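/- \textbf{Setting.} Put $\epsilon_1=1$, $\epsilon_2=\epsilon_3=-1$, indices in $\{1,2,3\}$ modulo $3$. Let $(M,\sigma,g)$ be a paraquaternionic Kähler manifold: $g$ is a semi-Riemannian metric on the smooth manifold $M$ with Levi-Civita connection $\overline\nabla$; $\sigma\subset \mathrm{End}(TM)$ is a rank-$3$ subbundle with local bases $\{J_1,J_2,J_3\}$ (canonical local bases) such that $J_\alpha^2=-\epsilon_\alpha \mathrm{Id}$ and $J_\alpha J_{\alpha+1}=-J_{\alpha+1}J_\alpha=\epsilon_{\alpha+2}J_{\alpha+2}$; $g(J_\alpha X,J_\alpha Y)=\epsilon_\alpha g(X,Y)$ for all $\alpha$ and every canonical local basis; and $\sigma$ is parallel with respect to $\overline\nabla$. Let $N$ be an immersed submanifold of $M$ such that the restriction of $g$ to $TN$ is non-degenerate, with second fundamental form $B$, shape operators $A_\xi$ and normal connection $\nabla^\perp$, so that, for $X,Y\in\Gamma(TN)$ and $\xi\in\Gamma(TN^\perp)$, $B(X,Y)$ is the normal part of $\overline\nabla_XY$, and $-A_\xi X$ and $\nabla^\perp_X\xi$ are the tangential and the normal part of $\overline\nabla_X\xi$.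 Suppose that $N$ is a paraquaternionic CR-submanifold: there is a non-degenerate smooth distribution $\mathcal D\subseteq TN$ such that $J_\alpha\mathcal D_x=\mathcal D_x$ and $J_\alpha\mathcal D^\perp_x\subset T_xN^\perp$ for every $x\in N$, every canonical local basis near $x$ and every $\alpha$, where $\mathcal D^\perp$ is the orthogonal complement of $\mathcal D$ in $TN$. Let $\nu^\perp=J_1\mathcal D^\perp\oplus J_2\mathcal D^\perp\oplus J_3\mathcal D^\perp\subseteq TN^\perp$ (it does not depend on the canonical local basis), and let $\nu$ be its orthogonal complement in $TN^\perp$. \textbf{Theorem.} The following assertions are equivalent: (i) $N$ is totally real ruled: $\mathcal D^\perp$ is the tangent distribution of a foliation of $N$ (there is an integral manifold of $\mathcal D^\perp$ through each point of $N$) whose leaves are totally geodesic immersed submanifolds of $M$. (ii) $N$ is $\mathcal D^\perp$-geodesic, that is, $B(X,Y)=0$ for all $X,Y\in\Gamma(\mathcal D^\perp)$, and $B(X,Y)\in\Gamma(\nu)$ for all $X\in\Gamma(\mathcal D)$, $Y\in\Gamma(\mathcal D^\perp)$. (iii) The subbundle $\nu^\perp$ is $\mathcal D^\perp$-parallel,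 that is, $\nabla^\perp_XJ_\alpha Z\in\Gamma(\nu^\perp)$ for all $X,Z\in\Gamma(\mathcal D^\perp)$, $\alpha\in\{1,2,3\}$ and every canonical local basis, and $B(X,Y)\in\Gamma(\nu)$ for all $X\in\Gamma(\mathcal D^\perp)$, $Y\in\Gamma(TN)$. (iv) $A_{J_\alpha Z}X=0$ for all $X,Z\in\Gamma(\mathcal D^\perp)$, $\alpha\in\{1,2,3\}$ and every canonical local basis, and $A_\xi X\in\Gamma(\mathcal D)$ for all $X\in\Gamma(\mathcal D^\perp)$, $\xi\in\Gamma(\nu)$. Here $\Gamma$ denotes smooth local sections. -/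

import Mathlib

open scoped Manifold ContDiff Topology
open Bundle

noncomputable section

namespace PQ

universe u

/-! ### Semi-Riemannian metrics and the Levi-Civita connection -/

section Sharp

variable {V : Type*} [AddCommGroup V] [Module ℝ V] [FiniteDimensional ℝ V]

/-- The vector dual to the functional `l` with respect to a non-degenerate bilinear form `b`,
that is, the unique `v` with `b v w = l w` for all `w` (see `apply_sharp`). -/
def sharp (b : V →ₗ[ℝ] V →ₗ[ℝ] ℝ) (hb : ∀ v, (∀ w, b v w = 0) → v = 0) (l : V →ₗ[ℝ] ℝ) : V :=
  (LinearEquiv.ofInjectiveOfFinrankEq b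
    ((injective_iff_map_eq_zero b).2 fun v hv => hb v fun w => by simp [hv])
    (Subspace.dual_finrank_eq (K := ℝ) (V := V)).symm).symm l

theorem apply_sharp (b : V →ₗ[ℝ] V →ₗ[ℝ] ℝ) (hb : ∀ v, (∀ w, b v w = 0) → v = 0)
    (l : V →ₗ[ℝ] ℝ) (w : V) : b (sharp b hb l) w = l w := by
  have h : b (sharp b hb l) = l := LinearEquiv.apply_symm_apply
    (LinearEquiv.ofInjectiveOfFinrankEq b
      ((injective_iff_map_eq_zero b).2 fun v hv => hb v fun w => by simp [hv])
      (Subspace.dual_finrank_eq (K := ℝ) (V := V)).symm) l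
  rw [h]

end Sharp

section Metric

variable (E : Type*) [NormedAddCommGroup E] [NormedSpace ℝ E]
  (M : Type*) [TopologicalSpace M] [ChartedSpace E M] [IsManifold 𝓘(ℝ, E) ∞ M]

/-- A smooth semi-Riemannian metric on `M`: a smooth field of non-degenerate symmetric bilinear
forms on the tangent spaces. -/
structure SemiRiemannianMetric where
  val (p : M) : TangentSpace 𝓘(ℝ, E) p →L[ℝ] TangentSpace 𝓘(ℝ, E) p →L[ℝ] ℝ
  symm (p : M) (v w : TangentSpace 𝓘(ℝ, E) p) : val p v w = val p w v
  nondegenerate (p : M) (v : TangentSpace 𝓘(ℝ, E) p) (hv : ∀ w, val p v w = 0) : v = 0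
  contMDiff : ContMDiff 𝓘(ℝ, E) (𝓘(ℝ, E).prod 𝓘(ℝ, E →L[ℝ] E →L[ℝ] ℝ)) ∞
    (fun p ↦ TotalSpace.mk' (E →L[ℝ] E →L[ℝ] ℝ) p (val p))

end Metric

section Sections

variable {E : Type*} [NormedAddCommGroup E] [NormedSpace ℝ E]
  {M : Type*} [TopologicalSpace M] [ChartedSpace E M] [IsManifold 𝓘(ℝ, E) ∞ M]
  {F : Type*} [NormedAddCommGroup F] [NormedSpace ℝ F]
  {N : Type*} [TopologicalSpace N] [ChartedSpace F N]

/-- The vector field `X` on `M` is smooth on `U`. -/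
def SmoothOn (U : Set M) (X : ∀ p : M, TangentSpace 𝓘(ℝ, E) p) : Prop :=
  ContMDiffOn 𝓘(ℝ, E) 𝓘(ℝ, E).tangent ∞ (fun p ↦ (⟨p, X p⟩ : TangentBundle 𝓘(ℝ, E) M)) U

variable (F) in
/-- The vector field `ξ` along the map `φ : N → M` is smooth on `U`, where `N` is a manifold
modelled on `F`. -/
def SmoothAlongOn (φ : N → M) (U : Set N) (ξ : ∀ y : N, TangentSpace 𝓘(ℝ, E) (φ y)) : Prop :=
  ContMDiffOn 𝓘(ℝ, F) 𝓘(ℝ, E).tangent ∞ (fun y ↦ (⟨φ y, ξ y⟩ : TangentBundle 𝓘(ℝ, E) M)) U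

variable (F) in
/-- `ξ` is a smooth section over `U` of the family `S` of subspaces of the pull-back of `TM`
by `φ`. -/
structure IsSectionAlong (φ : N → M) (S : ∀ y : N, Submodule ℝ (TangentSpace 𝓘(ℝ, E) (φ y)))
    (U : Set N) (ξ : ∀ y : N, TangentSpace 𝓘(ℝ, E) (φ y)) : Prop where
  smooth : SmoothAlongOn F φ U ξ
  mem : ∀ y ∈ U, ξ y ∈ S y

/-- `X` is a smooth section over `U` of the family `D` of tangent subspaces. -/
structure IsSection (D : ∀ p : M, Submodule ℝ (TangentSpace 𝓘(ℝ, E) p)) (U : Set M)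
    (X : ∀ p : M, TangentSpace 𝓘(ℝ, E) p) : Prop where
  smooth : SmoothOn U X
  mem : ∀ p ∈ U, X p ∈ D p

/-- A smooth distribution (a smooth subbundle of the tangent bundle): near each point it has a
smooth frame. -/
def IsDistribution (D : ∀ p : M, Submodule ℝ (TangentSpace 𝓘(ℝ, E) p)) : Prop :=
  ∀ p : M, ∃ U : Set M, IsOpen U ∧ p ∈ U ∧
    ∃ (r : ℕ) (X : Fin r → ∀ q : M, TangentSpace 𝓘(ℝ, E) q),
      (∀ i, SmoothOn U (X i)) ∧
      ∀ q ∈ U, LinearIndependent ℝ (fun i ↦ X i q) ∧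
        Submodule.span ℝ (Set.range fun i ↦ X i q) = D q

end Sections

section LeviCivita

variable {E : Type*} [NormedAddCommGroup E] [NormedSpace ℝ E]
  {M : Type*} [TopologicalSpace M] [ChartedSpace E M] [IsManifold 𝓘(ℝ, E) ∞ M]
  {F : Type*} [NormedAddCommGroup F] [NormedSpace ℝ F]
  {N : Type*} [TopologicalSpace N] [ChartedSpace F N]

/-- The linear map `T_q M → E` reading tangent vectors at `q` in the preferred chart at `p`. -/
def toCoord (p q : M) : TangentSpace 𝓘(ℝ, E) q →L[ℝ] E :=
  (trivializationAt E (TangentSpace 𝓘(ℝ, E)) p).continuousLinearMapAt ℝ q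

/-- The linear map `E → T_q M`, inverse to `toCoord p q` for `q` in the domain of the preferred
chart at `p`. -/
def ofCoord (p q : M) : E →L[ℝ] TangentSpace 𝓘(ℝ, E) q :=
  (trivializationAt E (TangentSpace 𝓘(ℝ, E)) p).symmL ℝ q

namespace SemiRiemannianMetric

variable (g : SemiRiemannianMetric E M)

/-- The bilinear form on `T_p M`. -/
def form (p : M) : TangentSpace 𝓘(ℝ, E) p →ₗ[ℝ] TangentSpace 𝓘(ℝ, E) p →ₗ[ℝ] ℝ :=
  LinearMap.mk₂ ℝ (fun v w ↦ g.val p v w) (by simp) (by simp) (by simp) (by simp)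

/-- The matrix of the metric at `q` in the preferred chart at `p`. -/
def coeff (p q : M) : E →L[ℝ] E →L[ℝ] ℝ :=
  ((ofCoord p q).precomp ℝ).comp ((g.val q).comp (ofCoord p q))

/-- The derivative at `p`, in the direction `v`, of the matrix of the metric in the preferred
chart at `p`. -/
def dcoeff (p : M) : TangentSpace 𝓘(ℝ, E) p →L[ℝ] (E →L[ℝ] E →L[ℝ] ℝ) :=
  mvfderiv 𝓘(ℝ, E) (g.coeff p) p

/-- The functional
`z ↦ (∂_v g(w, z) + ∂_w g(v, z) - ∂_z g(v, w)) / 2` in the preferred chart at `p`. -/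
def koszul (p : M) (v w : TangentSpace 𝓘(ℝ, E) p) : TangentSpace 𝓘(ℝ, E) p →ₗ[ℝ] ℝ where
  toFun z := (g.dcoeff p v (toCoord p p w) (toCoord p p z)
    + g.dcoeff p w (toCoord p p v) (toCoord p p z)
    - g.dcoeff p z (toCoord p p v) (toCoord p p w)) / 2
  map_add' z z' := by
    rw [(toCoord p p).map_add, (g.dcoeff p).map_add, ContinuousLinearMap.map_add,
      ContinuousLinearMap.map_add, add_apply, add_apply]
    ring
  map_smul' c z := by
    rw [(toCoord p p).map_smul, (g.dcoeff p).map_smul, ContinuousLinearMap.map_smul,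
      ContinuousLinearMap.map_smul, smul_apply,
      smul_apply]
    simp only [smul_eq_mul, RingHom.id_apply]
    ring

variable [FiniteDimensional ℝ E]

instance (p : M) : FiniteDimensional ℝ (TangentSpace 𝓘(ℝ, E) p) :=
  inferInstanceAs (FiniteDimensional ℝ E)

/-- The Christoffel symbols `v^i w^j Γ^k_{ij}` at `p` in the preferred chart at `p`. -/
def christoffel (p : M) (v w : TangentSpace 𝓘(ℝ, E) p) : TangentSpace 𝓘(ℝ, E) p :=
  sharp (g.form p) (g.nondegenerate p) (g.koszul p v w)

/-- The Levi-Civita connection of `g` on vector fields along a map `φ : N → M`: the covariant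
derivative `∇_u ξ` at `x`, in the direction `u ∈ T_x N`, of the vector field `ξ` along `φ`. In the
preferred chart at `φ x` its components are `u(ξ^k) + (φ_* u)^i ξ^j Γ^k_{ij}`. -/
def covAlong (φ : N → M) (ξ : ∀ y : N, TangentSpace 𝓘(ℝ, E) (φ y)) (x : N)
    (u : TangentSpace 𝓘(ℝ, F) x) : TangentSpace 𝓘(ℝ, E) (φ x) :=
  ofCoord (φ x) (φ x)
      (mvfderiv 𝓘(ℝ, F) (fun y ↦ toCoord (φ x) (φ y) (ξ y)) x u)
    + g.christoffel (φ x) (mfderiv 𝓘(ℝ, F) 𝓘(ℝ, E) φ x u) (ξ x)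

/-- The Levi-Civita connection of `g`: the covariant derivative `∇_v Y` at `p` of the vector field
`Y` on `M`. -/
def cov (Y : ∀ q : M, TangentSpace 𝓘(ℝ, E) q) (p : M) (v : TangentSpace 𝓘(ℝ, E) p) :
    TangentSpace 𝓘(ℝ, E) p :=
  g.covAlong (id : M → M) Y p v

end SemiRiemannianMetric

end LeviCivita

/-! ### Paraquaternionic structures -/

section Paraquaternionic

variable {E : Type*} [NormedAddCommGroup E] [NormedSpace ℝ E]
  {M : Type*} [TopologicalSpace M] [ChartedSpace E M] [IsManifold 𝓘(ℝ, E) ∞ M]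

/-- The signs `ε₁ = 1`, `ε₂ = ε₃ = -1`; the indices `1, 2, 3` modulo `3` are written
`0, 1, 2 : Fin 3`. -/
def eps : Fin 3 → ℝ := ![1, -1, -1]

/-- The field `S` of endomorphisms of the tangent spaces is smooth on `U`. -/
def SmoothEndOn (U : Set M)
    (S : ∀ p : M, TangentSpace 𝓘(ℝ, E) p →L[ℝ] TangentSpace 𝓘(ℝ, E) p) : Prop :=
  ContMDiffOn 𝓘(ℝ, E) (𝓘(ℝ, E).prod 𝓘(ℝ, E →L[ℝ] E)) ∞
    (fun p ↦ TotalSpace.mk' (E →L[ℝ] E) (E := fun q : M ↦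
      TangentSpace 𝓘(ℝ, E) q →L[ℝ] TangentSpace 𝓘(ℝ, E) q) p (S p)) U

/-- `J 0, J 1, J 2` is a canonical local basis on the open set `U` of the family `σ` of spaces of
endomorphisms. -/
structure IsCanonicalBasis
    (σ : ∀ p : M, Submodule ℝ (TangentSpace 𝓘(ℝ, E) p →L[ℝ] TangentSpace 𝓘(ℝ, E) p))
    (U : Set M)
    (J : Fin 3 → ∀ p : M, TangentSpace 𝓘(ℝ, E) p →L[ℝ] TangentSpace 𝓘(ℝ, E) p) : Prop where
  isOpen : IsOpen U
  smooth : ∀ α, SmoothEndOn U (J α)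
  linearIndependent : ∀ p ∈ U, LinearIndependent ℝ (fun α ↦ J α p)
  span_eq : ∀ p ∈ U, Submodule.span ℝ (Set.range fun α ↦ J α p) = σ p
  sq : ∀ p ∈ U, ∀ α v, J α p (J α p v) = -(eps α • v)
  mul_succ : ∀ p ∈ U, ∀ α v, J α p (J (α + 1) p v) = eps (α + 2) • J (α + 2) p v
  succ_mul : ∀ p ∈ U, ∀ α v, J (α + 1) p (J α p v) = -(eps (α + 2) • J (α + 2) p v)

/-- `σ` is an almost paraquaternionic structure on `M`: a rank-3 subbundle of `End(TM)` with
canonical local bases. -/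
def IsAlmostParaquaternionic
    (σ : ∀ p : M, Submodule ℝ (TangentSpace 𝓘(ℝ, E) p →L[ℝ] TangentSpace 𝓘(ℝ, E) p)) : Prop :=
  ∀ p : M, ∃ U : Set M, p ∈ U ∧ ∃ J, IsCanonicalBasis σ U J

/-- The metric `g` is adapted to `σ`. -/
def IsAdapted (g : SemiRiemannianMetric E M)
    (σ : ∀ p : M, Submodule ℝ (TangentSpace 𝓘(ℝ, E) p →L[ℝ] TangentSpace 𝓘(ℝ, E) p)) : Prop :=
  ∀ U J, IsCanonicalBasis σ U J → ∀ p ∈ U, ∀ α v w,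
    g.val p (J α p v) (J α p w) = eps α * g.val p v w

variable [FiniteDimensional ℝ E]

/-- `σ` is parallel with respect to the Levi-Civita connection: for each local section `S` of `σ`
and each tangent vector `v` at `p`, the endomorphism `∇_v S`, given by
`(∇_v S) Y = ∇_v (S Y) - S (∇_v Y)`, belongs to `σ p`. -/
def IsParallel (g : SemiRiemannianMetric E M)
    (σ : ∀ p : M, Submodule ℝ (TangentSpace 𝓘(ℝ, E) p →L[ℝ] TangentSpace 𝓘(ℝ, E) p)) : Prop :=
  ∀ (U : Set M) (S : ∀ p : M, TangentSpace 𝓘(ℝ, E) p →L[ℝ] TangentSpace 𝓘(ℝ, E) p),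
    IsOpen U → SmoothEndOn U S → (∀ p ∈ U, S p ∈ σ p) →
    ∀ p ∈ U, ∀ v : TangentSpace 𝓘(ℝ, E) p, ∃ T ∈ σ p,
      ∀ (W : Set M) (Y : ∀ q : M, TangentSpace 𝓘(ℝ, E) q),
        IsOpen W → p ∈ W → SmoothOn W Y →
        g.cov (fun q ↦ S q (Y q)) p v - S p (g.cov Y p v) = T (Y p)

/-- `(M, σ, g)` is a paraquaternionic Kähler manifold. -/
structure IsParaquaternionicKahler (g : SemiRiemannianMetric E M)
    (σ : ∀ p : M, Submodule ℝ (TangentSpace 𝓘(ℝ, E) p →L[ℝ] TangentSpace 𝓘(ℝ, E) p)) :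
    Prop where
  almost : IsAlmostParaquaternionic σ
  adapted : IsAdapted g σ
  parallel : IsParallel g σ

end Paraquaternionic

/-! ### Non-degenerate submanifolds -/

section Submanifold

variable {E : Type*} [NormedAddCommGroup E] [NormedSpace ℝ E]
  {M : Type*} [TopologicalSpace M] [ChartedSpace E M] [IsManifold 𝓘(ℝ, E) ∞ M]

/-- `N` as a non-degenerate immersed submanifold of `(M, g)`, given by its immersion. -/
structure NondegSubmanifold (g : SemiRiemannianMetric E M)
    (F : Type*) [NormedAddCommGroup F] [NormedSpace ℝ F]
    (N : Type*) [TopologicalSpace N] [ChartedSpace F N] [IsManifold 𝓘(ℝ, F) ∞ N] where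
  toFun : N → M
  contMDiff : ContMDiff 𝓘(ℝ, F) 𝓘(ℝ, E) ∞ toFun
  immersion : ∀ x, Function.Injective (mfderiv 𝓘(ℝ, F) 𝓘(ℝ, E) toFun x)
  nondegenerate : ∀ x (u : TangentSpace 𝓘(ℝ, F) x),
    (∀ w : TangentSpace 𝓘(ℝ, F) x, g.val (toFun x) (mfderiv 𝓘(ℝ, F) 𝓘(ℝ, E) toFun x u)
      (mfderiv 𝓘(ℝ, F) 𝓘(ℝ, E) toFun x w) = 0) → u = 0

namespace NondegSubmanifold

variable {g : SemiRiemannianMetric E M}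
  {F : Type*} [NormedAddCommGroup F] [NormedSpace ℝ F]
  {N : Type*} [TopologicalSpace N] [ChartedSpace F N] [IsManifold 𝓘(ℝ, F) ∞ N]
  (f : NondegSubmanifold g F N)

/-- The differential of the immersion at `x`. -/
def d (x : N) : TangentSpace 𝓘(ℝ, F) x →L[ℝ] TangentSpace 𝓘(ℝ, E) (f.toFun x) :=
  mfderiv 𝓘(ℝ, F) 𝓘(ℝ, E) f.toFun x

/-- The induced metric on `N`. -/
def induced (x : N) : TangentSpace 𝓘(ℝ, F) x →ₗ[ℝ] TangentSpace 𝓘(ℝ, F) x →ₗ[ℝ] ℝ :=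
  LinearMap.mk₂ ℝ (fun u w ↦ g.val (f.toFun x) (f.d x u) (f.d x w))
    (by simp) (by simp) (by simp) (by simp)

/-- The normal space `T_x N^⊥`. -/
def normalSpace (x : N) : Submodule ℝ (TangentSpace 𝓘(ℝ, E) (f.toFun x)) where
  carrier := {ξ | ∀ u, g.val (f.toFun x) ξ (f.d x u) = 0}
  add_mem' ha hb u := by simp [ha u, hb u]
  zero_mem' u := by simp
  smul_mem' c ξ h u := by simp [h u]

variable [FiniteDimensional ℝ F]

/-- The tangential part of a vector `v` of `M` at a point of `N`: the vector of `T_x N` with the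
same scalar products as `v` with all vectors tangent to `N`. -/
def tangentPart (x : N) (v : TangentSpace 𝓘(ℝ, E) (f.toFun x)) : TangentSpace 𝓘(ℝ, F) x :=
  sharp (f.induced x) (f.nondegenerate x)
    ((g.val (f.toFun x) v).toLinearMap ∘ₗ (f.d x).toLinearMap)

/-- The normal part of a vector of `M` at a point of `N`. -/
def normalPart (x : N) (v : TangentSpace 𝓘(ℝ, E) (f.toFun x)) :
    TangentSpace 𝓘(ℝ, E) (f.toFun x) :=
  v - f.d x (f.tangentPart x v)

variable [FiniteDimensional ℝ E]

/-- The second fundamental form `B(X, Y)` at `x`: the normal part of `∇_X Y`, where `∇` is the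
Levi-Civita connection of `M`. -/
def secondFundamentalForm (X Y : ∀ y : N, TangentSpace 𝓘(ℝ, F) y) (x : N) :
    TangentSpace 𝓘(ℝ, E) (f.toFun x) :=
  f.normalPart x (g.covAlong f.toFun (fun y ↦ f.d y (Y y)) x (X x))

/-- The shape operator `A_ξ X` at `x`: minus the tangential part of `∇_X ξ`. -/
def shape (ξ : ∀ y : N, TangentSpace 𝓘(ℝ, E) (f.toFun y)) (X : ∀ y : N, TangentSpace 𝓘(ℝ, F) y)
    (x : N) : TangentSpace 𝓘(ℝ, F) x :=
  -f.tangentPart x (g.covAlong f.toFun ξ x (X x))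

/-- The normal connection `∇^⊥_X ξ` at `x`: the normal part of `∇_X ξ`. -/
def normalConnection (X : ∀ y : N, TangentSpace 𝓘(ℝ, F) y)
    (ξ : ∀ y : N, TangentSpace 𝓘(ℝ, E) (f.toFun y)) (x : N) :
    TangentSpace 𝓘(ℝ, E) (f.toFun x) :=
  f.normalPart x (g.covAlong f.toFun ξ x (X x))

/-- The submanifold is totally geodesic: its second fundamental form vanishes. -/
def IsTotallyGeodesic : Prop :=
  ∀ U : Set N, IsOpen U → ∀ X Y : ∀ y : N, TangentSpace 𝓘(ℝ, F) y,
    SmoothOn U X → SmoothOn U Y →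
    ∀ x ∈ U, f.secondFundamentalForm X Y x = 0

end NondegSubmanifold

end Submanifold

/-! ### Paraquaternionic CR-submanifolds -/

section CR

variable {E : Type*} [NormedAddCommGroup E] [NormedSpace ℝ E]
  {M : Type*} [TopologicalSpace M] [ChartedSpace E M] [IsManifold 𝓘(ℝ, E) ∞ M]
  {g : SemiRiemannianMetric E M}
  {F : Type*} [NormedAddCommGroup F] [NormedSpace ℝ F]
  {N : Type u} [TopologicalSpace N] [ChartedSpace F N] [IsManifold 𝓘(ℝ, F) ∞ N]

namespace NondegSubmanifold

variable (f : NondegSubmanifold g F N)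
  (σ : ∀ p : M, Submodule ℝ (TangentSpace 𝓘(ℝ, E) p →L[ℝ] TangentSpace 𝓘(ℝ, E) p))
  (D : ∀ x : N, Submodule ℝ (TangentSpace 𝓘(ℝ, F) x))

/-- `D^⊥`: the orthogonal complement of `D` in the tangent spaces of `N`. -/
def perp (x : N) : Submodule ℝ (TangentSpace 𝓘(ℝ, F) x) where
  carrier := {u | ∀ w ∈ D x, f.induced x u w = 0}
  add_mem' ha hb w hw := by simp [ha w hw, hb w hw]
  zero_mem' w _ := by simp
  smul_mem' c u h w hw := by simp [h w hw]

/-- `N` is a paraquaternionic CR-submanifold with paraquaternionic distribution `D`. -/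
structure IsParaquaternionicCR : Prop where
  isDistribution : IsDistribution D
  nondegenerate : ∀ x, ∀ u ∈ D x, (∀ w ∈ D x, f.induced x u w = 0) → u = 0
  paraquaternionic : ∀ U J, IsCanonicalBasis σ U J → ∀ x, f.toFun x ∈ U → ∀ α,
    ((D x).map (f.d x).toLinearMap).map (J α (f.toFun x)).toLinearMap
      = (D x).map (f.d x).toLinearMap
  totallyReal : ∀ U J, IsCanonicalBasis σ U J → ∀ x, f.toFun x ∈ U → ∀ α,
    ∀ z ∈ f.perp D x, J α (f.toFun x) (f.d x z) ∈ f.normalSpace x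

/-- `ν^⊥`: the space spanned by the vectors `S Z` with `S ∈ σ`, `Z ∈ D^⊥`, that is,
`J₁ D^⊥ + J₂ D^⊥ + J₃ D^⊥` for each canonical local basis. -/
def nuPerp (x : N) : Submodule ℝ (TangentSpace 𝓘(ℝ, E) (f.toFun x)) :=
  Submodule.span ℝ {η | ∃ S ∈ σ (f.toFun x), ∃ z ∈ f.perp D x, η = S (f.d x z)}

/-- `ν`: the orthogonal complement of `ν^⊥` in the normal space. -/
def nu (x : N) : Submodule ℝ (TangentSpace 𝓘(ℝ, E) (f.toFun x)) where
  carrier := {ξ | ξ ∈ f.normalSpace x ∧ ∀ η ∈ f.nuPerp σ D x, g.val (f.toFun x) ξ η = 0}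
  add_mem' ha hb := ⟨add_mem ha.1 hb.1, fun η hη => by simp [ha.2 η hη, hb.2 η hη]⟩
  zero_mem' := ⟨zero_mem _, fun η _ => by simp⟩
  smul_mem' c ξ h := ⟨Submodule.smul_mem _ c h.1, fun η hη => by simp [h.2 η hη]⟩

end NondegSubmanifold

/-- `ι : L → N` is a connected immersed integral manifold of the distribution `D` on `N`. -/
structure IsIntegralManifold (D : ∀ x : N, Submodule ℝ (TangentSpace 𝓘(ℝ, F) x))
    {G : Type*} [NormedAddCommGroup G] [NormedSpace ℝ G]
    {L : Type*} [TopologicalSpace L] [ChartedSpace G L] (ι : L → N) : Prop where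
  connected : ConnectedSpace L
  contMDiff : ContMDiff 𝓘(ℝ, G) 𝓘(ℝ, F) ∞ ι
  injective : Function.Injective ι
  immersion : ∀ y, Function.Injective (mfderiv 𝓘(ℝ, G) 𝓘(ℝ, F) ι y)
  range_eq : ∀ y, (mfderiv 𝓘(ℝ, G) 𝓘(ℝ, F) ι y).range = D (ι y)

namespace NondegSubmanifold

variable (f : NondegSubmanifold g F N)
  (σ : ∀ p : M, Submodule ℝ (TangentSpace 𝓘(ℝ, E) p →L[ℝ] TangentSpace 𝓘(ℝ, E) p))
  (D : ∀ x : N, Submodule ℝ (TangentSpace 𝓘(ℝ, F) x))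
  [FiniteDimensional ℝ E] [FiniteDimensional ℝ F]

/-- `N` is totally real ruled: `D^⊥` is the tangent distribution of a foliation of `N`, that is,
there is an integral manifold of `D^⊥` through each point, and the leaves of this foliation are
totally geodesic immersed submanifolds of `M`. The leaves are the maximal connected integral
manifolds; the condition is imposed on every connected integral manifold. -/
def IsTotallyRealRuled : Prop :=
  (∀ x : N, ∃ (s : ℕ) (L : Type u) (_ : TopologicalSpace L)
    (_ : ChartedSpace (EuclideanSpace ℝ (Fin s)) L)
    (_ : IsManifold 𝓘(ℝ, EuclideanSpace ℝ (Fin s)) ∞ L) (ι : L → N),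
    IsIntegralManifold (G := EuclideanSpace ℝ (Fin s)) (f.perp D) ι ∧ x ∈ Set.range ι) ∧
  ∀ (s : ℕ) (L : Type u) [TopologicalSpace L] [ChartedSpace (EuclideanSpace ℝ (Fin s)) L]
    [IsManifold 𝓘(ℝ, EuclideanSpace ℝ (Fin s)) ∞ L] (ι : L → N),
    IsIntegralManifold (G := EuclideanSpace ℝ (Fin s)) (f.perp D) ι →
    ∃ h : NondegSubmanifold g (EuclideanSpace ℝ (Fin s)) L,
      h.toFun = f.toFun ∘ ι ∧ h.IsTotallyGeodesic

/-- `B(X, Y) = 0` for all sections `X, Y` of `D^⊥`. -/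
def IsPerpGeodesic : Prop :=
  ∀ U : Set N, IsOpen U → ∀ X Y : ∀ y : N, TangentSpace 𝓘(ℝ, F) y,
    IsSection (f.perp D) U X → IsSection (f.perp D) U Y →
    ∀ x ∈ U, f.secondFundamentalForm X Y x = 0

end NondegSubmanifold

end CR

end PQ

end

/-!
All four conditions say the same thing: `D^⊥` is parallel along itself, that is,
`∇̄_X Z ∈ Γ(D^⊥)` for `X, Z ∈ Γ(D^⊥)`. Let `X` and `W` be tangent to `N` and `Z ∈ Γ(D^⊥)`. Since `σ`
is parallel, `(∇̄_X J_α) Z` is a combination of `J₁ Z`, `J₂ Z`, `J₃ Z`, so it is normal to `N`, and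
with the Weingarten equation `g(∇̄_X Z, J_α W) = g(J_α Z, B(X, W))`. This turns every condition into
the same pointwise condition on the second fundamental form.

If `D^⊥` is parallel along itself, it is involutive because `∇̄` is torsion free. Near each point it
is spanned by fields `P v`, where `P` is a smooth family of projections with constant kernel; their
brackets lie both in `D^⊥` and in that kernel, so they vanish, and the total differential equation
`dk = P j` yields the integral manifold.
-/

noncomputable section

namespace PQ

universe u

section TotalDifferentialEquation

open Metric Set
open scoped NNReal

theorem gronwallBound_zero_left (K ε x : ℝ) :
    gronwallBound 0 K ε x = ε * gronwallBound 0 K 1 x := by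
  unfold gronwallBound
  split_ifs <;> ring

theorem exists_eventually_norm_le_of_continuousAt {X W : Type*} [TopologicalSpace X]
    [SeminormedAddCommGroup W] {f : X → W} {q₀ : X} (hf : ContinuousAt f q₀) :
    ∃ C : ℝ≥0, ∀ᶠ p in 𝓝 q₀, ‖f p‖ ≤ C :=
  ⟨‖f q₀‖₊ + 1, hf.norm.eventually_le_const (lt_add_one _)⟩

variable {V : Type*} [NormedAddCommGroup V] [NormedSpace ℝ V]
  {F : Type*} [NormedAddCommGroup F] [NormedSpace ℝ F]

theorem exists_hasDerivWithinAt_mem_closedBall [CompleteSpace F] {f : ℝ → F → F} {tmin tmax : ℝ}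
    {t₀ : Icc tmin tmax} {x₀ x : F} {a r L K : ℝ≥0} (hf : IsPicardLindelof f t₀ x₀ a r L K)
    (hx : x ∈ closedBall x₀ r) :
    ∃ c : ℝ → F, c t₀ = x ∧ (∀ t, c t ∈ closedBall x₀ a) ∧
      ∀ t ∈ Icc tmin tmax, HasDerivWithinAt c (f t (c t)) (Icc tmin tmax) t := by
  obtain ⟨α, hα⟩ := ODE.FunSpace.exists_isFixedPt_next hf hx
  refine ⟨α.compProj, by rw [ODE.FunSpace.compProj_val, ← hα, ODE.FunSpace.next_apply₀],
    fun t ↦ α.compProj_mem_closedBall hf.mul_max_le, fun t ht ↦ ?_⟩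
  refine (ODE.hasDerivWithinAt_picard_Icc t₀.2 hf.continuousOn_uncurry
    α.continuous_compProj.continuousOn (fun _ _ ↦ α.compProj_mem_closedBall hf.mul_max_le)
    x ht).congr_of_mem (fun t' ht' ↦ ?_) ht
  nth_rw 1 [← hα]
  rw [ODE.FunSpace.compProj_of_mem ht', ODE.FunSpace.next_apply]

theorem norm_sub_sub_fderiv_le {A : F → V} {s : Set F} {K : ℝ} (hs : Convex ℝ s)
    (hA : ∀ p ∈ s, DifferentiableAt ℝ A p)
    (hK : ∀ p ∈ s, ∀ p' ∈ s, ‖fderiv ℝ A p - fderiv ℝ A p'‖ ≤ K * ‖p - p'‖) (hK0 : 0 ≤ K)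
    {p q : F} (hp : p ∈ s) (hq : q ∈ s) :
    ‖A q - A p - fderiv ℝ A p (q - p)‖ ≤ K * ‖q - p‖ ^ 2 := by
  have hseg : segment ℝ p q ⊆ s := hs.segment_subset hp hq
  rw [sq, ← mul_assoc]
  refine Convex.norm_image_sub_le_of_norm_fderiv_le' (𝕜 := ℝ) (s := segment ℝ p q)
    (fun y hy ↦ hA y (hseg hy)) (fun y hy ↦ (hK y (hseg hy) p hp).trans ?_)
    (convex_segment p q) (left_mem_segment ℝ p q) (right_mem_segment ℝ p q)
  gcongr
  obtain ⟨θ, hθ, rfl⟩ := (segment_eq_image' ℝ p q) ▸ hy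
  rw [add_sub_cancel_left, norm_smul, Real.norm_of_nonneg hθ.1]
  exact mul_le_of_le_one_left (norm_nonneg _) hθ.2

/-- Quantitative hypotheses on `s` for the total differential equation `Du = A(u)`: bounds on `A`,
its derivative and the Lipschitz constant of its derivative, and the integrability condition of
Frobenius, which expresses the symmetry of the second derivative of a solution. -/
structure IsIntegrableWithBounds (A : F → V →L[ℝ] F) (s : Set F) (C K K' : ℝ≥0) : Prop where
  differentiableAt : ∀ p ∈ s, DifferentiableAt ℝ A p
  norm_le : ∀ p ∈ s, ‖A p‖ ≤ C
  norm_fderiv_le : ∀ p ∈ s, ‖fderiv ℝ A p‖ ≤ K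
  norm_fderiv_sub_le : ∀ p ∈ s, ∀ p' ∈ s, ‖fderiv ℝ A p - fderiv ℝ A p'‖ ≤ K' * ‖p - p'‖
  fderiv_symm : ∀ p ∈ s, ∀ h k, fderiv ℝ A p (A p h) k = fderiv ℝ A p (A p k) h

/-- The curve `c` is the restriction `c t = u (t x)` to a ray of the prospective solution `u` of
`Du = A(u)`, `u 0 = q₀`; it stays in `s`. -/
structure IsRadialSolution (A : F → V →L[ℝ] F) (s : Set F) (q₀ : F) (x : V) (c : ℝ → F) :
    Prop where
  zero : c 0 = q₀
  mem : ∀ t, c t ∈ s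
  hasDerivWithinAt : ∀ t ∈ Icc (0 : ℝ) 1, HasDerivWithinAt c (A (c t) x) (Icc 0 1) t

namespace IsIntegrableWithBounds

variable {A : F → V →L[ℝ] F} {s : Set F} {C K K' : ℝ≥0} (hA : IsIntegrableWithBounds A s C K K')
include hA

theorem lipschitzOnWith_apply (hs : Convex ℝ s) {x : V} (hx : ‖x‖ ≤ 1) :
    LipschitzOnWith K (fun p ↦ A p x) s := by
  refine LipschitzOnWith.of_dist_le_mul fun p hp p' hp' ↦ ?_
  rw [dist_eq_norm, dist_eq_norm, ← sub_apply]
  calc ‖(A p - A p') x‖ ≤ ‖A p - A p'‖ * 1 := (A p - A p').le_of_opNorm_le_of_le le_rfl hx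
    _ = ‖A p - A p'‖ := mul_one _
    _ ≤ K * ‖p - p'‖ := hs.norm_image_sub_le_of_norm_fderiv_le (𝕜 := ℝ)
      hA.differentiableAt hA.norm_fderiv_le hp' hp

/-- The left-hand side compares the velocity of `t ↦ c t + t A(c t) h`, where `c` solves the
equation in the direction `x` and `q = c t`, with the one prescribed by the equation in the
direction `x + h`. Integrability cancels the terms of first order in `h`. -/
theorem norm_velocity_sub_le (hs : Convex ℝ s) {q : F} (hq : q ∈ s) {t : ℝ}
    (ht : t ∈ Icc (0 : ℝ) 1) {x h : V} (hqh : q + t • A q h ∈ s) (hxh : ‖x + h‖ ≤ 1) :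
    ‖(A q x + (A q h + t • fderiv ℝ A q (A q x) h)) - A (q + t • A q h) (x + h)‖
      ≤ (K * C + K' * C ^ 2) * ‖h‖ ^ 2 := by
  set w := t • A q h with hw
  have hwn : ‖w‖ ≤ C * ‖h‖ := by
    rw [hw, norm_smul, Real.norm_of_nonneg ht.1]
    exact (mul_le_of_le_one_left (norm_nonneg _) ht.2).trans
      ((A q).le_of_opNorm_le (hA.norm_le q hq) h)
  set ρ := A (q + w) - A q - fderiv ℝ A q w with hρ
  have taylor : ‖ρ‖ ≤ K' * ‖w‖ ^ 2 := by
    simpa only [add_sub_cancel_left] using norm_sub_sub_fderiv_le hs hA.differentiableAt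
      hA.norm_fderiv_sub_le K'.2 hq hqh
  have difference_eq : (A q x + (A q h + t • fderiv ℝ A q (A q x) h)) - A (q + w) (x + h)
      = -(fderiv ℝ A q w h + ρ (x + h)) := by
    rw [show A (q + w) = A q + fderiv ℝ A q w + ρ by rw [hρ]; abel, hA.fderiv_symm q hq x h]
    simp only [add_apply, map_add, hw, map_smul, smul_apply]
    module
  have quadratic : ‖fderiv ℝ A q w h‖ ≤ K * C * ‖h‖ ^ 2 := by
    calc ‖fderiv ℝ A q w h‖ ≤ K * (C * ‖h‖) * ‖h‖ := ContinuousLinearMap.le_of_opNorm_le _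
          ((fderiv ℝ A q).le_of_opNorm_le_of_le (hA.norm_fderiv_le q hq) hwn) h
      _ = K * C * ‖h‖ ^ 2 := by ring
  have remainder : ‖ρ (x + h)‖ ≤ K' * C ^ 2 * ‖h‖ ^ 2 := by
    calc ‖ρ (x + h)‖ ≤ K' * ‖w‖ ^ 2 * 1 := ρ.le_of_opNorm_le_of_le taylor hxh
      _ ≤ K' * (C * ‖h‖) ^ 2 * 1 := by gcongr
      _ = K' * C ^ 2 * ‖h‖ ^ 2 := by ring
  rw [difference_eq, norm_neg, add_mul]
  exact (norm_add_le _ _).trans (add_le_add quadratic remainder)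

end IsIntegrableWithBounds

namespace IsRadialSolution

variable {A : F → V →L[ℝ] F} {s : Set F} {q₀ : F} {x : V} {c : ℝ → F}

theorem continuousOn (hc : IsRadialSolution A s q₀ x c) : ContinuousOn c (Icc 0 1) :=
  fun t ht ↦ (hc.hasDerivWithinAt t ht).continuousWithinAt

theorem hasDerivWithinAt_Ici (hc : IsRadialSolution A s q₀ x c) {t : ℝ} (ht : t ∈ Ico (0 : ℝ) 1) :
    HasDerivWithinAt c (A (c t) x) (Ici t) t :=
  (hc.hasDerivWithinAt t (Ico_subset_Icc_self ht)).mono_of_mem_nhdsWithin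
    (Icc_mem_nhdsGE_of_mem ht)

theorem one_eq_of_direction_zero (hc : IsRadialSolution A s q₀ 0 c) : c 1 = q₀ := by
  rw [← hc.zero]
  exact constant_of_has_deriv_right_zero hc.continuousOn
    (fun t ht ↦ by simpa only [map_zero] using hc.hasDerivWithinAt_Ici ht) 1 (by simp)

theorem hasDerivWithinAt_variation (hc : IsRadialSolution A s q₀ x c) (h : V) {t : ℝ}
    (ht : t ∈ Icc (0 : ℝ) 1) (hA : DifferentiableAt ℝ A (c t)) :
    HasDerivWithinAt (fun t ↦ c t + t • A (c t) h)
      (A (c t) x + (A (c t) h + t • fderiv ℝ A (c t) (A (c t) x) h)) (Icc 0 1) t := by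
  have hc' := hc.hasDerivWithinAt t ht
  have hAc : HasDerivWithinAt (fun t ↦ A (c t) h) (fderiv ℝ A (c t) (A (c t) x) h)
      (Icc 0 1) t := by
    simpa using (hA.hasFDerivAt.comp_hasDerivWithinAt t hc').clm_apply
      (hasDerivWithinAt_const t _ h)
  refine (hc'.add ((hasDerivWithinAt_id t _).smul hAc)).congr_deriv ?_
  simp only [id, one_smul]
  abel

theorem norm_sub_sub_le {C K K' : ℝ≥0} {s' : Set F} (hA : IsIntegrableWithBounds A s C K K')
    (hs : Convex ℝ s) {h : V} {c' : ℝ → F} (hs' : s' ⊆ s)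
    (hc : IsRadialSolution A s' q₀ x c) (hc' : IsRadialSolution A s' q₀ (x + h) c')
    (hvar : ∀ t ∈ Icc (0 : ℝ) 1, c t + t • A (c t) h ∈ s) (hxh : ‖x + h‖ ≤ 1) :
    ‖c' 1 - c 1 - A (c 1) h‖
      ≤ (K * C + K' * C ^ 2) * gronwallBound 0 K 1 1 * ‖h‖ ^ 2 := by
  have hder : ∀ t ∈ Icc (0 : ℝ) 1, HasDerivWithinAt (fun t ↦ c t + t • A (c t) h)
      (A (c t) x + (A (c t) h + t • fderiv ℝ A (c t) (A (c t) x) h)) (Icc 0 1) t := fun t ht ↦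
    hc.hasDerivWithinAt_variation h ht (hA.differentiableAt _ (hs' (hc.mem t)))
  have gronwall := dist_le_of_approx_trajectories_ODE_of_mem (δ := 0) (εg := 0)
    (εf := (K * C + K' * C ^ 2) * ‖h‖ ^ 2) (v := fun _ p ↦ A p (x + h)) (s := fun _ ↦ s)
    (fun _ _ ↦ hA.lipschitzOnWith_apply hs hxh)
    (fun t ht ↦ (hder t ht).continuousWithinAt)
    (fun t ht ↦ (hder t (Ico_subset_Icc_self ht)).mono_of_mem_nhdsWithin
      (Icc_mem_nhdsGE_of_mem ht))
    (fun t ht ↦ by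
      rw [dist_eq_norm]
      exact hA.norm_velocity_sub_le hs (hs' (hc.mem t)) (Ico_subset_Icc_self ht)
        (hvar t (Ico_subset_Icc_self ht)) hxh)
    (fun t ht ↦ hvar t (Ico_subset_Icc_self ht))
    hc'.continuousOn (fun _ ht ↦ hc'.hasDerivWithinAt_Ici ht) (fun t _ ↦ by simp)
    (fun t _ ↦ hs' (hc'.mem t)) (by simp [hc.zero, hc'.zero]) 1 (by simp)
  rw [sub_zero, add_zero, gronwallBound_zero_left, one_smul, dist_comm, dist_eq_norm,
    ← sub_sub] at gronwall
  linarith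

end IsRadialSolution

namespace IsIntegrableWithBounds

variable {A : F → V →L[ℝ] F} {q₀ : F} {R : ℝ} {C K K' : ℝ≥0}

theorem exists_isRadialSolution [CompleteSpace F]
    (hA : IsIntegrableWithBounds A (ball q₀ (2 * R)) C K K') (hR : 0 < R) {r : ℝ} (hr : r ≤ 1)
    (hCr : C * r ≤ R) {x : V} (hx : ‖x‖ ≤ r) :
    ∃ c, IsRadialSolution A (closedBall q₀ R) q₀ x c := by
  have hsub : closedBall q₀ R ⊆ ball q₀ (2 * R) := closedBall_subset_ball (by linarith)
  have hPL : IsPicardLindelof (fun _ p ↦ A p x) (tmin := 0) (tmax := 1)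
      ⟨0, by simp⟩ q₀ ⟨R, hR.le⟩ 0 (C * ‖x‖₊) K :=
    { lipschitzOnWith := fun _ _ ↦
        (hA.lipschitzOnWith_apply (convex_ball _ _) (hx.trans hr)).mono hsub
      continuousOn := fun _ _ ↦ continuousOn_const
      norm_le := fun _ _ p hp ↦ (A p).le_of_opNorm_le (hA.norm_le p (hsub hp)) x
      mul_max_le := by
        change (C : ℝ) * ‖x‖ * max (1 - 0) (0 - 0) ≤ R - 0
        simpa using (mul_le_mul_of_nonneg_left hx C.2).trans hCr }
  obtain ⟨c, h0, hmem, hderiv⟩ :=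
    exists_hasDerivWithinAt_mem_closedBall hPL (mem_closedBall_self le_rfl)
  exact ⟨c, h0, hmem, hderiv⟩

theorem add_smul_apply_mem_ball (hA : IsIntegrableWithBounds A (ball q₀ (2 * R)) C K K')
    (hR : 0 < R) {p : F} (hp : p ∈ closedBall q₀ R) {t : ℝ} (ht : t ∈ Icc (0 : ℝ) 1) {h : V}
    (hh : C * ‖h‖ < R) : p + t • A p h ∈ ball q₀ (2 * R) := by
  have hAp : ‖A p h‖ ≤ C * ‖h‖ :=
    (A p).le_of_opNorm_le (hA.norm_le p (closedBall_subset_ball (by linarith) hp)) h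
  have htA : ‖t • A p h‖ ≤ ‖A p h‖ := by
    rw [norm_smul, Real.norm_of_nonneg ht.1]
    exact mul_le_of_le_one_left (norm_nonneg _) ht.2
  rw [mem_ball_iff_norm, add_sub_right_comm]
  rw [mem_closedBall_iff_norm] at hp
  linarith [norm_add_le (p - q₀) (t • A p h)]

theorem exists_hasFDerivAt [CompleteSpace F]
    (hA : IsIntegrableWithBounds A (ball q₀ (2 * R)) C K K') (hR : 0 < R) :
    ∃ r > 0, ∃ u : V → F, u 0 = q₀ ∧
      ∀ x ∈ ball (0 : V) r, u x ∈ closedBall q₀ R ∧ HasFDerivAt u (A (u x)) x := by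
  obtain ⟨r, hr, hr1, hCr⟩ : ∃ r > 0, r ≤ 1 ∧ C * r ≤ R := by
    refine ⟨min 1 (R / (C + 1)), by positivity, min_le_left _ _, ?_⟩
    calc (C : ℝ) * min 1 (R / (C + 1)) ≤ (C + 1) * (R / (C + 1)) :=
          mul_le_mul (by linarith) (min_le_right _ _) (by positivity) (by positivity)
      _ = R := by field_simp
  have hex : ∀ x : V, ∃ c, ‖x‖ ≤ r → IsRadialSolution A (closedBall q₀ R) q₀ x c := fun x ↦ by
    by_cases hx : ‖x‖ ≤ r
    · exact (hA.exists_isRadialSolution hR hr1 hCr hx).imp fun _ hc _ ↦ hc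
    · exact ⟨fun _ ↦ q₀, fun h ↦ absurd h hx⟩
  choose c hc using hex
  refine ⟨r, hr, fun x ↦ c x 1, (hc 0 (by simpa using hr.le)).one_eq_of_direction_zero,
    fun x hx ↦ ?_⟩
  have hxr : ‖x‖ < r := by simpa using hx
  refine ⟨(hc x hxr.le).mem 1, ?_⟩
  have hxh : ∀ᶠ h in 𝓝 (0 : V), ‖x + h‖ < r :=
    (Continuous.tendsto' (by fun_prop) _ _ (by simp)).eventually_lt_const hxr
  have hCh : ∀ᶠ h in 𝓝 (0 : V), C * ‖h‖ < R :=
    (Continuous.tendsto' (by fun_prop) _ _ (by simp)).eventually_lt_const hR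
  rw [hasFDerivAt_iff_isLittleO_nhds_zero]
  refine (Asymptotics.IsBigO.of_bound ((K * C + K' * C ^ 2) * gronwallBound 0 K 1 1) ?_
    ).trans_isLittleO (Asymptotics.isLittleO_norm_pow_id one_lt_two)
  filter_upwards [hxh, hCh] with h hxh hCh
  rw [norm_pow, norm_norm]
  exact IsRadialSolution.norm_sub_sub_le hA (convex_ball _ _)
    (closedBall_subset_ball (by linarith)) (hc x hxr.le) (hc (x + h) hxh.le)
    (fun t ht ↦ hA.add_smul_apply_mem_ball hR ((hc x hxr.le).mem t) ht hCh) (hxh.le.trans hr1)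

end IsIntegrableWithBounds

set_option synthInstance.maxHeartbeats 100000 in
-- The norm on the iterated space of operators `F →L[ℝ] V →L[ℝ] F` is slow to synthesize.
theorem exists_isIntegrableWithBounds {A : F → V →L[ℝ] F} {U : Set F} {q₀ : F}
    (hU : IsOpen U) (hq₀ : q₀ ∈ U) (hA : ContDiffOn ℝ 2 A U)
    (hs : ∀ p ∈ U, ∀ h k, fderiv ℝ A p (A p h) k = fderiv ℝ A p (A p k) h) :
    ∃ R > 0, ball q₀ (2 * R) ⊆ U ∧ ∃ C K K', IsIntegrableWithBounds A (ball q₀ (2 * R)) C K K' := by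
  have hA₀ : ContDiffAt ℝ 2 A q₀ := hA.contDiffAt (hU.mem_nhds hq₀)
  have hA' : ContDiffAt ℝ 1 (fderiv ℝ A) q₀ := hA₀.fderiv_right (by norm_num)
  obtain ⟨C, hC⟩ := exists_eventually_norm_le_of_continuousAt hA₀.continuousAt
  obtain ⟨K, hK⟩ := exists_eventually_norm_le_of_continuousAt hA'.continuousAt
  obtain ⟨K', s, hs₀, hK'⟩ := hA'.exists_lipschitzOnWith
  obtain ⟨ρ, hρ, hball⟩ :=
    Metric.eventually_nhds_iff_ball.1 (((hU.eventually_mem hq₀).and hs₀).and (hC.and hK))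
  rw [← mul_div_cancel₀ ρ two_ne_zero] at hball
  exact ⟨ρ / 2, half_pos hρ, fun p hp ↦ (hball p hp).1.1, C, K, K',
    { differentiableAt := fun p hp ↦
        (hA.contDiffAt (hU.mem_nhds (hball p hp).1.1)).differentiableAt (by simp)
      norm_le := fun p hp ↦ (hball p hp).2.1
      norm_fderiv_le := fun p hp ↦ (hball p hp).2.2
      norm_fderiv_sub_le := fun p hp p' hp' ↦ by
        simpa only [dist_eq_norm] using hK'.dist_le_mul p (hball p hp).1.2 p' (hball p' hp').1.2
      fderiv_symm := fun p hp ↦ hs p (hball p hp).1.1 }⟩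

theorem contDiffOn_of_hasFDerivAt_comp {A : F → V →L[ℝ] F} {U : Set F} (hA : ContDiffOn ℝ ∞ A U)
    {u : V → F} {s : Set V} (hs : IsOpen s) (hu : ∀ x ∈ s, u x ∈ U ∧ HasFDerivAt u (A (u x)) x) :
    ContDiffOn ℝ ∞ u s := by
  rw [contDiffOn_infty]
  intro n
  induction n with
  | zero => exact contDiffOn_zero.2 fun x hx ↦ (hu x hx).2.continuousAt.continuousWithinAt
  | succ n ih =>
    rw [Nat.cast_succ, contDiffOn_succ_iff_fderiv_of_isOpen hs]
    refine ⟨fun x hx ↦ (hu x hx).2.differentiableAt.differentiableWithinAt, by simp, ?_⟩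
    have hAu : ContDiffOn ℝ n (fun x ↦ A (u x)) s :=
      (hA.of_le (by exact_mod_cast le_top)).comp ih fun x hx ↦ (hu x hx).1
    exact hAu.congr fun x hx ↦ (hu x hx).2.fderiv

/-- The solution is obtained by solving the equation along rays; the integrability condition makes
the resulting function differentiable in all directions. -/
theorem exists_hasFDerivAt_of_fderiv_symm [CompleteSpace F] {A : F → V →L[ℝ] F} {U : Set F}
    {q₀ : F} (hU : IsOpen U) (hq₀ : q₀ ∈ U) (hA : ContDiffOn ℝ ∞ A U)
    (hs : ∀ p ∈ U, ∀ h k, fderiv ℝ A p (A p h) k = fderiv ℝ A p (A p k) h) :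
    ∃ r > 0, ∃ u : V → F, u 0 = q₀ ∧ ContDiffOn ℝ ∞ u (ball 0 r) ∧
      ∀ x ∈ ball (0 : V) r, u x ∈ U ∧ HasFDerivAt u (A (u x)) x := by
  obtain ⟨R, hR, hRU, C, K, K', hbounds⟩ :=
    exists_isIntegrableWithBounds hU hq₀ (mod_cast contDiffOn_infty.1 hA 2) hs
  obtain ⟨r, hr, u, hu₀, hu⟩ := hbounds.exists_hasFDerivAt hR
  have huU : ∀ x ∈ ball (0 : V) r, u x ∈ U ∧ HasFDerivAt u (A (u x)) x := fun x hx ↦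
    ⟨hRU (closedBall_subset_ball (by linarith) (hu x hx).1), (hu x hx).2⟩
  exact ⟨r, hr, u, hu₀, contDiffOn_of_hasFDerivAt_comp hA isOpen_ball huU, huU⟩

end TotalDifferentialEquation

section Calculus

variable {𝕜 : Type*} [NontriviallyNormedField 𝕜]
  {F : Type*} [NormedAddCommGroup F] [NormedSpace 𝕜 F]
  {H : Type*} [TopologicalSpace H] {I : ModelWithCorners 𝕜 F H}
  {N : Type*} [TopologicalSpace N] [ChartedSpace H N]
  {V W : Type*} [NormedAddCommGroup V] [NormedSpace 𝕜 V] [NormedAddCommGroup W] [NormedSpace 𝕜 W]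

theorem mvfderiv_comp_fderiv {h : N → V} {G : V → W} {x : N} (hG : DifferentiableAt 𝕜 G (h x))
    (hh : MDifferentiableAt I 𝓘(𝕜, V) h x) (u : TangentSpace I x) :
    mvfderiv I (fun y ↦ G (h y)) x u = fderiv 𝕜 G (h x) (mvfderiv I h x u) := by
  have chain := mfderiv_comp_apply x (I'' := 𝓘(𝕜, W)) hG.mdifferentiableAt hh u
  rw [mfderiv_eq_fderiv] at chain
  exact chain

theorem mvfderiv_comp_mfderiv {E : Type*} [NormedAddCommGroup E] [NormedSpace 𝕜 E]
    {H' : Type*} [TopologicalSpace H'] {I' : ModelWithCorners 𝕜 E H'}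
    {M : Type*} [TopologicalSpace M] [ChartedSpace H' M] {φ : N → M} {h : M → V} {x : N}
    (hh : MDifferentiableAt I' 𝓘(𝕜, V) h (φ x)) (hφ : MDifferentiableAt I I' φ x)
    (u : TangentSpace I x) :
    mvfderiv I (fun y ↦ h (φ y)) x u = mvfderiv I' h (φ x) (mfderiv I I' φ x u) :=
  mfderiv_comp_apply x hh hφ u

theorem mvfderiv_congr_of_eventuallyEq {h k : N → V} {x : N} (hk : h =ᶠ[𝓝 x] k) :
    mvfderiv I h x = mvfderiv I k x := by
  ext u
  exact congr($(hk.mfderiv_eq (I := I) (I' := 𝓘(𝕜, V))) u)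

theorem mvfderiv_prodMk {h : N → V} {k : N → W} {x : N}
    (hh : MDifferentiableAt I 𝓘(𝕜, V) h x) (hk : MDifferentiableAt I 𝓘(𝕜, W) k x)
    (u : TangentSpace I x) :
    mvfderiv I (fun y ↦ (h y, k y)) x u = (mvfderiv I h x u, mvfderiv I k x u) := by
  have hp : MDifferentiableAt I 𝓘(𝕜, V × W) (fun y ↦ (h y, k y)) x := hh.prodMk_space hk
  have fst_eq := mvfderiv_comp_fderiv (G := (Prod.fst : V × W → V)) differentiableAt_fst hp u
  have snd_eq := mvfderiv_comp_fderiv (G := (Prod.snd : V × W → W)) differentiableAt_snd hp u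
  rw [fderiv_fst] at fst_eq
  rw [fderiv_snd] at snd_eq
  exact Prod.ext fst_eq.symm snd_eq.symm

theorem mvfderiv_clm_apply {B : N → V →L[𝕜] W} {w : N → V} {x : N}
    (hB : MDifferentiableAt I 𝓘(𝕜, V →L[𝕜] W) B x) (hw : MDifferentiableAt I 𝓘(𝕜, V) w x)
    (u : TangentSpace I x) :
    mvfderiv I (fun y ↦ B y (w y)) x u = mvfderiv I B x u (w x) + B x (mvfderiv I w x u) := by
  have evaluation : IsBoundedBilinearMap 𝕜 fun p : (V →L[𝕜] W) × V ↦ p.1 p.2 :=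
    isBoundedBilinearMap_apply
  rw [mvfderiv_comp_fderiv (h := fun y ↦ (B y, w y)) (G := fun p ↦ p.1 p.2)
    (evaluation.differentiableAt _) (hB.prodMk_space hw), mvfderiv_prodMk hB hw, evaluation.fderiv]
  exact add_comm _ _

theorem mvfderiv_clm_apply_const {B : N → V →L[𝕜] W} {x : N}
    (hB : MDifferentiableAt I 𝓘(𝕜, V →L[𝕜] W) B x) (v : V) (u : TangentSpace I x) :
    mvfderiv I (fun y ↦ B y v) x u = mvfderiv I B x u v := by
  have const_eq : mvfderiv I (fun _ : N ↦ v) x u = 0 := congr($(mvfderiv_const v) u)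
  rw [mvfderiv_clm_apply hB mdifferentiableAt_const, const_eq, map_zero, add_zero]

theorem contMDiffAt_clm_of_apply [CompleteSpace 𝕜] [FiniteDimensional 𝕜 V] {n : WithTop ℕ∞}
    {B : N → V →L[𝕜] W} {x : N} (h : ∀ v, ContMDiffAt I 𝓘(𝕜, W) n (fun y ↦ B y v) x) :
    ContMDiffAt I 𝓘(𝕜, V →L[𝕜] W) n B x := by
  let b := Module.finBasis 𝕜 V
  have expansion : B = fun y ↦ ∑ i, ContinuousLinearMap.smulRightL 𝕜 V W
      (LinearMap.toContinuousLinearMap (b.coord i)) (B y (b i)) := by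
    ext y v
    conv_lhs => rw [← b.sum_repr v, map_sum]
    simp
  rw [expansion]
  exact ContMDiffAt.sum fun i _ ↦ (ContinuousLinearMap.contMDiff _).contMDiffAt.comp x (h (b i))

end Calculus

section Coordinates

theorem eventually_mem_chartAt_source {X H M : Type*} [TopologicalSpace X]
    [TopologicalSpace H] [TopologicalSpace M] [ChartedSpace H M] {φ : X → M} {x : X} {p : M}
    (hφ : ContinuousAt φ x) (hp : φ x ∈ (chartAt H p).source) :
    ∀ᶠ y in 𝓝 x, φ y ∈ (chartAt H p).source :=
  hφ.eventually_mem ((chartAt H p).open_source.mem_nhds hp)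

variable {E : Type*} [NormedAddCommGroup E] [NormedSpace ℝ E]
  {M : Type*} [TopologicalSpace M] [ChartedSpace E M] [IsManifold 𝓘(ℝ, E) ∞ M]
  {F : Type*} [NormedAddCommGroup F] [NormedSpace ℝ F]
  {N : Type*} [TopologicalSpace N] [ChartedSpace F N]

theorem toCoord_ofCoord {p q : M} (hq : q ∈ (chartAt E p).source) (b : E) :
    toCoord p q (ofCoord p q b) = b :=
  (trivializationAt E (TangentSpace 𝓘(ℝ, E)) p).continuousLinearMapAt_symmL hq b

theorem ofCoord_toCoord {p q : M} (hq : q ∈ (chartAt E p).source) (v : TangentSpace 𝓘(ℝ, E) q) :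
    ofCoord p q (toCoord p q v) = v :=
  (trivializationAt E (TangentSpace 𝓘(ℝ, E)) p).symmL_continuousLinearMapAt hq v

theorem toCoord_eq_mvfderiv {p q : M} (hq : q ∈ (chartAt E p).source) :
    toCoord p q = mvfderiv 𝓘(ℝ, E) (extChartAt 𝓘(ℝ, E) p) q :=
  TangentBundle.continuousLinearMapAt_trivializationAt hq

variable (F) in
/-- The vector field `ξ` along the map `φ : N → M` is smooth near `x`, where `N` is a manifold
modelled on `F`; for `φ = id` this is smoothness of a vector field on `N`. -/
def SmoothAlongAt (φ : N → M) (x : N) (ξ : ∀ y : N, TangentSpace 𝓘(ℝ, E) (φ y)) : Prop :=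
  ContMDiffAt 𝓘(ℝ, F) 𝓘(ℝ, E).tangent ∞ (fun y ↦ (⟨φ y, ξ y⟩ : TangentBundle 𝓘(ℝ, E) M)) x

theorem SmoothAlongOn.smoothAlongAt {φ : N → M} {U : Set N}
    {ξ : ∀ y : N, TangentSpace 𝓘(ℝ, E) (φ y)} (h : SmoothAlongOn F φ U ξ) (hU : IsOpen U) {x : N}
    (hx : x ∈ U) : SmoothAlongAt F φ x ξ :=
  ContMDiffOn.contMDiffAt h (hU.mem_nhds hx)

theorem SmoothOn.smoothAlongAt {U : Set M} {X : ∀ p : M, TangentSpace 𝓘(ℝ, E) p}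
    (h : SmoothOn U X) (hU : IsOpen U) {x : M} (hx : x ∈ U) : SmoothAlongAt E id x X :=
  ContMDiffOn.contMDiffAt h (hU.mem_nhds hx)

theorem smoothAlongAt_iff {φ : N → M} {x : N} {ξ : ∀ y : N, TangentSpace 𝓘(ℝ, E) (φ y)} {p : M}
    (hp : φ x ∈ (chartAt E p).source) :
    SmoothAlongAt F φ x ξ ↔ ContMDiffAt 𝓘(ℝ, F) 𝓘(ℝ, E) ∞ φ x ∧
      ContMDiffAt 𝓘(ℝ, F) 𝓘(ℝ, E) ∞ (fun y ↦ toCoord p (φ y) (ξ y)) x := by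
  let e := trivializationAt E (TangentSpace 𝓘(ℝ, E)) p
  rw [SmoothAlongAt, e.contMDiffAt_iff (n := ∞)
    (f := fun y ↦ (⟨φ y, ξ y⟩ : TangentBundle 𝓘(ℝ, E) M)) (e.mem_source.2 hp)]
  refine and_congr_right fun hφ ↦ Filter.EventuallyEq.contMDiffAt_iff ?_
  filter_upwards [eventually_mem_chartAt_source hφ.continuousAt hp] with y hy
  exact (e.continuousLinearMapAt_apply_of_mem ℝ hy _).symm

theorem SmoothAlongAt.contMDiffAt {φ : N → M} {x : N} {ξ : ∀ y : N, TangentSpace 𝓘(ℝ, E) (φ y)}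
    (hξ : SmoothAlongAt F φ x ξ) : ContMDiffAt 𝓘(ℝ, F) 𝓘(ℝ, E) ∞ φ x :=
  ((smoothAlongAt_iff (mem_chart_source E (φ x))).1 hξ).1

theorem SmoothAlongAt.contMDiffAt_toCoord {φ : N → M} {x : N}
    {ξ : ∀ y : N, TangentSpace 𝓘(ℝ, E) (φ y)} (hξ : SmoothAlongAt F φ x ξ) {p : M}
    (hp : φ x ∈ (chartAt E p).source) :
    ContMDiffAt 𝓘(ℝ, F) 𝓘(ℝ, E) ∞ (fun y ↦ toCoord p (φ y) (ξ y)) x :=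
  ((smoothAlongAt_iff hp).1 hξ).2

theorem smoothAlongAt_ofCoord {φ : N → M} {x : N} {p : M} (hp : φ x ∈ (chartAt E p).source)
    (hφ : ContMDiffAt 𝓘(ℝ, F) 𝓘(ℝ, E) ∞ φ x) {w : N → E}
    (hw : ContMDiffAt 𝓘(ℝ, F) 𝓘(ℝ, E) ∞ w x) :
    SmoothAlongAt F φ x (fun y ↦ ofCoord p (φ y) (w y)) := by
  refine (smoothAlongAt_iff hp).2 ⟨hφ, hw.congr_of_eventuallyEq ?_⟩
  filter_upwards [eventually_mem_chartAt_source hφ.continuousAt hp] with y hy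
    using toCoord_ofCoord hy _

theorem smoothAlongAt_ofCoord_const {p q : M} (hq : q ∈ (chartAt E p).source) (b : E) :
    SmoothAlongAt E id q (fun r : M ↦ ofCoord p r b) :=
  smoothAlongAt_ofCoord (φ := id) (x := q) hq contMDiffAt_id contMDiffAt_const

theorem SmoothAlongAt.comp {G : Type*} [NormedAddCommGroup G] [NormedSpace ℝ G]
    {L : Type*} [TopologicalSpace L] [ChartedSpace G L] {φ : N → M} {ι : L → N} {y : L}
    {ξ : ∀ y : N, TangentSpace 𝓘(ℝ, E) (φ y)} (hξ : SmoothAlongAt F φ (ι y) ξ)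
    (hι : ContMDiffAt 𝓘(ℝ, G) 𝓘(ℝ, F) ∞ ι y) :
    SmoothAlongAt G (φ ∘ ι) y (fun z ↦ ξ (ι z)) :=
  ContMDiffAt.comp y hξ hι

variable [IsManifold 𝓘(ℝ, F) ∞ N]

theorem contDiffAt_chart_expression {φ : N → M} {x₀ z : N} {p : M}
    (hz : z ∈ (chartAt F x₀).source) (hp : φ z ∈ (chartAt E p).source)
    (hφ : ContMDiffAt 𝓘(ℝ, F) 𝓘(ℝ, E) ∞ φ z) :
    ContDiffAt ℝ ∞ (extChartAt 𝓘(ℝ, E) p ∘ φ ∘ (extChartAt 𝓘(ℝ, F) x₀).symm)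
      (extChartAt 𝓘(ℝ, F) x₀ z) := by
  have hz' : z ∈ (extChartAt 𝓘(ℝ, F) x₀).source := by rwa [extChartAt_source]
  have hinv : (extChartAt 𝓘(ℝ, F) x₀).symm (extChartAt 𝓘(ℝ, F) x₀ z) = z :=
    (extChartAt 𝓘(ℝ, F) x₀).left_inv hz'
  have smooth_symm : ContMDiffAt 𝓘(ℝ, F) 𝓘(ℝ, F) ∞ (extChartAt 𝓘(ℝ, F) x₀).symm
      (extChartAt 𝓘(ℝ, F) x₀ z) :=
    (contMDiffOn_extChartAt_symm x₀).contMDiffAt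
      (extChartAt_target_mem_nhds' ((extChartAt 𝓘(ℝ, F) x₀).map_source hz'))
  rw [← contMDiffAt_iff_contDiffAt]
  refine ContMDiffAt.comp (I' := 𝓘(ℝ, E)) _ ?_
    (ContMDiffAt.comp (I' := 𝓘(ℝ, F)) _ (by rwa [hinv]) smooth_symm)
  rw [Function.comp_apply, hinv]
  exact contMDiffAt_extChartAt' hp

theorem toCoord_mfderiv {φ : N → M} {x₀ z : N} {p : M}
    (hz : z ∈ (chartAt F x₀).source) (hp : φ z ∈ (chartAt E p).source)
    (hφ : ContMDiffAt 𝓘(ℝ, F) 𝓘(ℝ, E) ∞ φ z) (u : TangentSpace 𝓘(ℝ, F) z) :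
    toCoord p (φ z) (mfderiv 𝓘(ℝ, F) 𝓘(ℝ, E) φ z u)
      = fderiv ℝ (extChartAt 𝓘(ℝ, E) p ∘ φ ∘ (extChartAt 𝓘(ℝ, F) x₀).symm)
          (extChartAt 𝓘(ℝ, F) x₀ z) (toCoord x₀ z u) := by
  have hchart : MDifferentiableAt 𝓘(ℝ, F) 𝓘(ℝ, F) (extChartAt 𝓘(ℝ, F) x₀) z :=
    (contMDiffAt_extChartAt' (n := ∞) hz).mdifferentiableAt (by simp)
  have hchart' : MDifferentiableAt 𝓘(ℝ, E) 𝓘(ℝ, E) (extChartAt 𝓘(ℝ, E) p) (φ z) :=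
    (contMDiffAt_extChartAt' (n := ∞) hp).mdifferentiableAt (by simp)
  rw [toCoord_eq_mvfderiv hp, toCoord_eq_mvfderiv hz,
    ← mvfderiv_comp_fderiv
      ((contDiffAt_chart_expression hz hp hφ).differentiableAt (by simp)) hchart]
  refine (mvfderiv_comp_mfderiv hchart' (hφ.mdifferentiableAt (by simp)) u).symm.trans ?_
  refine congr($(mvfderiv_congr_of_eventuallyEq ?_) u)
  filter_upwards [(chartAt F x₀).open_source.mem_nhds hz] with y hy
  simp only [Function.comp_apply,
    (extChartAt 𝓘(ℝ, F) x₀).left_inv (by rwa [extChartAt_source] : y ∈ _)]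

theorem mfderiv_ofCoord {φ : N → M} {x₀ z : N} {p : M}
    (hz : z ∈ (chartAt F x₀).source) (hp : φ z ∈ (chartAt E p).source)
    (hφ : ContMDiffAt 𝓘(ℝ, F) 𝓘(ℝ, E) ∞ φ z) (b : F) :
    mfderiv 𝓘(ℝ, F) 𝓘(ℝ, E) φ z (ofCoord x₀ z b)
      = ofCoord p (φ z) (fderiv ℝ (extChartAt 𝓘(ℝ, E) p ∘ φ ∘ (extChartAt 𝓘(ℝ, F) x₀).symm)
          (extChartAt 𝓘(ℝ, F) x₀ z) b) := by
  rw [← ofCoord_toCoord hp (mfderiv _ _ _ _ _), toCoord_mfderiv hz hp hφ, toCoord_ofCoord hz]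

theorem smoothAlongAt_mfderiv {φ : N → M} {x : N} (hφ : ContMDiff 𝓘(ℝ, F) 𝓘(ℝ, E) ∞ φ)
    {Y : ∀ y : N, TangentSpace 𝓘(ℝ, F) y} (hY : SmoothAlongAt F id x Y) :
    SmoothAlongAt F φ x (fun y ↦ mfderiv 𝓘(ℝ, F) 𝓘(ℝ, E) φ y (Y y)) :=
  ContMDiffAt.comp x ((hφ.contMDiff_tangentMap (m := ∞) (by simp)).contMDiffAt) hY

end Coordinates

section LeviCivita

variable {E : Type*} [NormedAddCommGroup E] [NormedSpace ℝ E]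
  {M : Type*} [TopologicalSpace M] [ChartedSpace E M] [IsManifold 𝓘(ℝ, E) ∞ M]
  {F : Type*} [NormedAddCommGroup F] [NormedSpace ℝ F]
  {N : Type*} [TopologicalSpace N] [ChartedSpace F N]

namespace SemiRiemannianMetric

variable (g : SemiRiemannianMetric E M)

theorem contMDiffAt_val {φ : N → M} {x : N} {ξ η : ∀ y : N, TangentSpace 𝓘(ℝ, E) (φ y)}
    (hξ : SmoothAlongAt F φ x ξ) (hη : SmoothAlongAt F φ x η) :
    ContMDiffAt 𝓘(ℝ, F) 𝓘(ℝ) ∞ (fun y ↦ g.val (φ y) (ξ y) (η y)) x := by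
  have h := ContMDiffAt.clm_bundle_apply₂ (F₁ := E) (F₂ := E) (F₃ := ℝ) (n := ∞)
    (E₁ := fun p : M ↦ TangentSpace 𝓘(ℝ, E) p) (E₂ := fun p : M ↦ TangentSpace 𝓘(ℝ, E) p)
    (E₃ := Bundle.Trivial M ℝ) (b := φ) (v := ξ) (w := η) (ψ := fun y ↦ g.val (φ y))
    (g.contMDiff.contMDiffAt.comp x hξ.contMDiffAt) hξ hη
  exact (contMDiffAt_totalSpace.1 h).2

theorem coeff_toCoord {p q : M} (hq : q ∈ (chartAt E p).source) (v w : TangentSpace 𝓘(ℝ, E) q) :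
    g.coeff p q (toCoord p q v) (toCoord p q w) = g.val q v w := by
  change g.val q (ofCoord p q (toCoord p q v)) (ofCoord p q (toCoord p q w)) = _
  rw [ofCoord_toCoord hq, ofCoord_toCoord hq]

theorem coeff_symm (p q : M) (v w : E) : g.coeff p q v w = g.coeff p q w v :=
  g.symm q _ _

variable [FiniteDimensional ℝ E]

theorem contMDiffAt_coeff {p q : M} (hq : q ∈ (chartAt E p).source) :
    ContMDiffAt 𝓘(ℝ, E) 𝓘(ℝ, E →L[ℝ] E →L[ℝ] ℝ) ∞ (g.coeff p) q :=
  contMDiffAt_clm_of_apply fun v ↦ contMDiffAt_clm_of_apply fun w ↦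
    g.contMDiffAt_val (smoothAlongAt_ofCoord_const hq v) (smoothAlongAt_ofCoord_const hq w)

theorem dcoeff_apply (p : M) (v : TangentSpace 𝓘(ℝ, E) p) (a b : E) :
    g.dcoeff p v a b = mvfderiv 𝓘(ℝ, E) (fun q ↦ g.coeff p q a b) p v := by
  have hcoeff := g.contMDiffAt_coeff (mem_chart_source E p)
  rw [mvfderiv_clm_apply_const (B := fun q ↦ g.coeff p q a)
      ((hcoeff.clm_apply contMDiffAt_const).mdifferentiableAt (by simp)),
    mvfderiv_clm_apply_const (hcoeff.mdifferentiableAt (by simp)), dcoeff]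

theorem dcoeff_symm (p : M) (v : TangentSpace 𝓘(ℝ, E) p) (a b : E) :
    g.dcoeff p v a b = g.dcoeff p v b a := by
  simp only [dcoeff_apply, g.coeff_symm p _ a b]

theorem val_christoffel (p : M) (v w z : TangentSpace 𝓘(ℝ, E) p) :
    g.val p (g.christoffel p v w) z = (g.dcoeff p v (toCoord p p w) (toCoord p p z)
      + g.dcoeff p w (toCoord p p v) (toCoord p p z)
      - g.dcoeff p z (toCoord p p v) (toCoord p p w)) / 2 :=
  apply_sharp (g.form p) (g.nondegenerate p) (g.koszul p v w) z

theorem christoffel_symm (p : M) (v w : TangentSpace 𝓘(ℝ, E) p) :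
    g.christoffel p v w = g.christoffel p w v := by
  rw [← sub_eq_zero]
  refine g.nondegenerate p _ fun z ↦ ?_
  rw [map_sub, sub_apply, g.val_christoffel, g.val_christoffel, g.dcoeff_symm p z]
  ring

theorem christoffel_add (p : M) (v w w' : TangentSpace 𝓘(ℝ, E) p) :
    g.christoffel p v (w + w') = g.christoffel p v w + g.christoffel p v w' := by
  rw [← sub_eq_zero]
  refine g.nondegenerate p _ fun z ↦ ?_
  rw [map_sub, map_add, sub_apply, add_apply, g.val_christoffel, g.val_christoffel,
    g.val_christoffel, (g.dcoeff p).map_add, (toCoord p p).map_add]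
  simp only [map_add, add_apply]
  ring

theorem val_christoffel_add_val (p : M) (v w z : TangentSpace 𝓘(ℝ, E) p) :
    g.val p (g.christoffel p v w) z + g.val p w (g.christoffel p v z)
      = g.dcoeff p v (toCoord p p w) (toCoord p p z) := by
  rw [g.symm p w, g.val_christoffel, g.val_christoffel, g.dcoeff_symm p v (toCoord p p z),
    g.dcoeff_symm p w (toCoord p p v), g.dcoeff_symm p z (toCoord p p v)]
  ring

theorem mvfderiv_val {φ : N → M} {x : N} {ξ η : ∀ y : N, TangentSpace 𝓘(ℝ, E) (φ y)}
    (hξ : SmoothAlongAt F φ x ξ) (hη : SmoothAlongAt F φ x η) (u : TangentSpace 𝓘(ℝ, F) x) :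
    mvfderiv 𝓘(ℝ, F) (fun y ↦ g.val (φ y) (ξ y) (η y)) x u
      = g.val (φ x) (g.covAlong φ ξ x u) (η x) + g.val (φ x) (ξ x) (g.covAlong φ η x u) := by
  have hx := mem_chart_source E (φ x)
  have hφ := hξ.contMDiffAt
  have hξ' := hξ.contMDiffAt_toCoord hx
  have hη' := (hη.contMDiffAt_toCoord hx).mdifferentiableAt (by simp)
  have hcoeff := g.contMDiffAt_coeff hx
  have hcoeff' : ContMDiffAt 𝓘(ℝ, F) 𝓘(ℝ, E →L[ℝ] E →L[ℝ] ℝ) ∞ (fun y ↦ g.coeff (φ x) (φ y)) x :=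
    hcoeff.comp x hφ
  have in_chart : (fun y ↦ g.val (φ y) (ξ y) (η y)) =ᶠ[𝓝 x] fun y ↦
      g.coeff (φ x) (φ y) (toCoord (φ x) (φ y) (ξ y)) (toCoord (φ x) (φ y) (η y)) := by
    filter_upwards [eventually_mem_chartAt_source hφ.continuousAt hx]
      with y hy using (g.coeff_toCoord hy _ _).symm
  have compatible := g.val_christoffel_add_val (φ x) (mfderiv 𝓘(ℝ, F) 𝓘(ℝ, E) φ x u) (ξ x) (η x)
  rw [mvfderiv_congr_of_eventuallyEq in_chart,
    mvfderiv_clm_apply ((hcoeff'.clm_apply hξ').mdifferentiableAt (by simp)) hη',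
    mvfderiv_clm_apply (hcoeff'.mdifferentiableAt (by simp)) (hξ'.mdifferentiableAt (by simp)),
    mvfderiv_comp_mfderiv (hcoeff.mdifferentiableAt (by simp)) (hφ.mdifferentiableAt (by simp))]
  simp only [covAlong, map_add, add_apply]
  rw [← g.coeff_toCoord hx (ofCoord _ _ _), ← g.coeff_toCoord hx _ (ofCoord _ _ _),
    toCoord_ofCoord hx, toCoord_ofCoord hx]
  rw [dcoeff] at compatible
  linarith

theorem covAlong_congr {φ : N → M} {x : N} {ξ η : ∀ y : N, TangentSpace 𝓘(ℝ, E) (φ y)}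
    (h : ∀ᶠ y in 𝓝 x, ξ y = η y) (u : TangentSpace 𝓘(ℝ, F) x) :
    g.covAlong φ ξ x u = g.covAlong φ η x u := by
  have coord_eq : (fun y ↦ toCoord (φ x) (φ y) (ξ y)) =ᶠ[𝓝 x]
      fun y ↦ toCoord (φ x) (φ y) (η y) := h.mono fun y hy ↦ by simp only [hy]
  rw [covAlong, covAlong, mvfderiv_congr_of_eventuallyEq coord_eq, h.self_of_nhds]

theorem covAlong_comp {G : Type*} [NormedAddCommGroup G] [NormedSpace ℝ G]
    {L : Type*} [TopologicalSpace L] [ChartedSpace G L]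
    {φ : N → M} {ι : L → N} {y : L} {ξ : ∀ y : N, TangentSpace 𝓘(ℝ, E) (φ y)}
    (hξ : SmoothAlongAt F φ (ι y) ξ) (hι : ContMDiffAt 𝓘(ℝ, G) 𝓘(ℝ, F) ∞ ι y)
    (u : TangentSpace 𝓘(ℝ, G) y) :
    g.covAlong (φ ∘ ι) (fun z ↦ ξ (ι z)) y u
      = g.covAlong φ ξ (ι y) (mfderiv 𝓘(ℝ, G) 𝓘(ℝ, F) ι y u) := by
  have hιd := hι.mdifferentiableAt (by simp)
  have derivative_eq := mvfderiv_comp_mfderiv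
    ((hξ.contMDiffAt_toCoord (mem_chart_source E (φ (ι y)))).mdifferentiableAt (by simp)) hιd u
  have velocity_eq := mfderiv_comp_apply y (hξ.contMDiffAt.mdifferentiableAt (by simp)) hιd u
  simp only [covAlong, Function.comp_apply]
  rw [derivative_eq]
  exact congrArg (_ + ·) (congrArg (fun v ↦ g.christoffel (φ (ι y)) v (ξ (ι y))) velocity_eq)

section Hessian

variable [IsManifold 𝓘(ℝ, F) ∞ N]

/-- The second derivative at `x` of `φ : N → M`, read in the chart of `N` at `x₀`, corrected by the
Christoffel symbols of `M`: the Hessian of `φ` for the flat connection of that chart. -/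
def chartHessian (φ : N → M) (x₀ x : N) (u w : TangentSpace 𝓘(ℝ, F) x) :
    TangentSpace 𝓘(ℝ, E) (φ x) :=
  ofCoord (φ x) (φ x)
      (fderiv ℝ (fderiv ℝ (extChartAt 𝓘(ℝ, E) (φ x) ∘ φ ∘ (extChartAt 𝓘(ℝ, F) x₀).symm))
        (extChartAt 𝓘(ℝ, F) x₀ x) (toCoord x₀ x u) (toCoord x₀ x w))
    + g.christoffel (φ x) (mfderiv 𝓘(ℝ, F) 𝓘(ℝ, E) φ x u) (mfderiv 𝓘(ℝ, F) 𝓘(ℝ, E) φ x w)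

variable {φ : N → M} {x₀ x : N}

theorem chartHessian_symm (hφ : ContMDiffAt 𝓘(ℝ, F) 𝓘(ℝ, E) ∞ φ x)
    (hx : x ∈ (chartAt F x₀).source) (u w : TangentSpace 𝓘(ℝ, F) x) :
    g.chartHessian φ x₀ x u w = g.chartHessian φ x₀ x w u := by
  have two_le : minSmoothness ℝ 2 ≤ ∞ := by
    rw [minSmoothness_of_isRCLikeNormedField]
    exact (WithTop.coe_le_coe.2 le_top : ((2 : ℕ∞) : WithTop ℕ∞) ≤ ∞)
  have symm : IsSymmSndFDerivAt ℝ _ _ :=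
    (contDiffAt_chart_expression hx (mem_chart_source E (φ x)) hφ).isSymmSndFDerivAt two_le
  rw [chartHessian, chartHessian, g.christoffel_symm, symm]

theorem chartHessian_add (u w w' : TangentSpace 𝓘(ℝ, F) x) :
    g.chartHessian φ x₀ x u (w + w') = g.chartHessian φ x₀ x u w + g.chartHessian φ x₀ x u w' := by
  simp only [chartHessian, map_add, g.christoffel_add]
  abel

theorem covAlong_mfderiv (hφ : ContMDiff 𝓘(ℝ, F) 𝓘(ℝ, E) ∞ φ) (hx : x ∈ (chartAt F x₀).source)
    {Y : ∀ y : N, TangentSpace 𝓘(ℝ, F) y} (hY : SmoothAlongAt F id x Y)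
    (u : TangentSpace 𝓘(ℝ, F) x) :
    g.covAlong φ (fun y ↦ mfderiv 𝓘(ℝ, F) 𝓘(ℝ, E) φ y (Y y)) x u
      = g.chartHessian φ x₀ x u (Y x) + mfderiv 𝓘(ℝ, F) 𝓘(ℝ, E) φ x
          (ofCoord x₀ x (mvfderiv 𝓘(ℝ, F) (fun y ↦ toCoord x₀ y (Y y)) x u)) := by
  have hs := mem_chart_source E (φ x)
  set Φ := extChartAt 𝓘(ℝ, E) (φ x) ∘ φ ∘ (extChartAt 𝓘(ℝ, F) x₀).symm
  have hYd : MDifferentiableAt 𝓘(ℝ, F) 𝓘(ℝ, F) (fun y ↦ toCoord x₀ y (Y y)) x :=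
    (hY.contMDiffAt_toCoord (p := x₀) hx).mdifferentiableAt (by simp)
  have hchart : ContMDiffAt 𝓘(ℝ, F) 𝓘(ℝ, F) ∞ (extChartAt 𝓘(ℝ, F) x₀) x :=
    contMDiffAt_extChartAt' hx
  have hΦ' : ContDiffAt ℝ ∞ (fderiv ℝ Φ) (extChartAt 𝓘(ℝ, F) x₀ x) :=
    (contDiffAt_chart_expression hx hs hφ.contMDiffAt).fderiv_right (by simp)
  have hΦ'_chart : ContMDiffAt 𝓘(ℝ, F) 𝓘(ℝ, F →L[ℝ] E) ∞
      (fun y ↦ fderiv ℝ Φ (extChartAt 𝓘(ℝ, F) x₀ y)) x :=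
    ContMDiffAt.comp x hΦ'.contMDiffAt hchart
  have in_charts : (fun y ↦ toCoord (φ x) (φ y) (mfderiv 𝓘(ℝ, F) 𝓘(ℝ, E) φ y (Y y))) =ᶠ[𝓝 x]
      fun y ↦ fderiv ℝ Φ (extChartAt 𝓘(ℝ, F) x₀ y) (toCoord x₀ y (Y y)) := by
    filter_upwards [eventually_mem_chartAt_source hφ.continuous.continuousAt hs,
      (chartAt F x₀).open_source.mem_nhds hx] with y hy hy'
    exact toCoord_mfderiv hy' hy hφ.contMDiffAt (Y y)
  rw [mfderiv_ofCoord hx hs hφ.contMDiffAt, covAlong, mvfderiv_congr_of_eventuallyEq in_charts,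
    mvfderiv_clm_apply (hΦ'_chart.mdifferentiableAt (by simp)) hYd,
    mvfderiv_comp_fderiv (hΦ'.differentiableAt (by simp)) (hchart.mdifferentiableAt (by simp)),
    ← toCoord_eq_mvfderiv hx, map_add]
  exact add_right_comm _ _ _

end Hessian

end SemiRiemannianMetric

end LeviCivita

section Parallel

variable {E : Type*} [NormedAddCommGroup E] [NormedSpace ℝ E]
  {M : Type*} [TopologicalSpace M] [ChartedSpace E M] [IsManifold 𝓘(ℝ, E) ∞ M]
  {F : Type*} [NormedAddCommGroup F] [NormedSpace ℝ F]
  {N : Type*} [TopologicalSpace N] [ChartedSpace F N]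
  {U : Set M} {S : ∀ p : M, TangentSpace 𝓘(ℝ, E) p →L[ℝ] TangentSpace 𝓘(ℝ, E) p}

theorem SmoothEndOn.smoothAlongAt_apply (hS : SmoothEndOn U S) (hU : IsOpen U) {φ : N → M} {x : N}
    (hx : φ x ∈ U) {ξ : ∀ y : N, TangentSpace 𝓘(ℝ, E) (φ y)} (hξ : SmoothAlongAt F φ x ξ) :
    SmoothAlongAt F φ x (fun y ↦ S (φ y) (ξ y)) :=
  ContMDiffAt.clm_bundle_apply (F₁ := E) (F₂ := E) (n := ∞)
    (E₁ := fun p : M ↦ TangentSpace 𝓘(ℝ, E) p) (E₂ := fun p : M ↦ TangentSpace 𝓘(ℝ, E) p)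
    (b := φ) (v := ξ) (ϕ := fun y ↦ S (φ y))
    (ContMDiffAt.comp x (ContMDiffOn.contMDiffAt hS (hU.mem_nhds hx)) hξ.contMDiffAt) hξ

/-- The matrix at `q`, in the preferred chart at `p`, of the field of endomorphisms `S`. -/
def endCoeff (S : ∀ p : M, TangentSpace 𝓘(ℝ, E) p →L[ℝ] TangentSpace 𝓘(ℝ, E) p) (p q : M) :
    E →L[ℝ] E :=
  (toCoord p q).comp ((S q).comp (ofCoord p q))

theorem toCoord_apply_eq_endCoeff {p q : M} (hq : q ∈ (chartAt E p).source)
    (v : TangentSpace 𝓘(ℝ, E) q) : toCoord p q (S q v) = endCoeff S p q (toCoord p q v) := by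
  rw [endCoeff, ContinuousLinearMap.comp_apply, ContinuousLinearMap.comp_apply, ofCoord_toCoord hq]

variable [FiniteDimensional ℝ E]

theorem SmoothEndOn.contMDiffAt_endCoeff (hS : SmoothEndOn U S) (hU : IsOpen U) {p q : M}
    (hqU : q ∈ U) (hq : q ∈ (chartAt E p).source) :
    ContMDiffAt 𝓘(ℝ, E) 𝓘(ℝ, E →L[ℝ] E) ∞ (endCoeff S p) q :=
  contMDiffAt_clm_of_apply fun b ↦ (hS.smoothAlongAt_apply hU (φ := id) hqU
    (smoothAlongAt_ofCoord_const hq b)).contMDiffAt_toCoord hq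

namespace SemiRiemannianMetric

/-- The covariant derivative at `p`, in the direction `v`, of the field of endomorphisms `S`,
applied to `w`; it is computed in the preferred chart at `p`. -/
def covEnd (g : SemiRiemannianMetric E M)
    (S : ∀ p : M, TangentSpace 𝓘(ℝ, E) p →L[ℝ] TangentSpace 𝓘(ℝ, E) p) (p : M)
    (v w : TangentSpace 𝓘(ℝ, E) p) : TangentSpace 𝓘(ℝ, E) p :=
  ofCoord p p (mvfderiv 𝓘(ℝ, E) (endCoeff S p) p v (toCoord p p w))
    + g.christoffel p v (S p w) - S p (g.christoffel p v w)

theorem covAlong_end_sub (g : SemiRiemannianMetric E M) (hS : SmoothEndOn U S) (hU : IsOpen U)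
    {φ : N → M} {x : N} (hx : φ x ∈ U) {ξ : ∀ y : N, TangentSpace 𝓘(ℝ, E) (φ y)}
    (hξ : SmoothAlongAt F φ x ξ) (u : TangentSpace 𝓘(ℝ, F) x) :
    g.covAlong φ (fun y ↦ S (φ y) (ξ y)) x u - S (φ x) (g.covAlong φ ξ x u)
      = g.covEnd S (φ x) (mfderiv 𝓘(ℝ, F) 𝓘(ℝ, E) φ x u) (ξ x) := by
  have hs := mem_chart_source E (φ x)
  have hφ := hξ.contMDiffAt
  have hcoeff := hS.contMDiffAt_endCoeff hU hx hs
  have hcoeff' : ContMDiffAt 𝓘(ℝ, F) 𝓘(ℝ, E →L[ℝ] E) ∞ (fun y ↦ endCoeff S (φ x) (φ y)) x :=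
    hcoeff.comp x hφ
  have in_chart : (fun y ↦ toCoord (φ x) (φ y) (S (φ y) (ξ y))) =ᶠ[𝓝 x] fun y ↦
      endCoeff S (φ x) (φ y) (toCoord (φ x) (φ y) (ξ y)) := by
    filter_upwards [eventually_mem_chartAt_source hφ.continuousAt hs] with y hy
      using toCoord_apply_eq_endCoeff hy _
  simp only [covAlong, covEnd]
  rw [mvfderiv_congr_of_eventuallyEq in_chart,
    mvfderiv_clm_apply (hcoeff'.mdifferentiableAt (by simp))
      ((hξ.contMDiffAt_toCoord hs).mdifferentiableAt (by simp)),
    mvfderiv_comp_mfderiv (hcoeff.mdifferentiableAt (by simp)) (hφ.mdifferentiableAt (by simp))]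
  simp only [endCoeff, ContinuousLinearMap.comp_apply, map_add]
  rw [ofCoord_toCoord hs]
  module

end SemiRiemannianMetric

/-- Parallelism only concerns vector fields on `M`. It applies along `φ` because the difference
`∇ (S ξ) - S ∇ ξ` depends on `ξ` only through `ξ x`, which extends to a vector field on `M` with
constant components in a chart. -/
theorem IsParallel.exists_covAlong {g : SemiRiemannianMetric E M}
    {σ : ∀ p : M, Submodule ℝ (TangentSpace 𝓘(ℝ, E) p →L[ℝ] TangentSpace 𝓘(ℝ, E) p)}
    (hσ : IsParallel g σ) (hU : IsOpen U) (hS : SmoothEndOn U S) (hSσ : ∀ p ∈ U, S p ∈ σ p)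
    {φ : N → M} {x : N} (hx : φ x ∈ U) (u : TangentSpace 𝓘(ℝ, F) x) :
    ∃ T ∈ σ (φ x), ∀ ξ : ∀ y : N, TangentSpace 𝓘(ℝ, E) (φ y), SmoothAlongAt F φ x ξ →
      g.covAlong φ (fun y ↦ S (φ y) (ξ y)) x u
        = S (φ x) (g.covAlong φ ξ x u) + T (ξ x) := by
  have hs := mem_chart_source E (φ x)
  set v := mfderiv 𝓘(ℝ, F) 𝓘(ℝ, E) φ x u
  obtain ⟨T, hT, hcov⟩ := hσ U S hU hS hSσ (φ x) hx v
  refine ⟨T, hT, fun ξ hξ ↦ ?_⟩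
  let Y : ∀ q : M, TangentSpace 𝓘(ℝ, E) q := fun q ↦
    ofCoord (φ x) q (toCoord (φ x) (φ x) (ξ x))
  have hY : ∀ q ∈ (chartAt E (φ x)).source, SmoothAlongAt E id q Y := fun q hq ↦
    smoothAlongAt_ofCoord (φ := id) hq contMDiffAt_id contMDiffAt_const
  have extends_ξ : Y (φ x) = ξ x := ofCoord_toCoord hs _
  have covEnd_eq := g.covAlong_end_sub hS hU (φ := id) (x := φ x) hx (hY _ hs) v
  rw [mfderiv_id] at covEnd_eq
  have cov_eq := hcov _ Y (chartAt E (φ x)).open_source hs fun q hq ↦ (hY q hq).contMDiffWithinAt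
  rw [← sub_eq_iff_eq_add', g.covAlong_end_sub hS hU hx hξ u, ← extends_ξ]
  exact covEnd_eq.symm.trans cov_eq

end Parallel

section Projection

variable {F : Type*} [NormedAddCommGroup F] [NormedSpace ℝ F]
  {N : Type*} [TopologicalSpace N] [ChartedSpace F N]
  {V R : Type*} [NormedAddCommGroup V] [NormedSpace ℝ V]
  [NormedAddCommGroup R] [NormedSpace ℝ R]

/-- The operator `id - S (Λ S)⁻¹ Λ`, which is the projection onto the kernel of `Λ` along the range
of `S` when `Λ S` is invertible. -/
def kerProjection (S : R →L[ℝ] V) (Λ : V →L[ℝ] R) : V →L[ℝ] V :=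
  ContinuousLinearMap.id ℝ V - S.comp ((ContinuousLinearMap.inverse (Λ.comp S)).comp Λ)

section kerProjection

variable {S : R →L[ℝ] V} {Λ : V →L[ℝ] R}

theorem kerProjection_eq_self {v : V} (hv : Λ v = 0) : kerProjection S Λ v = v := by
  simp [kerProjection, hv]

theorem apply_kerProjection (hΛ : (Λ.comp S).IsInvertible) (v : V) :
    Λ (kerProjection S Λ v) = 0 := by
  have right_inverse := hΛ.self_apply_inverse (Λ v)
  simp_all [kerProjection]

theorem kerProjection_kerProjection (hΛ : (Λ.comp S).IsInvertible) (Λ' : V →L[ℝ] R) (v : V) :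
    kerProjection S Λ (kerProjection S Λ' v) = kerProjection S Λ v := by
  have left_inverse := hΛ.inverse_apply_self
  simp_all [kerProjection]

theorem contMDiffAt_kerProjection [CompleteSpace R] {Λ : N → V →L[ℝ] R} {y : N}
    (hΛ : ContMDiffAt 𝓘(ℝ, F) 𝓘(ℝ, V →L[ℝ] R) ∞ Λ y) (hy : ((Λ y).comp S).IsInvertible) :
    ContMDiffAt 𝓘(ℝ, F) 𝓘(ℝ, V →L[ℝ] V) ∞ (fun z ↦ kerProjection S (Λ z)) y := by
  obtain ⟨e, he⟩ := hy
  have hinverse : ContDiffAt ℝ ∞ ContinuousLinearMap.inverse ((Λ y).comp S) :=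
    he ▸ contDiffAt_map_inverse e
  exact contMDiffAt_const.sub (contMDiffAt_const.clm_comp
    (ContMDiffAt.clm_comp (hinverse.contMDiffAt.comp y (hΛ.clm_comp contMDiffAt_const)) hΛ))

end kerProjection

theorem exists_smooth_projection_ker [FiniteDimensional ℝ R] {Λ : N → V →L[ℝ] R} {U₀ : Set N}
    {x : N} (hU₀ : IsOpen U₀) (hx : x ∈ U₀)
    (hΛ : ∀ y ∈ U₀, ContMDiffAt 𝓘(ℝ, F) 𝓘(ℝ, V →L[ℝ] R) ∞ Λ y)
    (hsurj : Function.Surjective (Λ x)) :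
    ∃ (P : N → V →L[ℝ] V) (U : Set N), IsOpen U ∧ x ∈ U ∧ U ⊆ U₀ ∧
      ∀ y ∈ U, ContMDiffAt 𝓘(ℝ, F) 𝓘(ℝ, V →L[ℝ] V) ∞ P y ∧ (∀ v, Λ y (P y v) = 0) ∧
        (∀ v, Λ y v = 0 → P y v = v) ∧ ∀ z ∈ U, ∀ v, P y (P z v) = P y v := by
  have : CompleteSpace R := FiniteDimensional.complete ℝ R
  obtain ⟨s, hs⟩ := (Λ x).toLinearMap.exists_rightInverse_of_surjective
    (LinearMap.range_eq_top.2 hsurj)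
  let S : R →L[ℝ] V := LinearMap.toContinuousLinearMap s
  have right_inverse : (Λ x).comp S = ContinuousLinearMap.id ℝ R := by
    ext r
    exact LinearMap.congr_fun hs r
  have hcont : ContinuousOn (fun y ↦ (Λ y).comp S) U₀ := fun y hy ↦
    ((hΛ y hy).continuousAt.clm_comp continuousAt_const).continuousWithinAt
  refine ⟨fun y ↦ kerProjection S (Λ y),
    U₀ ∩ (fun y ↦ (Λ y).comp S) ⁻¹' Set.range ((↑) : (R ≃L[ℝ] R) → R →L[ℝ] R),
    hcont.isOpen_inter_preimage hU₀ ContinuousLinearEquiv.isOpen,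
    ⟨hx, ContinuousLinearEquiv.refl ℝ R, right_inverse.symm⟩, Set.inter_subset_left, ?_⟩
  rintro y ⟨hy, hinv⟩
  exact ⟨contMDiffAt_kerProjection (hΛ y hy) hinv, apply_kerProjection hinv,
    fun v ↦ kerProjection_eq_self, fun z _ ↦ kerProjection_kerProjection hinv (Λ z)⟩

end Projection

section ChartExpressions

variable {F : Type*} [NormedAddCommGroup F] [NormedSpace ℝ F]
  {N : Type*} [TopologicalSpace N] [ChartedSpace F N] [IsManifold 𝓘(ℝ, F) ∞ N]
  {W : Type*} [NormedAddCommGroup W] [NormedSpace ℝ W]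
  {G : Type*} [NormedAddCommGroup G] [NormedSpace ℝ G]

theorem contDiffAt_comp_extChartAt_symm {h : N → W} {x₀ y : N} (hy : y ∈ (chartAt F x₀).source)
    (hh : ContMDiffAt 𝓘(ℝ, F) 𝓘(ℝ, W) ∞ h y) :
    ContDiffAt ℝ ∞ (h ∘ (extChartAt 𝓘(ℝ, F) x₀).symm) (extChartAt 𝓘(ℝ, F) x₀ y) :=
  contDiffAt_chart_expression hy (mem_chart_source W (h y)) hh

theorem fderiv_comp_extChartAt_symm {h : N → W} {x₀ y : N} (hy : y ∈ (chartAt F x₀).source)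
    (hh : ContMDiffAt 𝓘(ℝ, F) 𝓘(ℝ, W) ∞ h y) (b : F) :
    fderiv ℝ (h ∘ (extChartAt 𝓘(ℝ, F) x₀).symm) (extChartAt 𝓘(ℝ, F) x₀ y) b
      = mvfderiv 𝓘(ℝ, F) h y (ofCoord x₀ y b) := by
  have chain := toCoord_mfderiv hy (mem_chart_source W (h y)) hh (ofCoord x₀ y b)
  rw [toCoord_ofCoord hy, toCoord, TangentBundle.continuousLinearMapAt_model_space] at chain
  exact chain.symm

theorem contMDiffAt_extChartAt_symm_comp {x₀ : N} {u : G → F} {v : G}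
    (huv : u v ∈ (extChartAt 𝓘(ℝ, F) x₀).target) (hu : ContDiffAt ℝ ∞ u v) :
    ContMDiffAt 𝓘(ℝ, G) 𝓘(ℝ, F) ∞ (fun w ↦ (extChartAt 𝓘(ℝ, F) x₀).symm (u w)) v :=
  ContMDiffAt.comp v ((contMDiffOn_extChartAt_symm x₀).contMDiffAt
    (extChartAt_target_mem_nhds' huv)) hu.contMDiffAt

theorem mfderiv_extChartAt_symm_comp {x₀ : N} {u : G → F} {v : G}
    (huv : u v ∈ (extChartAt 𝓘(ℝ, F) x₀).target) (hu : ContDiffAt ℝ ∞ u v) (t : G) :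
    mfderiv 𝓘(ℝ, G) 𝓘(ℝ, F) (fun w ↦ (extChartAt 𝓘(ℝ, F) x₀).symm (u w)) v t
      = ofCoord x₀ ((extChartAt 𝓘(ℝ, F) x₀).symm (u v)) (fderiv ℝ u v t) := by
  have hsource : (extChartAt 𝓘(ℝ, F) x₀).symm (u v) ∈ (chartAt F x₀).source := by
    simpa only [extChartAt_source] using (extChartAt 𝓘(ℝ, F) x₀).map_target huv
  have in_chart : (fun w ↦ extChartAt 𝓘(ℝ, F) x₀ ((extChartAt 𝓘(ℝ, F) x₀).symm (u w)))
      =ᶠ[𝓝 v] u := by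
    filter_upwards [hu.continuousAt.preimage_mem_nhds (extChartAt_target_mem_nhds' huv)]
      with w hw using (extChartAt 𝓘(ℝ, F) x₀).right_inv hw
  have hchart : ContMDiffAt 𝓘(ℝ, F) 𝓘(ℝ, F) ∞ (extChartAt 𝓘(ℝ, F) x₀)
      ((extChartAt 𝓘(ℝ, F) x₀).symm (u v)) := contMDiffAt_extChartAt' hsource
  have chain := mvfderiv_comp_mfderiv (φ := fun w ↦ (extChartAt 𝓘(ℝ, F) x₀).symm (u w))
    (hchart.mdifferentiableAt (by simp))
    ((contMDiffAt_extChartAt_symm_comp huv hu).mdifferentiableAt (by simp)) t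
  rw [mvfderiv_congr_of_eventuallyEq in_chart, mvfderiv, mfderiv_eq_fderiv,
    ← toCoord_eq_mvfderiv hsource] at chain
  exact (ofCoord_toCoord hsource _).symm.trans (congrArg (ofCoord x₀ _) chain.symm)

end ChartExpressions

section Frobenius

variable {F : Type*} [NormedAddCommGroup F] [NormedSpace ℝ F]
  {N : Type*} [TopologicalSpace N] [ChartedSpace F N] [IsManifold 𝓘(ℝ, F) ∞ N]

/-- Near `x₀`, the family `D` of tangent subspaces is, in the preferred chart at `x₀`, the image of
a smooth family `P` of projections, all with the same kernel. -/
structure IsProjectionFamily (D : ∀ x : N, Submodule ℝ (TangentSpace 𝓘(ℝ, F) x)) (x₀ : N)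
    (U : Set N) (P : N → F →L[ℝ] F) : Prop where
  isOpen : IsOpen U
  mem : x₀ ∈ U
  subset_source : U ⊆ (chartAt F x₀).source
  contMDiffAt : ∀ y ∈ U, ContMDiffAt 𝓘(ℝ, F) 𝓘(ℝ, F →L[ℝ] F) ∞ P y
  apply_apply : ∀ y ∈ U, ∀ z ∈ U, ∀ v, P y (P z v) = P y v
  ofCoord_apply_mem : ∀ y ∈ U, ∀ v, ofCoord x₀ y (P y v) ∈ D y
  apply_toCoord : ∀ y ∈ U, ∀ v ∈ D y, P y (toCoord x₀ y v) = toCoord x₀ y v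

/-- The components at `y`, in the preferred chart at `x₀`, of the Lie bracket of the vector fields
with components `P v` and `P w`. -/
def projectionBracket (x₀ : N) (P : N → F →L[ℝ] F) (y : N) (v w : F) : F :=
  mvfderiv 𝓘(ℝ, F) (fun z ↦ P z w) y (ofCoord x₀ y (P y v))
    - mvfderiv 𝓘(ℝ, F) (fun z ↦ P z v) y (ofCoord x₀ y (P y w))

namespace IsProjectionFamily

variable {D : ∀ x : N, Submodule ℝ (TangentSpace 𝓘(ℝ, F) x)} {x₀ : N} {U : Set N}
  {P : N → F →L[ℝ] F}

theorem apply_mvfderiv_eq_zero (hP : IsProjectionFamily D x₀ U P) {y z : N} (hy : y ∈ U)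
    (hz : z ∈ U) (w : F) (t : TangentSpace 𝓘(ℝ, F) y) :
    P z (mvfderiv 𝓘(ℝ, F) (fun z ↦ P z w) y t) = 0 := by
  have hPw : ContMDiffAt 𝓘(ℝ, F) 𝓘(ℝ, F) ∞ (fun z ↦ P z w) y :=
    (hP.contMDiffAt y hy).clm_apply contMDiffAt_const
  have chain := mvfderiv_comp_fderiv (P z).differentiableAt (hPw.mdifferentiableAt (by simp)) t
  have constant : (fun y ↦ P z (P y w)) =ᶠ[𝓝 y] fun _ ↦ P z w := by
    filter_upwards [hP.isOpen.mem_nhds hy] with y hy using hP.apply_apply z hz y hy w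
  rw [ContinuousLinearMap.fderiv, mvfderiv_congr_of_eventuallyEq constant, mvfderiv_const] at chain
  exact chain.symm

/-- The bracket of the fields `P v` and `P w` lies in the image of `P` and in the common kernel, so
in the involutive case these fields commute. -/
theorem projectionBracket_eq_zero (hP : IsProjectionFamily D x₀ U P) {y : N} (hy : y ∈ U)
    {v w : F} (hvw : ofCoord x₀ y (projectionBracket x₀ P y v w) ∈ D y) :
    projectionBracket x₀ P y v w = 0 := by
  have mem_image := hP.apply_toCoord y hy _ hvw
  rw [toCoord_ofCoord (hP.subset_source hy)] at mem_image
  rw [← mem_image, projectionBracket, map_sub, hP.apply_mvfderiv_eq_zero hy hy,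
    hP.apply_mvfderiv_eq_zero hy hy, sub_zero]

section Integration

variable {G : Type*} [NormedAddCommGroup G] [NormedSpace ℝ G] (j : G →L[ℝ] F)

theorem contDiffAt_comp_symm (hP : IsProjectionFamily D x₀ U P) {y : N} (hy : y ∈ U) :
    ContDiffAt ℝ ∞ ((fun z ↦ (P z).comp j) ∘ (extChartAt 𝓘(ℝ, F) x₀).symm)
      (extChartAt 𝓘(ℝ, F) x₀ y) :=
  contDiffAt_comp_extChartAt_symm (hP.subset_source hy)
    ((hP.contMDiffAt y hy).clm_comp contMDiffAt_const)

theorem fderiv_comp_symm (hP : IsProjectionFamily D x₀ U P) {y : N} (hy : y ∈ U) (b : F) (k : G) :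
    fderiv ℝ ((fun z ↦ (P z).comp j) ∘ (extChartAt 𝓘(ℝ, F) x₀).symm)
        (extChartAt 𝓘(ℝ, F) x₀ y) b k
      = mvfderiv 𝓘(ℝ, F) (fun z ↦ P z (j k)) y (ofCoord x₀ y b) := by
  have hPj : ContMDiffAt 𝓘(ℝ, F) 𝓘(ℝ, G →L[ℝ] F) ∞ (fun z ↦ (P z).comp j) y :=
    (hP.contMDiffAt y hy).clm_comp contMDiffAt_const
  rw [fderiv_comp_extChartAt_symm (hP.subset_source hy) hPj]
  exact (mvfderiv_clm_apply_const (hPj.mdifferentiableAt (by simp)) k _).symm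

/-- When the fields `P v` commute, the total differential equation `dk = P j` is integrable. -/
theorem exists_mfderiv_eq [CompleteSpace F] (hP : IsProjectionFamily D x₀ U P)
    (hcomm : ∀ y ∈ U, ∀ v w, projectionBracket x₀ P y v w = 0) :
    ∃ r > 0, ∃ k : G → N, k 0 = x₀ ∧ ∀ v ∈ Metric.ball (0 : G) r, k v ∈ U ∧
      ContMDiffAt 𝓘(ℝ, G) 𝓘(ℝ, F) ∞ k v ∧
      ∀ t : G, mfderiv 𝓘(ℝ, G) 𝓘(ℝ, F) k v t = ofCoord x₀ (k v) (P (k v) (j t)) := by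
  set ψ := extChartAt 𝓘(ℝ, F) x₀
  have hsource : U ⊆ ψ.source := by simpa only [ψ, extChartAt_source] using hP.subset_source
  have hopen : IsOpen (ψ.target ∩ ψ.symm ⁻¹' U) :=
    (continuousOn_extChartAt_symm x₀).isOpen_inter_preimage (isOpen_extChartAt_target x₀) hP.isOpen
  have hx₀ : ψ x₀ ∈ ψ.target ∩ ψ.symm ⁻¹' U :=
    ⟨ψ.map_source (hsource hP.mem), by
      rw [Set.mem_preimage, ψ.left_inv (hsource hP.mem)]; exact hP.mem⟩
  obtain ⟨r, hr, u, hu₀, hu, hu'⟩ := exists_hasFDerivAt_of_fderiv_symm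
    (A := (fun z ↦ (P z).comp j) ∘ ψ.symm) hopen hx₀
    (fun q ⟨hq, hqU⟩ ↦ by
      rw [← ψ.right_inv hq]
      exact (hP.contDiffAt_comp_symm j hqU).contDiffWithinAt)
    (fun q ⟨hq, hqU⟩ h k ↦ by
      rw [← ψ.right_inv hq, hP.fderiv_comp_symm j hqU, hP.fderiv_comp_symm j hqU, ψ.right_inv hq]
      exact sub_eq_zero.1 (hcomm _ hqU (j h) (j k)))
  refine ⟨r, hr, fun v ↦ ψ.symm (u v), by simp only [hu₀, ψ.left_inv (hsource hP.mem)],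
    fun v hv ↦ ?_⟩
  obtain ⟨⟨htarget, hU⟩, hderiv⟩ := hu' v hv
  have huv := hu.contDiffAt (Metric.isOpen_ball.mem_nhds hv)
  refine ⟨hU, contMDiffAt_extChartAt_symm_comp htarget huv, fun t ↦ ?_⟩
  rw [mfderiv_extChartAt_symm_comp htarget huv, hderiv.fderiv]
  rfl

theorem apply_extChartAt_eq (hP : IsProjectionFamily D x₀ U P) {k : G → N} {B : Set G}
    (hBopen : IsOpen B) (hBconvex : Convex ℝ B)
    (hk : ∀ v ∈ B, k v ∈ U ∧ ContMDiffAt 𝓘(ℝ, G) 𝓘(ℝ, F) ∞ k v ∧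
      ∀ t : G, mfderiv 𝓘(ℝ, G) 𝓘(ℝ, F) k v t = ofCoord x₀ (k v) (P (k v) (j t)))
    {v w : G} (hv : v ∈ B) (hw : w ∈ B) :
    P x₀ (extChartAt 𝓘(ℝ, F) x₀ (k v) - j v) = P x₀ (extChartAt 𝓘(ℝ, F) x₀ (k w) - j w) := by
  set ψ := extChartAt 𝓘(ℝ, F) x₀
  have hderiv : ∀ v ∈ B, HasFDerivAt (fun v ↦ P x₀ (ψ (k v) - j v)) (0 : G →L[ℝ] F) v := by
    intro v hv
    obtain ⟨hU, hsmooth, hmfderiv⟩ := hk v hv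
    have hsource := hP.subset_source hU
    have hψ : ContMDiffAt 𝓘(ℝ, F) 𝓘(ℝ, F) ∞ ψ (k v) := contMDiffAt_extChartAt' hsource
    have hψk : DifferentiableAt ℝ (fun v ↦ ψ (k v)) v :=
      (ContMDiffAt.comp v hψ hsmooth).contDiffAt.differentiableAt (by simp)
    have fderiv_eq : ∀ t, fderiv ℝ (fun v ↦ ψ (k v)) v t = P (k v) (j t) := fun t ↦ by
      have chain := mvfderiv_comp_mfderiv (hψ.mdifferentiableAt (by simp))
        (hsmooth.mdifferentiableAt (by simp)) t
      rw [mvfderiv, mfderiv_eq_fderiv, hmfderiv, ← toCoord_eq_mvfderiv hsource,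
        toCoord_ofCoord hsource] at chain
      exact chain
    refine ((P x₀).hasFDerivAt.comp v (hψk.hasFDerivAt.sub j.hasFDerivAt)).congr_fderiv ?_
    ext t
    simp [fderiv_eq, hP.apply_apply x₀ hP.mem (k v) hU]
  exact hBconvex.is_const_of_fderivWithin_eq_zero (𝕜 := ℝ)
    (fun w hw ↦ (hderiv w hw).differentiableAt.differentiableWithinAt)
    (fun w hw ↦ by rw [fderivWithin_of_isOpen hBopen hw, (hderiv w hw).fderiv]) hv hw

variable {j} (hj : Function.Injective j) (hrange : j.range = (P x₀).range)

include hrange in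
theorem apply_eq_self (hP : IsProjectionFamily D x₀ U P) (t : G) : P x₀ (j t) = j t := by
  obtain ⟨b, hb⟩ : j t ∈ (P x₀).range := hrange ▸ ⟨t, rfl⟩
  rw [← hb]
  exact hP.apply_apply x₀ hP.mem x₀ hP.mem b

include hj hrange in
theorem injective_ofCoord_apply (hP : IsProjectionFamily D x₀ U P) {y : N} (hy : y ∈ U) :
    Function.Injective fun t ↦ ofCoord x₀ y (P y (j t)) := by
  intro a b hab
  have apply_eq : P y (j a) = P y (j b) := by
    simpa only [toCoord_ofCoord (hP.subset_source hy)] using congrArg (toCoord x₀ y) hab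
  apply hj
  rw [← hP.apply_eq_self hrange, ← hP.apply_eq_self hrange b, ← hP.apply_apply x₀ hP.mem y hy,
    apply_eq, hP.apply_apply x₀ hP.mem y hy]

include hrange in
theorem range_ofCoord_apply (hP : IsProjectionFamily D x₀ U P) {y : N} (hy : y ∈ U) :
    Set.range (fun t ↦ ofCoord x₀ y (P y (j t))) = D y := by
  refine Set.Subset.antisymm ?_ fun v hv ↦ ?_
  · rintro _ ⟨t, rfl⟩
    exact hP.ofCoord_apply_mem y hy (j t)
  · obtain ⟨t, ht⟩ : P x₀ (toCoord x₀ y v) ∈ j.range := hrange ▸ ⟨_, rfl⟩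
    refine ⟨t, ?_⟩
    change j t = _ at ht
    beta_reduce
    rw [ht, hP.apply_apply y hy x₀ hP.mem, hP.apply_toCoord y hy v hv,
      ofCoord_toCoord (hP.subset_source hy)]

end Integration

variable [FiniteDimensional ℝ F]

theorem exists_integral_ball (hP : IsProjectionFamily D x₀ U P)
    (hinv : ∀ y ∈ U, ∀ v w, ofCoord x₀ y (projectionBracket x₀ P y v w) ∈ D y) :
    ∃ (s : ℕ) (k : EuclideanSpace ℝ (Fin s) → N) (r : ℝ), 0 < r ∧ k 0 = x₀ ∧
      Set.InjOn k (Metric.ball 0 r) ∧ ∀ v ∈ Metric.ball 0 r,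
        ContMDiffAt 𝓘(ℝ, EuclideanSpace ℝ (Fin s)) 𝓘(ℝ, F) ∞ k v ∧
        Function.Injective (mfderiv 𝓘(ℝ, EuclideanSpace ℝ (Fin s)) 𝓘(ℝ, F) k v) ∧
        (mfderiv 𝓘(ℝ, EuclideanSpace ℝ (Fin s)) 𝓘(ℝ, F) k v).range = D (k v) := by
  have : CompleteSpace F := FiniteDimensional.complete ℝ F
  let e : EuclideanSpace ℝ (Fin (Module.finrank ℝ (P x₀).range)) ≃ₗ[ℝ] (P x₀).range :=
    LinearEquiv.ofFinrankEq _ _ (by simp)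
  let j : EuclideanSpace ℝ (Fin (Module.finrank ℝ (P x₀).range)) →L[ℝ] F :=
    LinearMap.toContinuousLinearMap ((P x₀).range.subtype ∘ₗ e.toLinearMap)
  have hj : Function.Injective j := Subtype.val_injective.comp e.injective
  have hrange : j.range = (P x₀).range :=
    (LinearMap.range_comp_of_range_eq_top _ e.range).trans (Submodule.range_subtype _)
  obtain ⟨r, hr, k, hk₀, hk⟩ := hP.exists_mfderiv_eq j
    fun y hy v w ↦ hP.projectionBracket_eq_zero hy (hinv y hy v w)
  refine ⟨_, k, r, hr, hk₀, fun v hv w hw hvw ↦ ?_, fun v hv ↦ ⟨(hk v hv).2.1, ?_, ?_⟩⟩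
  · have h := hP.apply_extChartAt_eq j Metric.isOpen_ball (convex_ball 0 r) hk hv hw
    rw [map_sub, map_sub, hP.apply_eq_self hrange, hP.apply_eq_self hrange, hvw] at h
    exact hj (sub_right_injective h)
  · exact (funext (hk v hv).2.2 : ⇑(mfderiv _ _ k v) = _) ▸
      hP.injective_ofCoord_apply hj hrange (hk v hv).1
  · refine SetLike.coe_injective ((congrArg Set.range (funext (hk v hv).2.2)).trans
      (hP.range_ofCoord_apply hrange (hk v hv).1))

end IsProjectionFamily

section Ball

universe v

variable (G : Type v) [NormedAddCommGroup G] [InnerProductSpace ℝ G]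

theorem mdifferentiable_univBall {r : ℝ} (hr : 0 < r) :
    (OpenPartialHomeomorph.univBall (0 : G) r).MDifferentiable 𝓘(ℝ, G) 𝓘(ℝ, G) := by
  refine ⟨?_, ?_⟩
  · exact ((OpenPartialHomeomorph.contDiff_univBall (n := ⊤)).contMDiff.mdifferentiable
      (by simp)).mdifferentiableOn
  · rw [OpenPartialHomeomorph.univBall_target _ hr]
    exact (OpenPartialHomeomorph.contDiffOn_univBall_symm (n := ⊤)).contMDiffOn.mdifferentiableOn
      (by simp)

theorem exists_parametrization_ball {r : ℝ} (hr : 0 < r) :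
    ∃ (L : Type (max u v)) (_ : TopologicalSpace L) (_ : ChartedSpace G L)
      (_ : IsManifold 𝓘(ℝ, G) ∞ L) (_ : ConnectedSpace L) (κ : L → G),
      ContMDiff 𝓘(ℝ, G) 𝓘(ℝ, G) ∞ κ ∧ Function.Injective κ ∧
      (∀ l, κ l ∈ Metric.ball 0 r) ∧ 0 ∈ Set.range κ ∧
      ∀ l, Function.Bijective (mfderiv 𝓘(ℝ, G) 𝓘(ℝ, G) κ l) := by
  let L := ULift.{u} G
  let down : OpenPartialHomeomorph L G := (Homeomorph.ulift : L ≃ₜ G).toOpenPartialHomeomorph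
  let _ : ChartedSpace G L := down.singletonChartedSpace rfl
  have _ : IsManifold 𝓘(ℝ, G) ∞ L := down.isManifold_singleton rfl
  let b := OpenPartialHomeomorph.univBall (0 : G) r
  have hb : ∀ v, v ∈ b.source := by simp [b]
  have hdown : down.MDifferentiable 𝓘(ℝ, G) 𝓘(ℝ, G) :=
    mdifferentiable_of_mem_atlas (Set.mem_singleton_iff.2 rfl)
  have hdown_smooth : ContMDiff 𝓘(ℝ, G) 𝓘(ℝ, G) ∞ down := fun l ↦
    contMDiffAt_extChartAt (I := 𝓘(ℝ, G)) (x := l)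
  refine ⟨L, inferInstance, inferInstance, inferInstance,
    (Homeomorph.ulift (X := G)).symm.surjective.connectedSpace
      (Homeomorph.ulift (X := G)).symm.continuous, b ∘ down,
    OpenPartialHomeomorph.contDiff_univBall.contMDiff.comp hdown_smooth,
    fun l l' h ↦ ULift.down_injective (b.injOn (hb _) (hb _) h), fun l ↦ ?_,
    ⟨⟨0⟩, OpenPartialHomeomorph.univBall_apply_zero (0 : G) r⟩, fun l ↦
      (hdown.trans (mdifferentiable_univBall G hr)).mfderiv_bijective ?_⟩
  · rw [← OpenPartialHomeomorph.univBall_target (0 : G) hr]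
    exact b.map_source (hb _)
  · simp [down]

end Ball

theorem exists_isIntegralManifold [FiniteDimensional ℝ F] {N : Type u} [TopologicalSpace N]
    [ChartedSpace F N] [IsManifold 𝓘(ℝ, F) ∞ N]
    {D : ∀ x : N, Submodule ℝ (TangentSpace 𝓘(ℝ, F) x)} {x₀ : N} {U : Set N} {P : N → F →L[ℝ] F}
    (hP : IsProjectionFamily D x₀ U P)
    (hinv : ∀ y ∈ U, ∀ v w, ofCoord x₀ y (projectionBracket x₀ P y v w) ∈ D y) :
    ∃ (s : ℕ) (L : Type u) (_ : TopologicalSpace L)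
      (_ : ChartedSpace (EuclideanSpace ℝ (Fin s)) L)
      (_ : IsManifold 𝓘(ℝ, EuclideanSpace ℝ (Fin s)) ∞ L) (ι : L → N),
      IsIntegralManifold (G := EuclideanSpace ℝ (Fin s)) D ι ∧ x₀ ∈ Set.range ι := by
  obtain ⟨s, k, r, hr, hk₀, hkinj, hk⟩ := hP.exists_integral_ball hinv
  obtain ⟨L, _, _, _, hconn, κ, hκ, hκinj, hκball, ⟨l₀, hl₀⟩, hκ'⟩ :=
    exists_parametrization_ball (EuclideanSpace ℝ (Fin s)) hr
  have chain : ∀ l, mfderiv 𝓘(ℝ, EuclideanSpace ℝ (Fin s)) 𝓘(ℝ, F) (k ∘ κ) l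
      = (mfderiv 𝓘(ℝ, EuclideanSpace ℝ (Fin s)) 𝓘(ℝ, F) k (κ l)).comp
        (mfderiv 𝓘(ℝ, EuclideanSpace ℝ (Fin s)) 𝓘(ℝ, EuclideanSpace ℝ (Fin s)) κ l) := fun l ↦
    mfderiv_comp l ((hk _ (hκball l)).1.mdifferentiableAt (by simp))
      ((hκ l).mdifferentiableAt (by simp))
  refine ⟨s, L, inferInstance, inferInstance, inferInstance, k ∘ κ,
    { connected := hconn
      contMDiff := fun l ↦ (hk _ (hκball l)).1.comp l (hκ l)
      injective := fun a b hab ↦ hκinj (hkinj (hκball a) (hκball b) hab)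
      immersion := fun l ↦ ?_
      range_eq := fun l ↦ ?_ }, ⟨l₀, by rw [Function.comp_apply, hl₀, hk₀]⟩⟩
  · rw [chain]
    exact (hk _ (hκball l)).2.1.comp (hκ' l).1
  · rw [chain]
    exact (LinearMap.range_comp_of_range_eq_top _ (LinearMap.range_eq_top.2 (hκ' l).2)).trans
      (hk _ (hκball l)).2.2

end Frobenius

section Algebra

variable {E : Type*} [NormedAddCommGroup E] [NormedSpace ℝ E]
  {M : Type*} [TopologicalSpace M] [ChartedSpace E M] [IsManifold 𝓘(ℝ, E) ∞ M]
  {g : SemiRiemannianMetric E M}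
  {F : Type*} [NormedAddCommGroup F] [NormedSpace ℝ F]
  {N : Type*} [TopologicalSpace N] [ChartedSpace F N] [IsManifold 𝓘(ℝ, F) ∞ N]
  (f : NondegSubmanifold g F N)
  {σ : ∀ p : M, Submodule ℝ (TangentSpace 𝓘(ℝ, E) p →L[ℝ] TangentSpace 𝓘(ℝ, E) p)}
  {D : ∀ x : N, Submodule ℝ (TangentSpace 𝓘(ℝ, F) x)}

namespace NondegSubmanifold

theorem induced_apply (x : N) (u w : TangentSpace 𝓘(ℝ, F) x) :
    f.induced x u w = g.val (f.toFun x) (f.d x u) (f.d x w) := rfl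

theorem induced_symm (x : N) (u w : TangentSpace 𝓘(ℝ, F) x) :
    f.induced x u w = f.induced x w u := g.symm _ _ _

variable [FiniteDimensional ℝ F]

theorem exists_mem_induced_eq {x : N} {K : Submodule ℝ (TangentSpace 𝓘(ℝ, F) x)}
    (hK : ∀ u ∈ K, (∀ w ∈ K, f.induced x u w = 0) → u = 0)
    (l : TangentSpace 𝓘(ℝ, F) x →ₗ[ℝ] ℝ) : ∃ u ∈ K, ∀ w ∈ K, f.induced x u w = l w := by
  let b := (f.induced x).domRestrict₁₂ K K
  have hb : ∀ v : K, (∀ w : K, b v w = 0) → v = 0 :=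
    fun v hv ↦ Subtype.ext (hK v v.2 fun w hw ↦ hv ⟨w, hw⟩)
  let v : K := sharp b hb (l ∘ₗ K.subtype)
  exact ⟨v, v.2, fun w hw ↦ apply_sharp b hb (l ∘ₗ K.subtype) ⟨w, hw⟩⟩

theorem exists_mem_add_mem_perp {x : N}
    (hD : ∀ u ∈ D x, (∀ w ∈ D x, f.induced x u w = 0) → u = 0)
    (u : TangentSpace 𝓘(ℝ, F) x) : ∃ w ∈ D x, ∃ z ∈ f.perp D x, u = w + z := by
  obtain ⟨w, hw, hwu⟩ := f.exists_mem_induced_eq hD (f.induced x u)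
  refine ⟨w, hw, u - w, fun w' hw' ↦ ?_, (add_sub_cancel w u).symm⟩
  rw [map_sub, LinearMap.sub_apply, hwu w' hw', sub_self]

theorem perp_nondegenerate {x : N}
    (hD : ∀ u ∈ D x, (∀ w ∈ D x, f.induced x u w = 0) → u = 0)
    {u : TangentSpace 𝓘(ℝ, F) x} (hu : u ∈ f.perp D x)
    (h : ∀ z ∈ f.perp D x, f.induced x u z = 0) : u = 0 := by
  refine f.nondegenerate x u fun v ↦ ?_
  obtain ⟨w, hw, z, hz, rfl⟩ := f.exists_mem_add_mem_perp hD v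
  change f.induced x u (w + z) = 0
  rw [map_add, hu w hw, h z hz, add_zero]

theorem mem_of_perp_perp {x : N}
    (hD : ∀ u ∈ D x, (∀ w ∈ D x, f.induced x u w = 0) → u = 0)
    {u : TangentSpace 𝓘(ℝ, F) x} (h : ∀ z ∈ f.perp D x, f.induced x u z = 0) : u ∈ D x := by
  obtain ⟨w, hw, z, hz, rfl⟩ := f.exists_mem_add_mem_perp hD u
  suffices z = 0 by rwa [this, add_zero]
  refine f.perp_nondegenerate hD hz fun z' hz' ↦ ?_
  have := h z' hz'
  rwa [map_add, LinearMap.add_apply, f.induced_symm x w, hz' w hw, zero_add] at this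

theorem induced_tangentPart (x : N) (v : TangentSpace 𝓘(ℝ, E) (f.toFun x))
    (w : TangentSpace 𝓘(ℝ, F) x) :
    f.induced x (f.tangentPart x v) w = g.val (f.toFun x) v (f.d x w) :=
  apply_sharp (f.induced x) (f.nondegenerate x) _ w

theorem normalPart_mem (x : N) (v : TangentSpace 𝓘(ℝ, E) (f.toFun x)) :
    f.normalPart x v ∈ f.normalSpace x := fun w ↦ by
  rw [normalPart, map_sub, sub_apply, ← f.induced_tangentPart, f.induced_apply, sub_self]

theorem val_normalPart {x : N} {ξ v : TangentSpace 𝓘(ℝ, E) (f.toFun x)}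
    (hξ : ξ ∈ f.normalSpace x) :
    g.val (f.toFun x) ξ (f.normalPart x v) = g.val (f.toFun x) ξ v := by
  rw [normalPart, map_sub, hξ, sub_zero]

theorem tangentPart_add_normalPart (x : N) (v : TangentSpace 𝓘(ℝ, E) (f.toFun x)) :
    f.d x (f.tangentPart x v) + f.normalPart x v = v := add_sub_cancel _ _

theorem normalPart_d_add {x : N} {t : TangentSpace 𝓘(ℝ, F) x}
    {ξ : TangentSpace 𝓘(ℝ, E) (f.toFun x)} (hξ : ξ ∈ f.normalSpace x) :
    f.normalPart x (f.d x t + ξ) = ξ := by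
  have htangent : f.tangentPart x (f.d x t + ξ) = t := by
    rw [← sub_eq_zero]
    refine f.nondegenerate x _ fun w ↦ ?_
    change f.induced x _ w = 0
    rw [map_sub, LinearMap.sub_apply, f.induced_tangentPart, map_add, add_apply,
      hξ w, f.induced_apply, add_zero, sub_self]
  rw [normalPart, htangent, add_sub_cancel_left]

theorem normalPart_d {x : N} (t : TangentSpace 𝓘(ℝ, F) x) : f.normalPart x (f.d x t) = 0 := by
  simpa only [add_zero] using f.normalPart_d_add (t := t) (zero_mem (f.normalSpace x))

theorem normalPart_add (x : N) (v w : TangentSpace 𝓘(ℝ, E) (f.toFun x)) :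
    f.normalPart x (v + w) = f.normalPart x v + f.normalPart x w := by
  have hsum : v + w = f.d x (f.tangentPart x v + f.tangentPart x w)
      + (f.normalPart x v + f.normalPart x w) := by
    rw [map_add]
    conv_lhs => rw [← f.tangentPart_add_normalPart x v, ← f.tangentPart_add_normalPart x w]
    exact add_add_add_comm _ _ _ _
  conv_lhs => rw [hsum]
  exact f.normalPart_d_add (add_mem (f.normalPart_mem x v) (f.normalPart_mem x w))

end NondegSubmanifold

theorem eps_mul_self (α : Fin 3) : eps α * eps α = 1 := by
  fin_cases α <;> simp [eps]

theorem eps_ne_zero (α : Fin 3) : eps α ≠ 0 :=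
  left_ne_zero_of_mul_eq_one (eps_mul_self α)

namespace IsCanonicalBasis

variable {U : Set M} {J : Fin 3 → ∀ p : M, TangentSpace 𝓘(ℝ, E) p →L[ℝ] TangentSpace 𝓘(ℝ, E) p}
  (hJ : IsCanonicalBasis σ U J)

include hJ

theorem mem {p : M} (hp : p ∈ U) (α : Fin 3) : J α p ∈ σ p := by
  rw [← hJ.span_eq p hp]
  exact Submodule.subset_span ⟨α, rfl⟩

theorem exists_apply_apply_eq_smul {p : M} (hp : p ∈ U) {α β : Fin 3} (hαβ : α ≠ β) :
    ∃ (γ : Fin 3) (c : ℝ), ∀ v, J α p (J β p v) = c • J γ p v := by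
  have : β = α + 1 ∨ α = β + 1 := by revert α β; decide
  obtain rfl | rfl := this
  · exact ⟨α + 2, eps (α + 2), hJ.mul_succ p hp α⟩
  · exact ⟨β + 2, -eps (β + 2), fun v ↦ by rw [hJ.succ_mul p hp β, neg_smul]⟩

theorem val_skew (hg : IsAdapted g σ) {p : M} (hp : p ∈ U) (α : Fin 3)
    (v w : TangentSpace 𝓘(ℝ, E) p) : g.val p (J α p v) w = -g.val p v (J α p w) := by
  have hadapted := hg U J hJ p hp α v (J α p w)
  rw [hJ.sq p hp, map_neg, map_smul, smul_eq_mul, ← mul_neg] at hadapted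
  exact neg_eq_iff_eq_neg.1 (mul_left_cancel₀ (eps_ne_zero α) hadapted)

end IsCanonicalBasis

section Bundles

variable {f}

namespace IsCanonicalBasis

variable {U : Set M} {J : Fin 3 → ∀ p : M, TangentSpace 𝓘(ℝ, E) p →L[ℝ] TangentSpace 𝓘(ℝ, E) p}
  (hJ : IsCanonicalBasis σ U J)

include hJ

theorem exists_eq_sum {p : M} (hp : p ∈ U)
    {S : TangentSpace 𝓘(ℝ, E) p →L[ℝ] TangentSpace 𝓘(ℝ, E) p} (hS : S ∈ σ p) :
    ∃ c : Fin 3 → ℝ, ∀ v, S v = ∑ α, c α • J α p v := by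
  rw [← hJ.span_eq p hp, Submodule.mem_span_range_iff_exists_fun] at hS
  obtain ⟨c, rfl⟩ := hS
  exact ⟨c, fun v ↦ by simp⟩

theorem injective {p : M} (hp : p ∈ U) (α : Fin 3) : Function.Injective (J α p) := by
  refine (injective_iff_map_eq_zero (J α p)).2 fun v hv ↦ ?_
  have hsq := hJ.sq p hp α v
  rw [hv, map_zero, eq_comm, neg_eq_zero] at hsq
  exact (smul_eq_zero.1 hsq).resolve_left (eps_ne_zero α)

theorem apply_mem_nuPerp {x : N} (hx : f.toFun x ∈ U) (α : Fin 3) {z : TangentSpace 𝓘(ℝ, F) x}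
    (hz : z ∈ f.perp D x) : J α (f.toFun x) (f.d x z) ∈ f.nuPerp σ D x :=
  Submodule.subset_span ⟨_, hJ.mem hx α, z, hz, rfl⟩

theorem nuPerp_le {x : N} (hx : f.toFun x ∈ U)
    {K : Submodule ℝ (TangentSpace 𝓘(ℝ, E) (f.toFun x))}
    (h : ∀ α, ∀ z ∈ f.perp D x, J α (f.toFun x) (f.d x z) ∈ K) : f.nuPerp σ D x ≤ K := by
  refine Submodule.span_le.2 ?_
  rintro _ ⟨S, hS, z, hz, rfl⟩
  obtain ⟨c, hc⟩ := hJ.exists_eq_sum hx hS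
  rw [hc]
  exact sum_mem fun α _ ↦ K.smul_mem _ (h α z hz)

theorem mem_nu_iff {x : N} (hx : f.toFun x ∈ U) {ξ : TangentSpace 𝓘(ℝ, E) (f.toFun x)} :
    ξ ∈ f.nu σ D x ↔ ξ ∈ f.normalSpace x ∧
      ∀ α, ∀ z ∈ f.perp D x, g.val (f.toFun x) ξ (J α (f.toFun x) (f.d x z)) = 0 := by
  refine ⟨fun h ↦ ⟨h.1, fun α z hz ↦ h.2 _ (hJ.apply_mem_nuPerp hx α hz)⟩, fun h ↦ ⟨h.1, ?_⟩⟩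
  exact fun η hη ↦ hJ.nuPerp_le hx (K := LinearMap.ker (g.val (f.toFun x) ξ).toLinearMap)
    (fun α z hz ↦ h.2 α z hz) hη

end IsCanonicalBasis

namespace NondegSubmanifold.IsParaquaternionicCR

variable (hN : f.IsParaquaternionicCR σ D) {U : Set M}
  {J : Fin 3 → ∀ p : M, TangentSpace 𝓘(ℝ, E) p →L[ℝ] TangentSpace 𝓘(ℝ, E) p}
  (hJ : IsCanonicalBasis σ U J) {x : N} (hx : f.toFun x ∈ U)

include hN hJ hx

theorem nuPerp_le_normalSpace : f.nuPerp σ D x ≤ f.normalSpace x :=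
  hJ.nuPerp_le hx fun α z hz ↦ hN.totallyReal U J hJ x hx α z hz

theorem exists_apply_eq (α : Fin 3) {w : TangentSpace 𝓘(ℝ, F) x} (hw : w ∈ D x) :
    ∃ w' ∈ D x, J α (f.toFun x) (f.d x w) = f.d x w' := by
  have h : J α (f.toFun x) (f.d x w) ∈ (D x).map (f.d x).toLinearMap := by
    rw [← hN.paraquaternionic U J hJ x hx α]
    exact ⟨_, ⟨w, hw, rfl⟩, rfl⟩
  obtain ⟨w', hw', h⟩ := h
  exact ⟨w', hw', h.symm⟩

theorem exists_eq_apply (α : Fin 3) {w : TangentSpace 𝓘(ℝ, F) x} (hw : w ∈ D x) :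
    ∃ w' ∈ D x, f.d x w = J α (f.toFun x) (f.d x w') := by
  have h : f.d x w ∈ (D x).map (f.d x).toLinearMap := ⟨w, hw, rfl⟩
  rw [← hN.paraquaternionic U J hJ x hx α] at h
  obtain ⟨_, ⟨w', hw', rfl⟩, h⟩ := h
  exact ⟨w', hw', h.symm⟩

variable (hg : IsAdapted g σ)

include hg

theorem val_apply_apply_of_ne {α β : Fin 3} (h : α ≠ β) {z : TangentSpace 𝓘(ℝ, F) x}
    (w : TangentSpace 𝓘(ℝ, F) x) (hz : z ∈ f.perp D x) :
    g.val (f.toFun x) (J α (f.toFun x) (f.d x w)) (J β (f.toFun x) (f.d x z)) = 0 := by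
  obtain ⟨γ, c, hc⟩ := hJ.exists_apply_apply_eq_smul hx h
  rw [hJ.val_skew hg hx, hc, map_smul, g.symm, hN.totallyReal U J hJ x hx γ z hz w, smul_zero,
    neg_zero]

variable [FiniteDimensional ℝ F]

theorem exists_mem_nuPerp_val_eq (l : Fin 3 → TangentSpace 𝓘(ℝ, F) x →ₗ[ℝ] ℝ) :
    ∃ m ∈ f.nuPerp σ D x, ∀ α, ∀ w ∈ f.perp D x,
      g.val (f.toFun x) m (J α (f.toFun x) (f.d x w)) = l α w := by
  have hrepr (α : Fin 3) := f.exists_mem_induced_eq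
    (fun u hu ↦ f.perp_nondegenerate (hN.nondegenerate x) hu) (l α)
  choose z hz hzl using hrepr
  refine ⟨∑ α, eps α • J α (f.toFun x) (f.d x (z α)),
    sum_mem fun α _ ↦ Submodule.smul_mem _ _ (hJ.apply_mem_nuPerp hx α (hz α)), fun α w hw ↦ ?_⟩
  rw [map_sum, sum_apply, Finset.sum_eq_single_of_mem α (Finset.mem_univ α), map_smul, smul_apply,
    hg U J hJ _ hx, ← f.induced_apply, hzl α w hw, smul_eq_mul, ← mul_assoc, eps_mul_self, one_mul]
  intro β _ hβα
  rw [map_smul, smul_apply, hN.val_apply_apply_of_ne hJ hx hg hβα _ hw, smul_zero]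

theorem exists_sub_mem_nu {η : TangentSpace 𝓘(ℝ, E) (f.toFun x)} (hη : η ∈ f.normalSpace x) :
    ∃ m ∈ f.nuPerp σ D x, η - m ∈ f.nu σ D x := by
  obtain ⟨m, hm, hmη⟩ := hN.exists_mem_nuPerp_val_eq hJ hx hg fun α ↦
    (g.val (f.toFun x) η).toLinearMap ∘ₗ (J α (f.toFun x)).toLinearMap ∘ₗ (f.d x).toLinearMap
  refine ⟨m, hm, (hJ.mem_nu_iff hx).2
    ⟨sub_mem hη (hN.nuPerp_le_normalSpace hJ hx hm), fun α w hw ↦ ?_⟩⟩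
  rw [map_sub, sub_apply, hmη α w hw]
  exact sub_self _

theorem eq_zero_of_mem_normalSpace {ξ : TangentSpace 𝓘(ℝ, E) (f.toFun x)}
    (hξ : ξ ∈ f.normalSpace x) (hnuPerp : ∀ η ∈ f.nuPerp σ D x, g.val (f.toFun x) ξ η = 0)
    (hnu : ∀ η ∈ f.nu σ D x, g.val (f.toFun x) ξ η = 0) : ξ = 0 := by
  refine g.nondegenerate _ ξ fun v ↦ ?_
  obtain ⟨m, hm, hn⟩ := hN.exists_sub_mem_nu hJ hx hg (f.normalPart_mem x v)
  rw [← f.tangentPart_add_normalPart x v, ← sub_add_cancel (f.normalPart x v) m, map_add, map_add,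
    hξ, hnuPerp m hm, hnu _ hn, add_zero, add_zero]

theorem eq_zero_of_mem_nu_of_mem_nuPerp {ξ : TangentSpace 𝓘(ℝ, E) (f.toFun x)}
    (hnu : ξ ∈ f.nu σ D x) (hnuPerp : ξ ∈ f.nuPerp σ D x) : ξ = 0 :=
  hN.eq_zero_of_mem_normalSpace hJ hx hg hnu.1 hnu.2 fun η hη ↦ by rw [g.symm, hη.2 ξ hnuPerp]

theorem apply_mem_nu (α : Fin 3) {ξ : TangentSpace 𝓘(ℝ, E) (f.toFun x)} (h : ξ ∈ f.nu σ D x) :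
    J α (f.toFun x) ξ ∈ f.nu σ D x := by
  refine (hJ.mem_nu_iff hx).2 ⟨fun u ↦ ?_, fun β z hz ↦ ?_⟩
  · obtain ⟨w, hw, z, hz, rfl⟩ := f.exists_mem_add_mem_perp (hN.nondegenerate x) u
    obtain ⟨w', -, hw'⟩ := hN.exists_apply_eq hJ hx α hw
    rw [hJ.val_skew hg hx, map_add, map_add, map_add, hw', h.1,
      h.2 _ (hJ.apply_mem_nuPerp hx α hz), add_zero, neg_zero]
  · rw [hJ.val_skew hg hx]
    rcases eq_or_ne α β with rfl | hne
    · rw [hJ.sq _ hx, map_neg, map_smul, h.1, smul_zero, neg_zero, neg_zero]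
    · obtain ⟨γ, c, hc⟩ := hJ.exists_apply_apply_eq_smul hx hne
      rw [hc, map_smul, h.2 _ (hJ.apply_mem_nuPerp hx γ hz), smul_zero, neg_zero]

end NondegSubmanifold.IsParaquaternionicCR

end Bundles

end Algebra

section SecondForm

variable {E : Type*} [NormedAddCommGroup E] [NormedSpace ℝ E]
  {M : Type*} [TopologicalSpace M] [ChartedSpace E M] [IsManifold 𝓘(ℝ, E) ∞ M]
  {g : SemiRiemannianMetric E M}
  {F : Type*} [NormedAddCommGroup F] [NormedSpace ℝ F]
  {N : Type*} [TopologicalSpace N] [ChartedSpace F N] [IsManifold 𝓘(ℝ, F) ∞ N]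

namespace NondegSubmanifold

variable [FiniteDimensional ℝ E] [FiniteDimensional ℝ F] (f : NondegSubmanifold g F N)

/-- The second fundamental form of `N` as a tensor: the normal part of the Hessian of the immersion.
By `normalPart_covAlong` its value `B(X, Y)` at `x` depends on `X x` and `Y x` only. -/
def secondForm (x : N) (u w : TangentSpace 𝓘(ℝ, F) x) : TangentSpace 𝓘(ℝ, E) (f.toFun x) :=
  f.normalPart x (g.chartHessian f.toFun x x u w)

theorem secondForm_mem (x : N) (u w : TangentSpace 𝓘(ℝ, F) x) :
    f.secondForm x u w ∈ f.normalSpace x := f.normalPart_mem x _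

theorem secondForm_symm (x : N) (u w : TangentSpace 𝓘(ℝ, F) x) :
    f.secondForm x u w = f.secondForm x w u :=
  congrArg _ (g.chartHessian_symm f.contMDiff.contMDiffAt (mem_chart_source F x) u w)

theorem secondForm_add (x : N) (u w w' : TangentSpace 𝓘(ℝ, F) x) :
    f.secondForm x u (w + w') = f.secondForm x u w + f.secondForm x u w' := by
  rw [secondForm, g.chartHessian_add, f.normalPart_add, secondForm, secondForm]

theorem normalPart_covAlong {x : N} {Y : ∀ y : N, TangentSpace 𝓘(ℝ, F) y}
    (hY : SmoothAlongAt F id x Y) (u : TangentSpace 𝓘(ℝ, F) x) :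
    f.normalPart x (g.covAlong f.toFun (fun y ↦ f.d y (Y y)) x u) = f.secondForm x u (Y x) := by
  have hcov := g.covAlong_mfderiv f.contMDiff (mem_chart_source F x) hY u
  change g.covAlong f.toFun (fun y ↦ f.d y (Y y)) x u = _ + f.d x _ at hcov
  rw [hcov, f.normalPart_add, f.normalPart_d, add_zero, secondForm]

theorem val_covAlong_normal {x : N} {ξ : ∀ y : N, TangentSpace 𝓘(ℝ, E) (f.toFun y)}
    (hξ : SmoothAlongAt F f.toFun x ξ) (hn : ∀ᶠ y in 𝓝 x, ξ y ∈ f.normalSpace y)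
    (u w : TangentSpace 𝓘(ℝ, F) x) :
    g.val (f.toFun x) (g.covAlong f.toFun ξ x u) (f.d x w)
      = -g.val (f.toFun x) (ξ x) (f.secondForm x u w) := by
  let W (y : N) : TangentSpace 𝓘(ℝ, F) y := ofCoord x y (toCoord x x w)
  have hW : SmoothAlongAt F id x W := smoothAlongAt_ofCoord_const (mem_chart_source F x) _
  have hWx : W x = w := ofCoord_toCoord (mem_chart_source F x) w
  have orthogonal : (fun y ↦ g.val (f.toFun y) (ξ y) (f.d y (W y))) =ᶠ[𝓝 x] fun _ ↦ 0 :=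
    hn.mono fun y hy ↦ hy (W y)
  have hderiv : mvfderiv 𝓘(ℝ, F) (fun y ↦ g.val (f.toFun y) (ξ y) (f.d y (W y))) x u = _ :=
    g.mvfderiv_val hξ (smoothAlongAt_mfderiv f.contMDiff hW) u
  rw [mvfderiv_congr_of_eventuallyEq orthogonal, mvfderiv_const] at hderiv
  rw [← hWx, ← f.normalPart_covAlong hW u, f.val_normalPart hn.self_of_nhds]
  exact eq_neg_of_add_eq_zero_left hderiv.symm

theorem induced_shape {x : N} {ξ : ∀ y : N, TangentSpace 𝓘(ℝ, E) (f.toFun y)}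
    (hξ : SmoothAlongAt F f.toFun x ξ) (hn : ∀ᶠ y in 𝓝 x, ξ y ∈ f.normalSpace y)
    (X : ∀ y : N, TangentSpace 𝓘(ℝ, F) y) (w : TangentSpace 𝓘(ℝ, F) x) :
    f.induced x (f.shape ξ X x) w = g.val (f.toFun x) (ξ x) (f.secondForm x (X x) w) := by
  rw [shape, map_neg, LinearMap.neg_apply, f.induced_tangentPart, f.val_covAlong_normal hξ hn,
    neg_neg]

end NondegSubmanifold

variable {f : NondegSubmanifold g F N}
  {σ : ∀ p : M, Submodule ℝ (TangentSpace 𝓘(ℝ, E) p →L[ℝ] TangentSpace 𝓘(ℝ, E) p)}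
  {D : ∀ x : N, Submodule ℝ (TangentSpace 𝓘(ℝ, F) x)} {U : Set M}
  {J : Fin 3 → ∀ p : M, TangentSpace 𝓘(ℝ, E) p →L[ℝ] TangentSpace 𝓘(ℝ, E) p}
  {x : N} {Z : ∀ y : N, TangentSpace 𝓘(ℝ, F) y}

theorem IsCanonicalBasis.smoothAlongAt_apply (hJ : IsCanonicalBasis σ U J) (hx : f.toFun x ∈ U)
    (hZ : SmoothAlongAt F id x Z) (α : Fin 3) :
    SmoothAlongAt F f.toFun x (fun y ↦ J α (f.toFun y) (f.d y (Z y))) :=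
  (hJ.smooth α).smoothAlongAt_apply hJ.isOpen hx (smoothAlongAt_mfderiv f.contMDiff hZ)

namespace NondegSubmanifold.IsParaquaternionicCR

theorem eventually_apply_mem_normalSpace (hN : f.IsParaquaternionicCR σ D)
    (hJ : IsCanonicalBasis σ U J) (hx : f.toFun x ∈ U) (hZp : ∀ᶠ y in 𝓝 x, Z y ∈ f.perp D y)
    (α : Fin 3) : ∀ᶠ y in 𝓝 x, J α (f.toFun y) (f.d y (Z y)) ∈ f.normalSpace y := by
  filter_upwards [hZp, f.contMDiff.continuous.continuousAt.preimage_mem_nhds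
    (hJ.isOpen.mem_nhds hx)] with y hy hyU using hN.totallyReal U J hJ y hyU α _ hy

end NondegSubmanifold.IsParaquaternionicCR

variable [FiniteDimensional ℝ E]

theorem IsParaquaternionicKahler.exists_covAlong_apply (hM : IsParaquaternionicKahler g σ)
    (hJ : IsCanonicalBasis σ U J) (hx : f.toFun x ∈ U) (hZ : SmoothAlongAt F id x Z)
    (hZx : Z x ∈ f.perp D x) (α : Fin 3) (u : TangentSpace 𝓘(ℝ, F) x) :
    ∃ η ∈ f.nuPerp σ D x,
      g.covAlong f.toFun (fun y ↦ J α (f.toFun y) (f.d y (Z y))) x u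
        = J α (f.toFun x) (g.covAlong f.toFun (fun y ↦ f.d y (Z y)) x u) + η := by
  obtain ⟨T, hT, hcov⟩ := hM.parallel.exists_covAlong hJ.isOpen (hJ.smooth α)
    (fun p hp ↦ hJ.mem hp α) hx u
  exact ⟨T (f.d x (Z x)), Submodule.subset_span ⟨T, hT, Z x, hZx, rfl⟩,
    hcov _ (smoothAlongAt_mfderiv f.contMDiff hZ)⟩

theorem NondegSubmanifold.IsParaquaternionicCR.val_covAlong_apply [FiniteDimensional ℝ F]
    (hN : f.IsParaquaternionicCR σ D) (hM : IsParaquaternionicKahler g σ)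
    (hJ : IsCanonicalBasis σ U J) (hx : f.toFun x ∈ U) (hZ : SmoothAlongAt F id x Z)
    (hZp : ∀ᶠ y in 𝓝 x, Z y ∈ f.perp D y) (α : Fin 3) (u w : TangentSpace 𝓘(ℝ, F) x) :
    g.val (f.toFun x) (g.covAlong f.toFun (fun y ↦ f.d y (Z y)) x u) (J α (f.toFun x) (f.d x w))
      = g.val (f.toFun x) (J α (f.toFun x) (f.d x (Z x))) (f.secondForm x u w) := by
  obtain ⟨η, hη, hcov⟩ := hM.exists_covAlong_apply hJ hx hZ hZp.self_of_nhds α u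
  have weingarten := f.val_covAlong_normal (hJ.smoothAlongAt_apply hx hZ α)
    (hN.eventually_apply_mem_normalSpace hJ hx hZp α) u w
  have skew := hJ.val_skew hM.adapted hx α
    (g.covAlong f.toFun (fun y ↦ f.d y (Z y)) x u) (f.d x w)
  rw [hcov, map_add, add_apply, hN.nuPerp_le_normalSpace hJ hx hη w] at weingarten
  linarith

end SecondForm

section Extension

variable {E : Type*} [NormedAddCommGroup E] [NormedSpace ℝ E]
  {M : Type*} [TopologicalSpace M] [ChartedSpace E M] [IsManifold 𝓘(ℝ, E) ∞ M]
  {g : SemiRiemannianMetric E M}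
  {F : Type*} [NormedAddCommGroup F] [NormedSpace ℝ F]
  {N : Type*} [TopologicalSpace N] [ChartedSpace F N]
  {σ : ∀ p : M, Submodule ℝ (TangentSpace 𝓘(ℝ, E) p →L[ℝ] TangentSpace 𝓘(ℝ, E) p)}
  {D : ∀ x : N, Submodule ℝ (TangentSpace 𝓘(ℝ, F) x)} {x : N}

theorem exists_isSectionAlong_of_ker {R : Type*} [NormedAddCommGroup R] [NormedSpace ℝ R]
    [FiniteDimensional ℝ R] {φ : N → M} (hφ : ContMDiff 𝓘(ℝ, F) 𝓘(ℝ, E) ∞ φ)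
    {S : ∀ y : N, Submodule ℝ (TangentSpace 𝓘(ℝ, E) (φ y))} {U₀ : Set N} (hU₀ : IsOpen U₀)
    (hx : x ∈ U₀) {p : M} (hp : ∀ y ∈ U₀, φ y ∈ (chartAt E p).source) {Λ : N → E →L[ℝ] R}
    (hΛ : ∀ y ∈ U₀, ContMDiffAt 𝓘(ℝ, F) 𝓘(ℝ, E →L[ℝ] R) ∞ Λ y)
    (hsurj : Function.Surjective (Λ x))
    (hker : ∀ y ∈ U₀, ∀ b, Λ y b = 0 ↔ ofCoord p (φ y) b ∈ S y)
    {η : TangentSpace 𝓘(ℝ, E) (φ x)} (hη : η ∈ S x) :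
    ∃ (U : Set N) (ξ : ∀ y : N, TangentSpace 𝓘(ℝ, E) (φ y)), IsOpen U ∧ x ∈ U ∧
      IsSectionAlong F φ S U ξ ∧ ξ x = η := by
  obtain ⟨Q, U, hU, hxU, hUU₀, hQ⟩ := exists_smooth_projection_ker hU₀ hx hΛ hsurj
  refine ⟨U, fun y ↦ ofCoord p (φ y) (Q y (toCoord p (φ x) η)), hU, hxU,
    ⟨fun y hy ↦ ?_, fun y hy ↦ ?_⟩, ?_⟩
  · exact ContMDiffAt.contMDiffWithinAt (smoothAlongAt_ofCoord (hp y (hUU₀ hy)) hφ.contMDiffAt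
      ((hQ y hy).1.clm_apply contMDiffAt_const))
  · obtain ⟨-, hΛQ, -⟩ := hQ y hy
    exact (hker y (hUU₀ hy) _).1 (hΛQ _)
  · obtain ⟨-, -, hQ_of_ker, -⟩ := hQ x hxU
    beta_reduce
    rw [hQ_of_ker _ ((hker x hx _).2 (by rwa [ofCoord_toCoord (hp x hx)])),
      ofCoord_toCoord (hp x hx)]

variable [IsManifold 𝓘(ℝ, F) ∞ N]

theorem isSection_top {U : Set N} {Y : ∀ y : N, TangentSpace 𝓘(ℝ, F) y} :
    IsSection (fun y : N ↦ (⊤ : Submodule ℝ (TangentSpace 𝓘(ℝ, F) y))) U Y ↔ SmoothOn U Y :=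
  ⟨fun hY ↦ hY.smooth, fun hY ↦ ⟨hY, fun _ _ ↦ Submodule.mem_top⟩⟩

theorem IsSection.mono {U U' : Set N} {Y : ∀ y : N, TangentSpace 𝓘(ℝ, F) y}
    (hY : IsSection D U Y) (hU' : U' ⊆ U) : IsSection D U' Y :=
  ⟨hY.smooth.mono hU', fun y hy ↦ hY.mem y (hU' hy)⟩

theorem IsSection.eventually_mem {U : Set N} {Y : ∀ y : N, TangentSpace 𝓘(ℝ, F) y}
    (hY : IsSection D U Y) (hU : IsOpen U) (hx : x ∈ U) : ∀ᶠ y in 𝓝 x, Y y ∈ D y :=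
  Filter.eventually_of_mem (hU.mem_nhds hx) hY.mem

variable (D) in
/-- Every vector of the family of subspaces `D` extends to a smooth local section of `D`. -/
def HasLocalSections : Prop :=
  ∀ x, ∀ v ∈ D x, ∃ (U : Set N) (Y : ∀ y : N, TangentSpace 𝓘(ℝ, F) y),
    IsOpen U ∧ x ∈ U ∧ IsSection D U Y ∧ Y x = v

theorem HasLocalSections.exists_isSection_pair
    {D' : ∀ x : N, Submodule ℝ (TangentSpace 𝓘(ℝ, F) x)} (hD : HasLocalSections D)
    (hD' : HasLocalSections D') {W : Set N} (hW : IsOpen W) (hx : x ∈ W)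
    {v w : TangentSpace 𝓘(ℝ, F) x} (hv : v ∈ D x) (hw : w ∈ D' x) :
    ∃ (U : Set N) (X Y : ∀ y : N, TangentSpace 𝓘(ℝ, F) y), IsOpen U ∧ x ∈ U ∧ U ⊆ W ∧
      IsSection D U X ∧ IsSection D' U Y ∧ X x = v ∧ Y x = w := by
  obtain ⟨U, X, hU, hxU, hX, hXx⟩ := hD x v hv
  obtain ⟨U', Y, hU', hxU', hY, hYx⟩ := hD' x w hw
  exact ⟨U ∩ U' ∩ W, X, Y, (hU.inter hU').inter hW, ⟨⟨hxU, hxU'⟩, hx⟩, Set.inter_subset_right,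
    hX.mono fun y hy ↦ hy.1.1, hY.mono fun y hy ↦ hy.1.2, hXx, hYx⟩

theorem hasLocalSections_top :
    HasLocalSections (fun x : N ↦ (⊤ : Submodule ℝ (TangentSpace 𝓘(ℝ, F) x))) := fun x w _ ↦
  ⟨(chartAt F x).source, fun y ↦ ofCoord x y (toCoord x x w), (chartAt F x).open_source,
    mem_chart_source F x,
    isSection_top.2 fun _ hy ↦ (smoothAlongAt_ofCoord_const hy _).contMDiffWithinAt,
    ofCoord_toCoord (mem_chart_source F x) w⟩

theorem SmoothAlongAt.linearCombination {r : ℕ} {X : Fin r → ∀ y : N, TangentSpace 𝓘(ℝ, F) y}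
    (hX : ∀ i, SmoothAlongAt F id x (X i)) (c : Fin r → ℝ) :
    SmoothAlongAt F id x (fun y ↦ ∑ i, c i • X i y) := by
  have hsource := mem_chart_source F x
  refine (smoothAlongAt_iff hsource).2 ⟨contMDiffAt_id, ?_⟩
  simp only [map_sum, map_smul]
  exact ContMDiffAt.sum fun i _ ↦
    (contMDiffAt_const (I := 𝓘(ℝ, F)) (I' := 𝓘(ℝ)) (c := c i)).smul
      ((hX i).contMDiffAt_toCoord hsource)

theorem IsDistribution.hasLocalSections (hD : IsDistribution D) : HasLocalSections D := by
  intro x w hw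
  obtain ⟨U, hU, hx, r, X, hX, hframe⟩ := hD x
  rw [← (hframe x hx).2, Submodule.mem_span_range_iff_exists_fun] at hw
  obtain ⟨c, hc⟩ := hw
  refine ⟨U, fun y ↦ ∑ i, c i • X i y, hU, hx, ⟨fun y hy ↦ ?_, fun y hy ↦ ?_⟩, hc⟩
  · exact ContMDiffAt.contMDiffWithinAt
      (SmoothAlongAt.linearCombination (fun i ↦ (hX i).smoothAlongAt hU hy) c)
  · rw [← (hframe y hy).2]
    exact sum_mem fun i _ ↦ Submodule.smul_mem _ _ (Submodule.subset_span ⟨i, rfl⟩)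

theorem IsProjectionFamily.exists_isSection {U : Set N} {P : N → F →L[ℝ] F}
    (hP : IsProjectionFamily D x U P) {v : TangentSpace 𝓘(ℝ, F) x} (hv : v ∈ D x) :
    ∃ Y : ∀ y : N, TangentSpace 𝓘(ℝ, F) y, IsSection D U Y ∧ Y x = v := by
  refine ⟨fun y ↦ ofCoord x y (P y (toCoord x x v)), ⟨fun y hy ↦ ?_,
    fun y hy ↦ hP.ofCoord_apply_mem y hy _⟩, ?_⟩
  · exact ContMDiffAt.contMDiffWithinAt (smoothAlongAt_ofCoord (φ := id) (x := y)
      (hP.subset_source hy) contMDiffAt_id ((hP.contMDiffAt y hy).clm_apply contMDiffAt_const))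
  · beta_reduce
    rw [hP.apply_toCoord x hP.mem v hv, ofCoord_toCoord (mem_chart_source F x)]

namespace NondegSubmanifold

variable (f : NondegSubmanifold g F N)

section FrameCovectors

variable {r : ℕ} (X : Fin r → ∀ y : N, TangentSpace 𝓘(ℝ, F) y)

/-- The covectors `g(X i, ·)` at `y`, in the preferred chart of `N` at `x`. If the fields `X i` span
`D`, they are the equations of `D^⊥`. -/
def frameCovectors (x y : N) : F →L[ℝ] (Fin r → ℝ) := ContinuousLinearMap.pi fun i ↦
  (g.val (f.toFun y) (f.d y (X i y))).comp ((f.d y).comp (ofCoord x y))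

variable {X}

theorem frameCovectors_apply (x y : N) (v : F) (i : Fin r) :
    f.frameCovectors X x y v i = f.induced y (ofCoord x y v) (X i y) := f.induced_symm y _ _

theorem frameCovectors_eq_zero_iff {y : N}
    (hspan : Submodule.span ℝ (Set.range fun i ↦ X i y) = D y) (v : F) :
    f.frameCovectors X x y v = 0 ↔ ofCoord x y v ∈ f.perp D y := by
  constructor
  · intro hzero
    have hle : D y ≤ LinearMap.ker (f.induced y (ofCoord x y v)) := by
      rw [← hspan, Submodule.span_le]
      rintro _ ⟨i, rfl⟩
      exact (f.frameCovectors_apply x y v i).symm.trans (congrFun hzero i)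
    exact fun w hw ↦ hle hw
  · intro hv
    funext i
    rw [frameCovectors_apply]
    exact hv _ (hspan ▸ Submodule.subset_span ⟨i, rfl⟩)

variable [FiniteDimensional ℝ F]

theorem contMDiffAt_frameCovectors {y : N} (hy : y ∈ (chartAt F x).source)
    (hX : ∀ i, SmoothAlongAt F id y (X i)) :
    ContMDiffAt 𝓘(ℝ, F) 𝓘(ℝ, F →L[ℝ] (Fin r → ℝ)) ∞ (f.frameCovectors X x) y :=
  contMDiffAt_clm_of_apply fun v ↦ contMDiffAt_pi_space.2 fun i ↦
    g.contMDiffAt_val (smoothAlongAt_mfderiv f.contMDiff (hX i))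
      (smoothAlongAt_mfderiv f.contMDiff (smoothAlongAt_ofCoord_const hy v))

theorem frameCovectors_surjective (hX : LinearIndependent ℝ fun i ↦ X i x) :
    Function.Surjective (f.frameCovectors X x x) := fun c ↦ by
  obtain ⟨l, hl⟩ := LinearMap.exists_extend ((Module.Basis.span hX).constr ℝ c : _ →ₗ[ℝ] ℝ)
  have hlX (i : Fin r) : l (X i x) = c i := by
    have hlb := LinearMap.congr_fun hl (Module.Basis.span hX i)
    rwa [Module.Basis.constr_basis, LinearMap.comp_apply, Submodule.subtype_apply,
      Module.Basis.span_apply] at hlb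
  refine ⟨toCoord x x (sharp (f.induced x) (f.nondegenerate x) l), funext fun i ↦ ?_⟩
  rw [frameCovectors_apply, ofCoord_toCoord (mem_chart_source F x), ← hlX i]
  exact apply_sharp (f.induced x) (f.nondegenerate x) l _

theorem exists_isProjectionFamily_perp (hD : IsDistribution D) (x : N) :
    ∃ (U : Set N) (P : N → F →L[ℝ] F), IsProjectionFamily (f.perp D) x U P := by
  obtain ⟨U₁, hU₁, hx, r, X, hX, hframe⟩ := hD x
  obtain ⟨P, U, hU, hxU, hsubset, hP⟩ := exists_smooth_projection_ker
    (hU₁.inter (chartAt F x).open_source) ⟨hx, mem_chart_source F x⟩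
    (fun y hy ↦ f.contMDiffAt_frameCovectors hy.2 fun i ↦ (hX i).smoothAlongAt hU₁ hy.1)
    (f.frameCovectors_surjective (hframe x hx).1)
  have hker (y : N) (hy : y ∈ U) (v : F) :
      f.frameCovectors X x y v = 0 ↔ ofCoord x y v ∈ f.perp D y :=
    f.frameCovectors_eq_zero_iff (hframe y (hsubset hy).1).2 v
  refine ⟨U, P, hU, hxU, fun y hy ↦ (hsubset hy).2, fun y hy ↦ (hP y hy).1,
    fun y hy ↦ (hP y hy).2.2.2, fun y hy v ↦ ?_, fun y hy v hv ↦ ?_⟩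
  · exact (hker y hy _).1 ((hP y hy).2.1 v)
  · exact (hP y hy).2.2.1 _ ((hker y hy _).2 (by rwa [ofCoord_toCoord (hsubset hy).2]))

theorem hasLocalSections_perp (hD : IsDistribution D) : HasLocalSections (f.perp D) := by
  intro x v hv
  obtain ⟨U, P, hP⟩ := f.exists_isProjectionFamily_perp hD x
  obtain ⟨Y, hY, hYx⟩ := hP.exists_isSection hv
  exact ⟨U, Y, hP.isOpen, hP.mem, hY, hYx⟩

end FrameCovectors

section NuCovectors

variable (J : Fin 3 → ∀ p : M, TangentSpace 𝓘(ℝ, E) p →L[ℝ] TangentSpace 𝓘(ℝ, E) p)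
  (P : N → F →L[ℝ] F) {G : Type*} [NormedAddCommGroup G] [NormedSpace ℝ G] (j : G →L[ℝ] F)

/-- The linear forms `g(·, t)` and `g(·, J α (P y (j w)))` at `y`, for `t` in `F` and `w` in `G`, in
the preferred charts at `x` and `f x`. When `P` is a projection family of `D^⊥` and `j` is a
parametrization of the range of `P x`, they are the equations of `ν`; they are independent because
`w` runs through the range of `P x` only. -/
def nuCovectors (x y : N) : E →L[ℝ] (F →L[ℝ] ℝ) × (Fin 3 → G →L[ℝ] ℝ) :=
  ((((f.d y).comp (ofCoord x y)).precomp ℝ).comp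
      ((g.val (f.toFun y)).comp (ofCoord (f.toFun x) (f.toFun y)))).prod
    (ContinuousLinearMap.pi fun α ↦
      (((J α (f.toFun y)).comp ((f.d y).comp ((ofCoord x y).comp
        ((P y).comp j)))).precomp ℝ).comp
      ((g.val (f.toFun y)).comp (ofCoord (f.toFun x) (f.toFun y))))

variable {J P j}

theorem nuCovectors_fst_apply (x y : N) (b : E) (t : F) :
    (f.nuCovectors J P j x y b).1 t
      = g.val (f.toFun y) (ofCoord (f.toFun x) (f.toFun y) b) (f.d y (ofCoord x y t)) := rfl

theorem nuCovectors_snd_apply (x y : N) (b : E) (α : Fin 3) (w : G) :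
    (f.nuCovectors J P j x y b).2 α w
      = g.val (f.toFun y) (ofCoord (f.toFun x) (f.toFun y) b)
        (J α (f.toFun y) (f.d y (ofCoord x y (P y (j w))))) := rfl

variable {f} {U : Set N} {V : Set M} {k : F →L[ℝ] G}

theorem nuCovectors_eq_zero_iff (hP : IsProjectionFamily (f.perp D) x U P)
    (hJ : IsCanonicalBasis σ V J) (hjk : ∀ v, j (k v) = P x v) {y : N} (hy : y ∈ U)
    (hyV : f.toFun y ∈ V) (b : E) :
    f.nuCovectors J P j x y b = 0 ↔ ofCoord (f.toFun x) (f.toFun y) b ∈ f.nu σ D y := by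
  have hsource := hP.subset_source hy
  rw [hJ.mem_nu_iff hyV]
  refine ⟨fun hzero ↦ ⟨fun u ↦ ?_, fun α z hz ↦ ?_⟩,
    fun hnu ↦ Prod.ext ?_ (funext fun α ↦ ?_)⟩
  · rw [← ofCoord_toCoord hsource u, ← f.nuCovectors_fst_apply (j := j), hzero]
    rfl
  · have hzP : toCoord x y z = P y (j (k (toCoord x y z))) := by
      rw [hjk, hP.apply_apply y hy x hP.mem, hP.apply_toCoord y hy z hz]
    rw [← ofCoord_toCoord hsource z, hzP,
      ← f.nuCovectors_snd_apply x y b α (k (toCoord x y z)), hzero]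
    rfl
  · ext t
    exact hnu.1 _
  · ext w
    exact hnu.2 α _ (hP.ofCoord_apply_mem y hy _)

variable [FiniteDimensional ℝ F]

theorem nuCovectors_surjective (hN : f.IsParaquaternionicCR σ D) (hg : IsAdapted g σ)
    (hP : IsProjectionFamily (f.perp D) x U P) (hJ : IsCanonicalBasis σ V J)
    (hxV : f.toFun x ∈ V) (hkj : ∀ w, k (j w) = w) (hjk : ∀ v, j (k v) = P x v) :
    Function.Surjective (f.nuCovectors J P j x x) := by
  rintro ⟨l, l'⟩
  have hsource := mem_chart_source F x
  have hsource' := mem_chart_source E (f.toFun x)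
  let t₀ := sharp (f.induced x) (f.nondegenerate x) (l.toLinearMap ∘ₗ (toCoord x x).toLinearMap)
  obtain ⟨m, hm, hml'⟩ := hN.exists_mem_nuPerp_val_eq hJ hxV hg fun α ↦
    (l' α).toLinearMap ∘ₗ k.toLinearMap ∘ₗ (toCoord x x).toLinearMap
  refine ⟨toCoord (f.toFun x) (f.toFun x) (f.d x t₀ + m), Prod.ext ?_ (funext fun α ↦ ?_)⟩
  · ext t
    rw [nuCovectors_fst_apply, ofCoord_toCoord hsource', map_add, add_apply,
      hN.nuPerp_le_normalSpace hJ hxV hm, add_zero]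
    refine (apply_sharp (f.induced x) (f.nondegenerate x) _ _).trans ?_
    exact congrArg l (toCoord_ofCoord hsource t)
  · ext w
    have hPw : P x (j w) = j w := by rw [← hjk, hkj]
    have hw : ofCoord x x (j w) ∈ f.perp D x := hPw ▸ hP.ofCoord_apply_mem x hP.mem (j w)
    rw [nuCovectors_snd_apply, ofCoord_toCoord hsource', hPw, map_add, add_apply,
      g.symm _ (f.d x t₀), hN.totallyReal V J hJ x hxV α _ hw, zero_add, hml' α _ hw]
    exact congrArg (l' α) ((congrArg k (toCoord_ofCoord hsource _)).trans (hkj w))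

variable [FiniteDimensional ℝ E] [FiniteDimensional ℝ G]

theorem contMDiffAt_nuCovectors (hP : IsProjectionFamily D x U P)
    (hJ : IsCanonicalBasis σ V J) {y : N} (hy : y ∈ U) (hyV : f.toFun y ∈ V)
    (hyx : f.toFun y ∈ (chartAt E (f.toFun x)).source) :
    ContMDiffAt 𝓘(ℝ, F) 𝓘(ℝ, E →L[ℝ] (F →L[ℝ] ℝ) × (Fin 3 → G →L[ℝ] ℝ)) ∞
      (f.nuCovectors J P j x) y := by
  refine contMDiffAt_clm_of_apply fun b ↦ ?_
  have hb : SmoothAlongAt F f.toFun y (fun y ↦ ofCoord (f.toFun x) (f.toFun y) b) :=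
    smoothAlongAt_ofCoord hyx f.contMDiff.contMDiffAt contMDiffAt_const
  have hsource := hP.subset_source hy
  refine ContMDiffAt.prodMk_space ?_ (contMDiffAt_pi_space.2 fun α ↦ ?_)
  · exact contMDiffAt_clm_of_apply fun t ↦ g.contMDiffAt_val hb
      (smoothAlongAt_mfderiv f.contMDiff (smoothAlongAt_ofCoord_const hsource t))
  · exact contMDiffAt_clm_of_apply fun w ↦ g.contMDiffAt_val hb (hJ.smoothAlongAt_apply hyV
      (smoothAlongAt_ofCoord (φ := id) (x := y) hsource contMDiffAt_id
        ((hP.contMDiffAt y hy).clm_apply contMDiffAt_const)) α)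

theorem exists_isSectionAlong_nu_of_factorization (hN : f.IsParaquaternionicCR σ D)
    (hg : IsAdapted g σ) (hP : IsProjectionFamily (f.perp D) x U P) (hJ : IsCanonicalBasis σ V J)
    (hxV : f.toFun x ∈ V) (hkj : ∀ w, k (j w) = w) (hjk : ∀ v, j (k v) = P x v)
    {η : TangentSpace 𝓘(ℝ, E) (f.toFun x)} (hη : η ∈ f.nu σ D x) :
    ∃ (U : Set N) (ξ : ∀ y : N, TangentSpace 𝓘(ℝ, E) (f.toFun y)), IsOpen U ∧ x ∈ U ∧
      IsSectionAlong F f.toFun (f.nu σ D) U ξ ∧ ξ x = η := by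
  have hopen : IsOpen (U ∩ f.toFun ⁻¹' (V ∩ (chartAt E (f.toFun x)).source)) :=
    hP.isOpen.inter ((hJ.isOpen.inter (chartAt E (f.toFun x)).open_source).preimage
      f.contMDiff.continuous)
  exact exists_isSectionAlong_of_ker f.contMDiff hopen ⟨hP.mem, hxV, mem_chart_source E _⟩
    (fun y hy ↦ hy.2.2) (fun y hy ↦ contMDiffAt_nuCovectors (j := j) hP hJ hy.1 hy.2.1 hy.2.2)
    (nuCovectors_surjective hN hg hP hJ hxV hkj hjk)
    (fun y hy ↦ nuCovectors_eq_zero_iff hP hJ hjk hy.1 hy.2.1) hη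

theorem IsParaquaternionicCR.exists_isSectionAlong_nu (hN : f.IsParaquaternionicCR σ D)
    (hg : IsAdapted g σ) (hJ : IsCanonicalBasis σ V J) (hxV : f.toFun x ∈ V)
    {η : TangentSpace 𝓘(ℝ, E) (f.toFun x)} (hη : η ∈ f.nu σ D x) :
    ∃ (U : Set N) (ξ : ∀ y : N, TangentSpace 𝓘(ℝ, E) (f.toFun y)), IsOpen U ∧ x ∈ U ∧
      IsSectionAlong F f.toFun (f.nu σ D) U ξ ∧ ξ x = η := by
  obtain ⟨U, P, hP⟩ := f.exists_isProjectionFamily_perp hN.isDistribution x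
  refine exists_isSectionAlong_nu_of_factorization hN hg hP hJ hxV
    (j := (P x).range.subtypeL) (k := (P x).rangeRestrict) (fun w ↦ Subtype.ext ?_) (fun _ ↦ rfl) hη
  obtain ⟨v, hv⟩ := w.2
  exact (congrArg (P x) hv.symm).trans ((hP.apply_apply x hP.mem x hP.mem v).trans hv)

end NuCovectors

end NondegSubmanifold

end Extension

section PullBack

variable {F : Type*} [NormedAddCommGroup F] [NormedSpace ℝ F] [FiniteDimensional ℝ F]
  {G : Type*} [NormedAddCommGroup G] [NormedSpace ℝ G] [FiniteDimensional ℝ G]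

theorem exists_contMDiffAt_apply_eq {H : Type*} [NormedAddCommGroup H] [NormedSpace ℝ H]
    {L : Type*} [TopologicalSpace L] [ChartedSpace H L] {l : L} {B : L → G →L[ℝ] F} {ζ : L → F}
    (hB : ContMDiffAt 𝓘(ℝ, H) 𝓘(ℝ, G →L[ℝ] F) ∞ B l) (hinj : Function.Injective (B l))
    (hζ : ContMDiffAt 𝓘(ℝ, H) 𝓘(ℝ, F) ∞ ζ l) (hrange : ∀ᶠ y in 𝓝 l, ∃ w, B y w = ζ y) :
    ∃ w : L → G, ContMDiffAt 𝓘(ℝ, H) 𝓘(ℝ, G) ∞ w l ∧ ∀ᶠ y in 𝓝 l, B y (w y) = ζ y := by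
  obtain ⟨r, hr⟩ := (B l).toLinearMap.exists_leftInverse_of_injective (LinearMap.ker_eq_bot.2 hinj)
  let R : F →L[ℝ] G := LinearMap.toContinuousLinearMap r
  have hRB : R.comp (B l) = ContinuousLinearEquiv.refl ℝ G := by
    ext w
    exact LinearMap.congr_fun hr w
  have hsmooth : ContMDiffAt 𝓘(ℝ, H) 𝓘(ℝ, G →L[ℝ] G) ∞ (fun y ↦ R.comp (B y)) l :=
    contMDiffAt_const.clm_comp hB
  have hinverse : ContDiffAt ℝ ∞ ContinuousLinearMap.inverse (R.comp (B l)) :=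
    hRB ▸ contDiffAt_map_inverse (ContinuousLinearEquiv.refl ℝ G)
  have hinvertible : ∀ᶠ y in 𝓝 l, R.comp (B y) ∈ Set.range ((↑) : (G ≃L[ℝ] G) → G →L[ℝ] G) :=
    hsmooth.continuousAt.preimage_mem_nhds (ContinuousLinearEquiv.isOpen.mem_nhds ⟨_, hRB.symm⟩)
  refine ⟨fun y ↦ ContinuousLinearMap.inverse (R.comp (B y)) (R (ζ y)),
    (hinverse.contMDiffAt.comp l hsmooth).clm_apply (contMDiffAt_const.clm_apply hζ), ?_⟩
  filter_upwards [hrange, hinvertible]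
  rintro y ⟨w, hw⟩ ⟨e, he⟩
  have hRζ : R (ζ y) = e w := hw ▸ (congr($he w)).symm
  rw [hRζ, ← he, ContinuousLinearMap.inverse_equiv, ← hw]
  exact congrArg (B y) (e.symm_apply_apply w)

variable {N : Type*} [TopologicalSpace N] [ChartedSpace F N] [IsManifold 𝓘(ℝ, F) ∞ N]
  {L : Type*} [TopologicalSpace L] [ChartedSpace G L] [IsManifold 𝓘(ℝ, G) ∞ L]

theorem exists_smoothAlongAt_mfderiv_eq {ι : L → N} (hι : ContMDiff 𝓘(ℝ, G) 𝓘(ℝ, F) ∞ ι)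
    {l : L} (hinj : Function.Injective (mfderiv 𝓘(ℝ, G) 𝓘(ℝ, F) ι l))
    {Z : ∀ y : N, TangentSpace 𝓘(ℝ, F) y} (hZ : SmoothAlongAt F id (ι l) Z)
    (hrange : ∀ᶠ l' in 𝓝 l, Z (ι l') ∈ (mfderiv 𝓘(ℝ, G) 𝓘(ℝ, F) ι l').range) :
    ∃ Y : ∀ l' : L, TangentSpace 𝓘(ℝ, G) l', SmoothAlongAt G id l Y ∧
      ∀ᶠ l' in 𝓝 l, mfderiv 𝓘(ℝ, G) 𝓘(ℝ, F) ι l' (Y l') = Z (ι l') := by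
  have hsourceN := mem_chart_source F (ι l)
  have hsourceL := mem_chart_source G l
  let B : L → G →L[ℝ] F := fun l' ↦
    (toCoord (ι l) (ι l')).comp ((mfderiv 𝓘(ℝ, G) 𝓘(ℝ, F) ι l').comp (ofCoord l l'))
  have hB : ContMDiffAt 𝓘(ℝ, G) 𝓘(ℝ, G →L[ℝ] F) ∞ B l := contMDiffAt_clm_of_apply fun v ↦
    (smoothAlongAt_mfderiv hι (smoothAlongAt_ofCoord_const hsourceL v)).contMDiffAt_toCoord hsourceN
  have hBinj : Function.Injective (B l) :=
    (Function.LeftInverse.injective (ofCoord_toCoord hsourceN)).comp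
      (hinj.comp (Function.LeftInverse.injective (toCoord_ofCoord hsourceL)))
  have hζ : ContMDiffAt 𝓘(ℝ, G) 𝓘(ℝ, F) ∞ (fun l' ↦ toCoord (ι l) (ι l') (Z (ι l'))) l :=
    SmoothAlongAt.contMDiffAt_toCoord (φ := id ∘ ι) (hZ.comp hι.contMDiffAt) hsourceN
  have hBrange : ∀ᶠ l' in 𝓝 l, ∃ w, B l' w = toCoord (ι l) (ι l') (Z (ι l')) := by
    filter_upwards [hrange, (chartAt G l).open_source.mem_nhds hsourceL]
    rintro l' ⟨t, ht⟩ hl'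
    refine ⟨toCoord l l' t, congrArg (toCoord (ι l) (ι l')) (Eq.trans ?_ ht)⟩
    exact congrArg (mfderiv 𝓘(ℝ, G) 𝓘(ℝ, F) ι l') (ofCoord_toCoord hl' t)
  obtain ⟨w, hw, hBw⟩ := exists_contMDiffAt_apply_eq hB hBinj hζ hBrange
  refine ⟨fun l' ↦ ofCoord l l' (w l'),
    smoothAlongAt_ofCoord (φ := id) (x := l) hsourceL contMDiffAt_id hw, ?_⟩
  filter_upwards [hBw, eventually_mem_chartAt_source hι.continuous.continuousAt hsourceN]
    with l' hl' hsource'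
  exact Function.LeftInverse.injective (ofCoord_toCoord hsource') hl'

end PullBack

section Equivalences

variable {E : Type*} [NormedAddCommGroup E] [NormedSpace ℝ E] [FiniteDimensional ℝ E]
  {M : Type*} [TopologicalSpace M] [ChartedSpace E M] [IsManifold 𝓘(ℝ, E) ∞ M]
  {g : SemiRiemannianMetric E M}
  {F : Type*} [NormedAddCommGroup F] [NormedSpace ℝ F] [FiniteDimensional ℝ F]
  {N : Type*} [TopologicalSpace N] [ChartedSpace F N] [IsManifold 𝓘(ℝ, F) ∞ N]
  {σ : ∀ p : M, Submodule ℝ (TangentSpace 𝓘(ℝ, E) p →L[ℝ] TangentSpace 𝓘(ℝ, E) p)}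
  {D : ∀ x : N, Submodule ℝ (TangentSpace 𝓘(ℝ, F) x)}

namespace NondegSubmanifold

theorem secondFundamentalForm_eq (f : NondegSubmanifold g F N)
    (X : ∀ y : N, TangentSpace 𝓘(ℝ, F) y) {Y : ∀ y : N, TangentSpace 𝓘(ℝ, F) y} {U : Set N}
    (hY : SmoothOn U Y) (hU : IsOpen U) {x : N} (hx : x ∈ U) :
    f.secondFundamentalForm X Y x = f.secondForm x (X x) (Y x) :=
  f.normalPart_covAlong (hY.smoothAlongAt hU hx) (X x)

theorem forall_secondFundamentalForm_iff (f : NondegSubmanifold g F N)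
    {D' : ∀ x : N, Submodule ℝ (TangentSpace 𝓘(ℝ, F) x)} (hD : HasLocalSections D)
    (hD' : HasLocalSections D') (p : ∀ x, TangentSpace 𝓘(ℝ, E) (f.toFun x) → Prop) :
    (∀ U : Set N, IsOpen U → ∀ X Y : ∀ y : N, TangentSpace 𝓘(ℝ, F) y,
        IsSection D U X → IsSection D' U Y → ∀ x ∈ U, p x (f.secondFundamentalForm X Y x)) ↔
      ∀ x, ∀ u ∈ D x, ∀ w ∈ D' x, p x (f.secondForm x u w) := by
  refine ⟨fun h x u hu w hw ↦ ?_, fun h U hU X Y hX hY x hx ↦ ?_⟩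
  · obtain ⟨U, X, Y, hU, hx, -, hX, hY, rfl, rfl⟩ :=
      hD.exists_isSection_pair hD' isOpen_univ (Set.mem_univ x) hu hw
    rw [← f.secondFundamentalForm_eq X hY.smooth hU hx]
    exact h U hU X Y hX hY x hx
  · rw [f.secondFundamentalForm_eq X hY.smooth hU hx]
    exact h x _ (hX.mem x hx) _ (hY.mem x hx)

theorem isTotallyGeodesic_iff (f : NondegSubmanifold g F N) :
    f.IsTotallyGeodesic ↔ ∀ x u w, f.secondForm x u w = 0 := by
  have hpointwise := f.forall_secondFundamentalForm_iff hasLocalSections_top hasLocalSections_top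
    fun _ b ↦ b = 0
  simp only [isSection_top, Submodule.mem_top, forall_const] at hpointwise
  exact hpointwise

variable (f : NondegSubmanifold g F N)
  (σ : ∀ p : M, Submodule ℝ (TangentSpace 𝓘(ℝ, E) p →L[ℝ] TangentSpace 𝓘(ℝ, E) p))
  (D : ∀ x : N, Submodule ℝ (TangentSpace 𝓘(ℝ, F) x))

/-- Pointwise form of: `B(X, Z) = 0` and `B(X, Y) ∈ Γ(ν)` for `X, Z ∈ Γ(D^⊥)`, `Y ∈ Γ(TN)`. All the
conditions of the theorem are compared with this one. -/
structure SecondFormCondition : Prop where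
  eq_zero : ∀ x, ∀ u ∈ f.perp D x, ∀ z ∈ f.perp D x, f.secondForm x u z = 0
  mem_nu : ∀ x, ∀ u ∈ f.perp D x, ∀ w, f.secondForm x u w ∈ f.nu σ D x

/-- The covariant derivatives in `M` of sections of `D^⊥`, in the directions of `D^⊥`, are in
`D^⊥`. -/
def IsPerpParallel : Prop :=
  ∀ (Z : ∀ y : N, TangentSpace 𝓘(ℝ, F) y) (x : N), SmoothAlongAt F id x Z →
    (∀ᶠ y in 𝓝 x, Z y ∈ f.perp D y) → ∀ u ∈ f.perp D x, ∃ t ∈ f.perp D x,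
      g.covAlong f.toFun (fun y ↦ f.d y (Z y)) x u = f.d x t

variable {f σ D}

theorem isPerpGeodesic_iff (hD : IsDistribution D) :
    f.IsPerpGeodesic D ↔
      ∀ x, ∀ u ∈ f.perp D x, ∀ z ∈ f.perp D x, f.secondForm x u z = 0 :=
  f.forall_secondFundamentalForm_iff (f.hasLocalSections_perp hD) (f.hasLocalSections_perp hD)
    fun _ b ↦ b = 0

theorem secondFormCondition_iff_isPerpGeodesic (hN : f.IsParaquaternionicCR σ D) :
    f.SecondFormCondition σ D ↔ f.IsPerpGeodesic D ∧
      ∀ U : Set N, IsOpen U → ∀ X Y : ∀ y : N, TangentSpace 𝓘(ℝ, F) y,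
        IsSection D U X → IsSection (f.perp D) U Y →
        ∀ x ∈ U, f.secondFundamentalForm X Y x ∈ f.nu σ D x := by
  have hD := hN.isDistribution
  rw [isPerpGeodesic_iff hD, f.forall_secondFundamentalForm_iff hD.hasLocalSections
    (f.hasLocalSections_perp hD) fun x b ↦ b ∈ f.nu σ D x]
  refine ⟨fun h ↦ ⟨h.eq_zero, fun x w _ u hu ↦ ?_⟩,
    fun ⟨hzero, hmixed⟩ ↦ ⟨hzero, fun x u hu w ↦ ?_⟩⟩
  · exact f.secondForm_symm x u w ▸ h.mem_nu x u hu w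
  · obtain ⟨w, hw, z, hz, rfl⟩ := f.exists_mem_add_mem_perp (hN.nondegenerate x) w
    rw [f.secondForm_add, hzero x u hu z hz, add_zero, f.secondForm_symm]
    exact hmixed x w hw u hu

variable (hM : IsParaquaternionicKahler g σ) (hN : f.IsParaquaternionicCR σ D)
  {V : Set M} {J : Fin 3 → ∀ p : M, TangentSpace 𝓘(ℝ, E) p →L[ℝ] TangentSpace 𝓘(ℝ, E) p}
  (hJ : IsCanonicalBasis σ V J) {Z : ∀ y : N, TangentSpace 𝓘(ℝ, F) y} {x : N}
  (hx : f.toFun x ∈ V)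

section Pointwise

variable (hZ : SmoothAlongAt F id x Z)

include hN hJ hx hZ

include hM in
theorem exists_normalConnection_apply (hZx : Z x ∈ f.perp D x) (α : Fin 3)
    {X : ∀ y : N, TangentSpace 𝓘(ℝ, F) y} (hnu : f.secondForm x (X x) (Z x) ∈ f.nu σ D x) :
    ∃ m ∈ f.nuPerp σ D x, f.normalConnection X (fun y ↦ J α (f.toFun y) (f.d y (Z y))) x
      = m + J α (f.toFun x) (f.secondForm x (X x) (Z x)) := by
  obtain ⟨η, hη, hcov⟩ := hM.exists_covAlong_apply hJ hx hZ hZx α (X x)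
  have hgauss := f.tangentPart_add_normalPart x
    (g.covAlong f.toFun (fun y ↦ f.d y (Z y)) x (X x))
  rw [f.normalPart_covAlong hZ] at hgauss
  obtain ⟨w, hw, z, hz, hwz⟩ := f.exists_mem_add_mem_perp (hN.nondegenerate x)
    (f.tangentPart x (g.covAlong f.toFun (fun y ↦ f.d y (Z y)) x (X x)))
  obtain ⟨w', -, hw'⟩ := hN.exists_apply_eq hJ hx α hw
  have hJz := hJ.apply_mem_nuPerp hx α hz
  refine ⟨J α (f.toFun x) (f.d x z) + η, add_mem hJz hη, ?_⟩
  rw [normalConnection, hcov, ← hgauss, hwz, map_add, map_add, map_add, hw', add_assoc, add_assoc,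
    f.normalPart_d_add]
  · abel
  · exact add_mem (hN.nuPerp_le_normalSpace hJ hx hJz)
      (add_mem (hN.apply_mem_nu hJ hx hM.adapted α hnu).1 (hN.nuPerp_le_normalSpace hJ hx hη))

include hM in
theorem normalConnection_apply_mem_nuPerp_iff (hZx : Z x ∈ f.perp D x) (α : Fin 3)
    {X : ∀ y : N, TangentSpace 𝓘(ℝ, F) y} (hnu : f.secondForm x (X x) (Z x) ∈ f.nu σ D x) :
    f.normalConnection X (fun y ↦ J α (f.toFun y) (f.d y (Z y))) x ∈ f.nuPerp σ D x ↔
      f.secondForm x (X x) (Z x) = 0 := by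
  obtain ⟨m, hm, hconn⟩ := exists_normalConnection_apply hM hN hJ hx hZ hZx α hnu
  rw [hconn, Submodule.add_mem_iff_right _ hm]
  refine ⟨fun hnuPerp ↦ hJ.injective hx α ?_, fun hzero ↦ ?_⟩
  · rw [map_zero]
    exact hN.eq_zero_of_mem_nu_of_mem_nuPerp hJ hx hM.adapted
      (hN.apply_mem_nu hJ hx hM.adapted α hnu) hnuPerp
  · rw [hzero, map_zero]
    exact zero_mem _

theorem shape_apply_eq_zero_iff (hZp : ∀ᶠ y in 𝓝 x, Z y ∈ f.perp D y) (α : Fin 3)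
    (X : ∀ y : N, TangentSpace 𝓘(ℝ, F) y) :
    f.shape (fun y ↦ J α (f.toFun y) (f.d y (Z y))) X x = 0 ↔
      ∀ w, g.val (f.toFun x) (J α (f.toFun x) (f.d x (Z x))) (f.secondForm x (X x) w) = 0 := by
  have hinduced (w : TangentSpace 𝓘(ℝ, F) x) := f.induced_shape
    (hJ.smoothAlongAt_apply hx hZ α) (hN.eventually_apply_mem_normalSpace hJ hx hZp α) X w
  refine ⟨fun hzero w ↦ ?_, fun h ↦ f.nondegenerate x _ fun w ↦ (hinduced w).trans (h w)⟩
  rw [← hinduced, hzero, map_zero, LinearMap.zero_apply]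

end Pointwise

theorem shape_mem_iff (hDx : ∀ u ∈ D x, (∀ w ∈ D x, f.induced x u w = 0) → u = 0)
    {ξ : ∀ y : N, TangentSpace 𝓘(ℝ, E) (f.toFun y)} (hξ : SmoothAlongAt F f.toFun x ξ)
    (hn : ∀ᶠ y in 𝓝 x, ξ y ∈ f.normalSpace y) (X : ∀ y : N, TangentSpace 𝓘(ℝ, F) y) :
    f.shape ξ X x ∈ D x ↔
      ∀ z ∈ f.perp D x, g.val (f.toFun x) (ξ x) (f.secondForm x (X x) z) = 0 := by
  refine ⟨fun hmem z hz ↦ ?_, fun h ↦ f.mem_of_perp_perp hDx fun z hz ↦ ?_⟩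
  · rw [← f.induced_shape hξ hn, f.induced_symm]
    exact hz _ hmem
  · rw [f.induced_shape hξ hn, h z hz]

include hM hN

theorem secondFormCondition_iff_nuPerp_parallel : f.SecondFormCondition σ D ↔
      (∀ (V : Set M) (J : Fin 3 → ∀ p : M, TangentSpace 𝓘(ℝ, E) p →L[ℝ] TangentSpace 𝓘(ℝ, E) p),
        IsCanonicalBasis σ V J →
        ∀ U : Set N, IsOpen U → U ⊆ f.toFun ⁻¹' V → ∀ X Z : ∀ y : N, TangentSpace 𝓘(ℝ, F) y,
          IsSection (f.perp D) U X → IsSection (f.perp D) U Z →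
          ∀ α : Fin 3, ∀ x ∈ U,
            f.normalConnection X (fun y ↦ J α (f.toFun y) (f.d y (Z y))) x ∈ f.nuPerp σ D x) ∧
        (∀ U : Set N, IsOpen U → ∀ X Y : ∀ y : N, TangentSpace 𝓘(ℝ, F) y,
          IsSection (f.perp D) U X → SmoothOn U Y →
          ∀ x ∈ U, f.secondFundamentalForm X Y x ∈ f.nu σ D x) := by
  have hperp := f.hasLocalSections_perp hN.isDistribution
  have hmem_nu := f.forall_secondFundamentalForm_iff hperp hasLocalSections_top
    fun x b ↦ b ∈ f.nu σ D x
  simp only [isSection_top, Submodule.mem_top, forall_const] at hmem_nu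
  rw [hmem_nu]
  refine ⟨fun h ↦ ⟨fun V J hJ U hU hUV X Z hX hZ α x hx ↦ ?_, h.mem_nu⟩,
    fun ⟨hparallel, hnu⟩ ↦ ⟨fun x u hu z hz ↦ ?_, hnu⟩⟩
  · have hXx := hX.mem x hx
    exact (normalConnection_apply_mem_nuPerp_iff hM hN hJ (hUV hx) (hZ.smooth.smoothAlongAt hU hx)
      (hZ.mem x hx) α (h.mem_nu x _ hXx _)).2 (h.eq_zero x _ hXx _ (hZ.mem x hx))
  · obtain ⟨V, hxV, J, hJ⟩ := hM.almost (f.toFun x)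
    obtain ⟨U, X, Z, hU, hx, hUV, hX, hZ, rfl, rfl⟩ := hperp.exists_isSection_pair hperp
      (hJ.isOpen.preimage f.contMDiff.continuous) hxV hu hz
    exact (normalConnection_apply_mem_nuPerp_iff hM hN hJ hxV (hZ.smooth.smoothAlongAt hU hx)
      hz 0 (hnu x _ hu _)).1 (hparallel V J hJ U hU hUV X Z hX hZ 0 x hx)

theorem forall_shape_apply_eq_zero_iff :
    (∀ (V : Set M) (J : Fin 3 → ∀ p : M, TangentSpace 𝓘(ℝ, E) p →L[ℝ] TangentSpace 𝓘(ℝ, E) p),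
      IsCanonicalBasis σ V J →
      ∀ U : Set N, IsOpen U → U ⊆ f.toFun ⁻¹' V → ∀ X Z : ∀ y : N, TangentSpace 𝓘(ℝ, F) y,
        IsSection (f.perp D) U X → IsSection (f.perp D) U Z →
        ∀ α : Fin 3, ∀ x ∈ U, f.shape (fun y ↦ J α (f.toFun y) (f.d y (Z y))) X x = 0) ↔
      ∀ x, ∀ u ∈ f.perp D x, ∀ w, f.secondForm x u w ∈ f.nu σ D x := by
  have hperp := f.hasLocalSections_perp hN.isDistribution
  refine ⟨fun hshape x u hu w ↦ ?_, fun hnu V J hJ U hU hUV X Z hX hZ α x hx ↦ ?_⟩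
  · obtain ⟨V, hxV, J, hJ⟩ := hM.almost (f.toFun x)
    refine (hJ.mem_nu_iff hxV).2 ⟨f.secondForm_mem x _ _, fun α z hz ↦ ?_⟩
    obtain ⟨U, X, Z, hU, hx, hUV, hX, hZ, rfl, rfl⟩ := hperp.exists_isSection_pair hperp
      (hJ.isOpen.preimage f.contMDiff.continuous) hxV hu hz
    rw [g.symm]
    exact (shape_apply_eq_zero_iff hN hJ hxV (hZ.smooth.smoothAlongAt hU hx)
      (hZ.eventually_mem hU hx) α X).1 (hshape V J hJ U hU hUV X Z hX hZ α x hx) w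
  · refine (shape_apply_eq_zero_iff hN hJ (hUV hx) (hZ.smooth.smoothAlongAt hU hx)
      (hZ.eventually_mem hU hx) α X).2 fun w ↦ ?_
    rw [g.symm]
    exact (hnu x _ (hX.mem x hx) w).2 _ (hJ.apply_mem_nuPerp (hUV hx) α (hZ.mem x hx))

theorem secondFormCondition_iff_shape : f.SecondFormCondition σ D ↔
      (∀ (V : Set M) (J : Fin 3 → ∀ p : M, TangentSpace 𝓘(ℝ, E) p →L[ℝ] TangentSpace 𝓘(ℝ, E) p),
        IsCanonicalBasis σ V J →
        ∀ U : Set N, IsOpen U → U ⊆ f.toFun ⁻¹' V → ∀ X Z : ∀ y : N, TangentSpace 𝓘(ℝ, F) y,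
          IsSection (f.perp D) U X → IsSection (f.perp D) U Z →
          ∀ α : Fin 3, ∀ x ∈ U,
            f.shape (fun y ↦ J α (f.toFun y) (f.d y (Z y))) X x = 0) ∧
        (∀ U : Set N, IsOpen U → ∀ X : ∀ y : N, TangentSpace 𝓘(ℝ, F) y,
          IsSection (f.perp D) U X →
          ∀ ξ : ∀ y : N, TangentSpace 𝓘(ℝ, E) (f.toFun y),
            IsSectionAlong F f.toFun (f.nu σ D) U ξ →
            ∀ x ∈ U, f.shape ξ X x ∈ D x) := by
  rw [forall_shape_apply_eq_zero_iff hM hN]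
  have hnormal {U : Set N} {ξ : ∀ y : N, TangentSpace 𝓘(ℝ, E) (f.toFun y)} {x : N} (hU : IsOpen U)
      (hx : x ∈ U) (hξ : IsSectionAlong F f.toFun (f.nu σ D) U ξ) :
      ∀ᶠ y in 𝓝 x, ξ y ∈ f.normalSpace y :=
    Filter.eventually_of_mem (hU.mem_nhds hx) fun y hy ↦ (hξ.mem y hy).1
  refine ⟨fun h ↦ ⟨h.mem_nu, fun U hU X hX ξ hξ x hx ↦ ?_⟩,
    fun ⟨hnu, hshape⟩ ↦ ⟨fun x u hu z hz ↦ ?_, hnu⟩⟩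
  · refine (shape_mem_iff (hN.nondegenerate x) (hξ.smooth.smoothAlongAt hU hx)
      (hnormal hU hx hξ) X).2 fun z hz ↦ ?_
    rw [h.eq_zero x _ (hX.mem x hx) z hz, map_zero]
  · obtain ⟨V, hxV, J, hJ⟩ := hM.almost (f.toFun x)
    refine hN.eq_zero_of_mem_normalSpace hJ hxV hM.adapted (f.secondForm_mem x _ _)
      (hnu x u hu z).2 fun η hη ↦ ?_
    obtain ⟨U, ξ, hU, hx, hξ, rfl⟩ := hN.exists_isSectionAlong_nu hM.adapted hJ hxV hη
    obtain ⟨U', X, hU', hx', hX, rfl⟩ := f.hasLocalSections_perp hN.isDistribution x u hu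
    have hmem := hshape (U ∩ U') (hU.inter hU') X (hX.mono Set.inter_subset_right) ξ
      ⟨hξ.smooth.mono Set.inter_subset_left, fun y hy ↦ hξ.mem y hy.1⟩ x ⟨hx, hx'⟩
    rw [g.symm]
    exact (shape_mem_iff (hN.nondegenerate x) (hξ.smooth.smoothAlongAt hU hx)
      (hnormal hU hx hξ) X).1 hmem z hz

theorem SecondFormCondition.isPerpParallel (h : f.SecondFormCondition σ D) :
    f.IsPerpParallel D := by
  intro Z x hZ hZp u hu
  have hZx := hZp.self_of_nhds
  obtain ⟨V, hxV, J, hJ⟩ := hM.almost (f.toFun x)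
  have hgauss := f.tangentPart_add_normalPart x (g.covAlong f.toFun (fun y ↦ f.d y (Z y)) x u)
  rw [f.normalPart_covAlong hZ, h.eq_zero x u hu _ hZx, add_zero] at hgauss
  refine ⟨_, fun w hw ↦ ?_, hgauss.symm⟩
  obtain ⟨w', -, hw'⟩ := hN.exists_eq_apply hJ hxV 0 hw
  rw [f.induced_apply, hgauss, hw', hN.val_covAlong_apply hM hJ hxV hZ hZp, g.symm]
  exact (h.mem_nu x u hu w').2 _ (hJ.apply_mem_nuPerp hxV 0 hZx)

theorem IsPerpParallel.secondFormCondition (h : f.IsPerpParallel D) :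
    f.SecondFormCondition σ D := by
  refine ⟨fun x u hu z hz ↦ ?_, fun x u hu w ↦ ?_⟩
  · obtain ⟨U, Z, hU, hx, hZ, rfl⟩ := f.hasLocalSections_perp hN.isDistribution x z hz
    have hZs := hZ.smooth.smoothAlongAt hU hx
    obtain ⟨t, -, ht⟩ := h Z x hZs (hZ.eventually_mem hU hx) u hu
    rw [← f.normalPart_covAlong hZs, ht, f.normalPart_d]
  · obtain ⟨V, hxV, J, hJ⟩ := hM.almost (f.toFun x)
    refine (hJ.mem_nu_iff hxV).2 ⟨f.secondForm_mem x _ _, fun α z hz ↦ ?_⟩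
    obtain ⟨U, Z, hU, hx, hZ, rfl⟩ := f.hasLocalSections_perp hN.isDistribution x z hz
    have hZs := hZ.smooth.smoothAlongAt hU hx
    have hZp := hZ.eventually_mem hU hx
    obtain ⟨t, ht, hcov⟩ := h Z x hZs hZp u hu
    obtain ⟨v, hv, v', hv', rfl⟩ := f.exists_mem_add_mem_perp (hN.nondegenerate x) w
    obtain ⟨v'', hv'', hJv⟩ := hN.exists_apply_eq hJ hxV α hv
    rw [g.symm, ← hN.val_covAlong_apply hM hJ hxV hZs hZp, hcov, map_add, map_add, map_add, hJv,
      ← f.induced_apply, ht v'' hv'', g.symm, hN.totallyReal V J hJ x hxV α v' hv', add_zero]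

end NondegSubmanifold

end Equivalences

section Leaves

variable {E : Type*} [NormedAddCommGroup E] [NormedSpace ℝ E]
  {M : Type*} [TopologicalSpace M] [ChartedSpace E M] [IsManifold 𝓘(ℝ, E) ∞ M]
  {g : SemiRiemannianMetric E M}
  {F : Type*} [NormedAddCommGroup F] [NormedSpace ℝ F]

section Integrability

variable [FiniteDimensional ℝ E] {N : Type u} [TopologicalSpace N] [ChartedSpace F N]
  [IsManifold 𝓘(ℝ, F) ∞ N]

variable (g) in
theorem mfderiv_ofCoord_projectionBracket {φ : N → M} (hφ : ContMDiff 𝓘(ℝ, F) 𝓘(ℝ, E) ∞ φ)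
    {x₀ y : N} (hy : y ∈ (chartAt F x₀).source) {P : N → F →L[ℝ] F}
    (hP : ContMDiffAt 𝓘(ℝ, F) 𝓘(ℝ, F →L[ℝ] F) ∞ P y) (v w : F) :
    mfderiv 𝓘(ℝ, F) 𝓘(ℝ, E) φ y (ofCoord x₀ y (projectionBracket x₀ P y v w))
      = g.covAlong φ (fun z ↦ mfderiv 𝓘(ℝ, F) 𝓘(ℝ, E) φ z (ofCoord x₀ z (P z w))) y
          (ofCoord x₀ y (P y v))
        - g.covAlong φ (fun z ↦ mfderiv 𝓘(ℝ, F) 𝓘(ℝ, E) φ z (ofCoord x₀ z (P z v))) y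
          (ofCoord x₀ y (P y w)) := by
  have hfield (v : F) : SmoothAlongAt F id y (fun z ↦ ofCoord x₀ z (P z v)) :=
    smoothAlongAt_ofCoord (φ := id) (x := y) hy contMDiffAt_id (hP.clm_apply contMDiffAt_const)
  have hcoord (v : F) : mvfderiv 𝓘(ℝ, F) (fun z ↦ toCoord x₀ z (ofCoord x₀ z (P z v))) y
      = mvfderiv 𝓘(ℝ, F) (fun z ↦ P z v) y := mvfderiv_congr_of_eventuallyEq <| by
    filter_upwards [(chartAt F x₀).open_source.mem_nhds hy] with z hz using toCoord_ofCoord hz _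
  rw [g.covAlong_mfderiv hφ hy (hfield w), g.covAlong_mfderiv hφ hy (hfield v), hcoord, hcoord,
    g.chartHessian_symm (hφ y) hy, add_sub_add_left_eq_sub, ← map_sub, ← map_sub,
    projectionBracket]

variable [FiniteDimensional ℝ F] {f : NondegSubmanifold g F N}
  {D : ∀ x : N, Submodule ℝ (TangentSpace 𝓘(ℝ, F) x)}

theorem NondegSubmanifold.IsPerpParallel.exists_isIntegralManifold (h : f.IsPerpParallel D)
    (hD : IsDistribution D) (x : N) :
    ∃ (s : ℕ) (L : Type u) (_ : TopologicalSpace L)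
      (_ : ChartedSpace (EuclideanSpace ℝ (Fin s)) L)
      (_ : IsManifold 𝓘(ℝ, EuclideanSpace ℝ (Fin s)) ∞ L) (ι : L → N),
      IsIntegralManifold (G := EuclideanSpace ℝ (Fin s)) (f.perp D) ι ∧ x ∈ Set.range ι := by
  obtain ⟨U, P, hP⟩ := f.exists_isProjectionFamily_perp hD x
  refine PQ.exists_isIntegralManifold hP fun y hy v w ↦ ?_
  have hparallel (v w : F) : ∃ t ∈ f.perp D y,
      g.covAlong f.toFun (fun z ↦ f.d z (ofCoord x z (P z w))) y (ofCoord x y (P y v))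
        = f.d y t :=
    h _ y (smoothAlongAt_ofCoord (φ := id) (x := y) (hP.subset_source hy) contMDiffAt_id
      ((hP.contMDiffAt y hy).clm_apply contMDiffAt_const))
      (by filter_upwards [hP.isOpen.mem_nhds hy] with z hz using hP.ofCoord_apply_mem z hz w)
      _ (hP.ofCoord_apply_mem y hy v)
  obtain ⟨t, ht, hvw⟩ := hparallel v w
  obtain ⟨t', ht', hwv⟩ := hparallel w v
  have hbracket : f.d y (ofCoord x y (projectionBracket x P y v w)) = f.d y (t - t') := by
    rw [map_sub, ← hvw, ← hwv]
    exact mfderiv_ofCoord_projectionBracket g f.contMDiff (hP.subset_source hy)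
      (hP.contMDiffAt y hy) v w
  rw [f.immersion y hbracket]
  exact sub_mem ht ht'

end Integrability

variable {N : Type*} [TopologicalSpace N] [ChartedSpace F N]
  {D : ∀ x : N, Submodule ℝ (TangentSpace 𝓘(ℝ, F) x)}
  {G : Type*} [NormedAddCommGroup G] [NormedSpace ℝ G]
  {L : Type*} [TopologicalSpace L] [ChartedSpace G L] {ι : L → N}

theorem IsIntegralManifold.mfderiv_mem (hι : IsIntegralManifold (G := G) D ι) {l : L}
    (u : TangentSpace 𝓘(ℝ, G) l) : mfderiv 𝓘(ℝ, G) 𝓘(ℝ, F) ι l u ∈ D (ι l) :=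
  hι.range_eq l ▸ ⟨u, rfl⟩

theorem IsIntegralManifold.exists_mfderiv_eq (hι : IsIntegralManifold (G := G) D ι) {l : L}
    {v : TangentSpace 𝓘(ℝ, F) (ι l)} (hv : v ∈ D (ι l)) :
    ∃ u, mfderiv 𝓘(ℝ, G) 𝓘(ℝ, F) ι l u = v := by
  rwa [← hι.range_eq] at hv

namespace NondegSubmanifold

variable [IsManifold 𝓘(ℝ, F) ∞ N] (f : NondegSubmanifold g F N)

theorem mfderiv_comp (hι : ContMDiff 𝓘(ℝ, G) 𝓘(ℝ, F) ∞ ι) (l : L)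
    (u : TangentSpace 𝓘(ℝ, G) l) :
    mfderiv 𝓘(ℝ, G) 𝓘(ℝ, E) (f.toFun ∘ ι) l u = f.d (ι l) (mfderiv 𝓘(ℝ, G) 𝓘(ℝ, F) ι l u) :=
  mfderiv_comp_apply l (f.contMDiff.mdifferentiableAt (by simp))
    (hι.mdifferentiableAt (by simp)) u

variable [FiniteDimensional ℝ E] [FiniteDimensional ℝ F] [FiniteDimensional ℝ G]
  [IsManifold 𝓘(ℝ, G) ∞ L]

theorem exists_restriction (hι : IsIntegralManifold (G := G) D ι) {l : L}
    {Z : ∀ y : N, TangentSpace 𝓘(ℝ, F) y} (hZ : SmoothAlongAt F id (ι l) Z)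
    (hZD : ∀ᶠ y in 𝓝 (ι l), Z y ∈ D y) :
    ∃ Y : ∀ l' : L, TangentSpace 𝓘(ℝ, G) l', SmoothAlongAt G id l Y ∧
      mfderiv 𝓘(ℝ, G) 𝓘(ℝ, F) ι l (Y l) = Z (ι l) ∧
      ∀ u : TangentSpace 𝓘(ℝ, G) l, g.covAlong (f.toFun ∘ ι)
          (fun l' ↦ mfderiv 𝓘(ℝ, G) 𝓘(ℝ, E) (f.toFun ∘ ι) l' (Y l')) l u
        = g.covAlong f.toFun (fun y ↦ f.d y (Z y)) (ι l) (mfderiv 𝓘(ℝ, G) 𝓘(ℝ, F) ι l u) := by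
  obtain ⟨Y, hY, hYZ⟩ := exists_smoothAlongAt_mfderiv_eq hι.contMDiff (hι.immersion l) hZ <| by
    filter_upwards [hι.contMDiff.continuous.continuousAt.eventually hZD] with l' hl'
    exact hι.exists_mfderiv_eq hl'
  refine ⟨Y, hY, hYZ.self_of_nhds, fun u ↦ ?_⟩
  refine (g.covAlong_congr ?_ u).trans
    (g.covAlong_comp (smoothAlongAt_mfderiv f.contMDiff hZ) hι.contMDiff.contMDiffAt u)
  filter_upwards [hYZ] with l' hl'
  exact (f.mfderiv_comp hι.contMDiff l' (Y l')).trans (congrArg (f.d (ι l')) hl')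

variable {f}

/-- An integral manifold of `D^⊥` as a submanifold of `M`. -/
def leaf (hD : ∀ x, ∀ u ∈ D x, (∀ w ∈ D x, f.induced x u w = 0) → u = 0)
    (hι : IsIntegralManifold (G := G) (f.perp D) ι) : NondegSubmanifold g G L where
  toFun := f.toFun ∘ ι
  contMDiff := f.contMDiff.comp hι.contMDiff
  immersion l a b hab := by
    rw [f.mfderiv_comp hι.contMDiff, f.mfderiv_comp hι.contMDiff] at hab
    exact hι.immersion l (f.immersion _ hab)
  nondegenerate l u hu := by
    have hdι : mfderiv 𝓘(ℝ, G) 𝓘(ℝ, F) ι l u = 0 := by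
      refine f.perp_nondegenerate (hD _) (hι.mfderiv_mem u) fun z hz ↦ ?_
      obtain ⟨w, rfl⟩ := hι.exists_mfderiv_eq hz
      have horth := hu w
      rwa [f.mfderiv_comp hι.contMDiff, f.mfderiv_comp hι.contMDiff] at horth
    exact hι.immersion l (hdι.trans (map_zero _).symm)

theorem IsPerpParallel.isTotallyGeodesic_leaf (h : f.IsPerpParallel D) (hdist : IsDistribution D)
    (hD : ∀ x, ∀ u ∈ D x, (∀ w ∈ D x, f.induced x u w = 0) → u = 0)
    (hι : IsIntegralManifold (G := G) (f.perp D) ι) : (leaf hD hι).IsTotallyGeodesic := by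
  refine (leaf hD hι).isTotallyGeodesic_iff.2 fun l u w ↦ ?_
  obtain ⟨U, Z, hU, hl, hZ, hZw⟩ := f.hasLocalSections_perp hdist (ι l) _ (hι.mfderiv_mem w)
  have hZsmooth := hZ.smooth.smoothAlongAt hU hl
  have hZperp := hZ.eventually_mem hU hl
  obtain ⟨Y, hY, hYZ, hcov⟩ := f.exists_restriction hι hZsmooth hZperp
  obtain ⟨t, ht, hZt⟩ := h Z (ι l) hZsmooth hZperp _ (hι.mfderiv_mem u)
  obtain ⟨t, rfl⟩ := hι.exists_mfderiv_eq ht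
  obtain rfl : Y l = w := hι.immersion l (hYZ.trans hZw)
  have htangent : g.covAlong (leaf hD hι).toFun (fun l' ↦ (leaf hD hι).d l' (Y l')) l u
      = (leaf hD hι).d l t :=
    ((hcov u).trans hZt).trans (f.mfderiv_comp hι.contMDiff l t).symm
  rw [← (leaf hD hι).normalPart_covAlong hY, htangent, normalPart_d]

theorem exists_covAlong_eq_of_isTotallyGeodesic (hι : IsIntegralManifold (G := G) D ι)
    {h : NondegSubmanifold g G L} (hcomp : h.toFun = f.toFun ∘ ι) (hgeo : h.IsTotallyGeodesic)
    {l : L} {Z : ∀ y : N, TangentSpace 𝓘(ℝ, F) y} (hZ : SmoothAlongAt F id (ι l) Z)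
    (hZD : ∀ᶠ y in 𝓝 (ι l), Z y ∈ D y) {u : TangentSpace 𝓘(ℝ, F) (ι l)} (hu : u ∈ D (ι l)) :
    ∃ t ∈ D (ι l), g.covAlong f.toFun (fun y ↦ f.d y (Z y)) (ι l) u = f.d (ι l) t := by
  obtain ⟨Y, hY, -, hcov⟩ := f.exists_restriction hι hZ hZD
  obtain ⟨u, rfl⟩ := hι.exists_mfderiv_eq hu
  have hgauss := h.tangentPart_add_normalPart l (g.covAlong h.toFun (fun l' ↦ h.d l' (Y l')) l u)
  rw [h.normalPart_covAlong hY, h.isTotallyGeodesic_iff.1 hgeo, add_zero] at hgauss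
  obtain ⟨k, hk, hki, hkn⟩ := h
  obtain rfl : k = f.toFun ∘ ι := hcomp
  exact ⟨_, hι.mfderiv_mem _,
    (hcov u).symm.trans (hgauss.symm.trans (f.mfderiv_comp hι.contMDiff l _))⟩

end NondegSubmanifold

theorem NondegSubmanifold.isTotallyRealRuled_iff [FiniteDimensional ℝ E] [FiniteDimensional ℝ F]
    {N : Type u} [TopologicalSpace N] [ChartedSpace F N] [IsManifold 𝓘(ℝ, F) ∞ N]
    {f : NondegSubmanifold g F N} {D : ∀ x : N, Submodule ℝ (TangentSpace 𝓘(ℝ, F) x)}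
    (hdist : IsDistribution D)
    (hD : ∀ x, ∀ u ∈ D x, (∀ w ∈ D x, f.induced x u w = 0) → u = 0) :
    f.IsTotallyRealRuled D ↔ f.IsPerpParallel D := by
  refine ⟨?_, fun h ↦ ⟨h.exists_isIntegralManifold hdist, fun s L _ _ _ ι hι ↦
    ⟨leaf hD hι, rfl, h.isTotallyGeodesic_leaf hdist hD hι⟩⟩⟩
  rintro ⟨hleaf, hgeodesic⟩ Z x hZ hZp u hu
  obtain ⟨s, L, _, _, _, ι, hι, l, rfl⟩ := hleaf x
  obtain ⟨h, hcomp, hgeo⟩ := hgeodesic s L ι hι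
  exact exists_covAlong_eq_of_isTotallyGeodesic hι hcomp hgeo hZ hZp hu

end Leaves

end PQ

end

theorem mainTheorem6
    {E : Type*} [NormedAddCommGroup E] [NormedSpace ℝ E] [FiniteDimensional ℝ E]
    {M : Type*} [TopologicalSpace M] [ChartedSpace E M] [IsManifold 𝓘(ℝ, E) ∞ M]
    {F : Type*} [NormedAddCommGroup F] [NormedSpace ℝ F] [FiniteDimensional ℝ F]
    {N : Type*} [TopologicalSpace N] [ChartedSpace F N] [IsManifold 𝓘(ℝ, F) ∞ N]
    (g : PQ.SemiRiemannianMetric E M)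
    (σ : ∀ p : M, Submodule ℝ (TangentSpace 𝓘(ℝ, E) p →L[ℝ] TangentSpace 𝓘(ℝ, E) p))
    (hM : PQ.IsParaquaternionicKahler g σ)
    (f : PQ.NondegSubmanifold g F N)
    (D : ∀ x : N, Submodule ℝ (TangentSpace 𝓘(ℝ, F) x))
    (hN : f.IsParaquaternionicCR σ D) :
    List.TFAE [
      f.IsTotallyRealRuled D,
      f.IsPerpGeodesic D ∧
        ∀ U : Set N, IsOpen U → ∀ X Y : ∀ y : N, TangentSpace 𝓘(ℝ, F) y,
          PQ.IsSection D U X → PQ.IsSection (f.perp D) U Y →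
          ∀ x ∈ U, f.secondFundamentalForm X Y x ∈ f.nu σ D x,
      (∀ (V : Set M) (J : Fin 3 → ∀ p : M, TangentSpace 𝓘(ℝ, E) p →L[ℝ] TangentSpace 𝓘(ℝ, E) p),
        PQ.IsCanonicalBasis σ V J →
        ∀ U : Set N, IsOpen U → U ⊆ f.toFun ⁻¹' V → ∀ X Z : ∀ y : N, TangentSpace 𝓘(ℝ, F) y,
          PQ.IsSection (f.perp D) U X → PQ.IsSection (f.perp D) U Z →
          ∀ α : Fin 3, ∀ x ∈ U,
            f.normalConnection X (fun y ↦ J α (f.toFun y) (f.d y (Z y))) x ∈ f.nuPerp σ D x) ∧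
        (∀ U : Set N, IsOpen U → ∀ X Y : ∀ y : N, TangentSpace 𝓘(ℝ, F) y,
          PQ.IsSection (f.perp D) U X → PQ.SmoothOn U Y →
          ∀ x ∈ U, f.secondFundamentalForm X Y x ∈ f.nu σ D x),
      (∀ (V : Set M) (J : Fin 3 → ∀ p : M, TangentSpace 𝓘(ℝ, E) p →L[ℝ] TangentSpace 𝓘(ℝ, E) p),
        PQ.IsCanonicalBasis σ V J →
        ∀ U : Set N, IsOpen U → U ⊆ f.toFun ⁻¹' V → ∀ X Z : ∀ y : N, TangentSpace 𝓘(ℝ, F) y,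
          PQ.IsSection (f.perp D) U X → PQ.IsSection (f.perp D) U Z →
          ∀ α : Fin 3, ∀ x ∈ U,
            f.shape (fun y ↦ J α (f.toFun y) (f.d y (Z y))) X x = 0) ∧
        (∀ U : Set N, IsOpen U → ∀ X : ∀ y : N, TangentSpace 𝓘(ℝ, F) y,
          PQ.IsSection (f.perp D) U X →
          ∀ ξ : ∀ y : N, TangentSpace 𝓘(ℝ, E) (f.toFun y),
            PQ.IsSectionAlong F f.toFun (f.nu σ D) U ξ →
            ∀ x ∈ U, f.shape ξ X x ∈ D x)] := by
  have ruled_iff : f.IsTotallyRealRuled D ↔ f.SecondFormCondition σ D :=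
    (PQ.NondegSubmanifold.isTotallyRealRuled_iff hN.isDistribution hN.nondegenerate).trans
      ⟨fun h ↦ h.secondFormCondition hM hN, fun h ↦ h.isPerpParallel hM hN⟩
  have perpGeodesic_iff := f.secondFormCondition_iff_isPerpGeodesic hN
  have nuPerp_iff := PQ.NondegSubmanifold.secondFormCondition_iff_nuPerp_parallel hM hN
  have shape_iff := PQ.NondegSubmanifold.secondFormCondition_iff_shape hM hN
  tfae_have 1 ↔ 2 := ruled_iff.trans perpGeodesic_iff
  tfae_have 2 ↔ 3 := perpGeodesic_iff.symm.trans nuPerp_iff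
  tfae_have 3 ↔ 4 := nuPerp_iff.symm.trans shape_iff
  tfae_finish
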